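/- Let $M$ be a smooth manifold (finite-dimensional, without boundary, Hausdorff, second countable), $V$ a finite-dimensional real vector space and $\sigma\colon M\to V$ a smooth function. Let $\mathcal X$ be the quasi-smooth dg-manifold of $\sigma$: its dg-algebra of functions is $C^\infty(\mathcal X)=C^\infty(M)\otimes_{\mathbb R}\bigwedge^{-\bullet}V^*$, with $\bigwedge^kV^*$ in degree $-k$ and with differential $\delta_{\mathcal X}=\iota_\sigma$, the contraction with $\sigma$. A $C^\infty$-derivation of degree $n$ of $C^\infty(\mathcal X)$ with values in a graded $C^\infty(\mathcal X)$-module $\mathcal M$ is an $\mathbb R$-linear map $d'\colon C^\infty(\mathcal X)\to\mathcal M$ of degree $n$ with $d'(fg)=d'(f)\,g+(-1)^{n|f|}f\,d'(g)$ and $d'(h(a_1,\dots,a_k))=\sum_i\frac{\partial h}{\partial x_i}(a_1,\dots,a_k)\,d'(a_i)$ for $a_1,\dots,a_k\in C^\infty(\mathcal X)_0$ and $h\in C^\infty(\mathbb R^k)$. A module of Kähler differentials (cotangent module) $T^*_{\mathcal X}$ is a dg-$C^\infty(\mathcal X)$-module with a $C^\infty$-derivation $d\colon C^\infty(\mathcal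 X)\to T^*_{\mathcal X}$ of degree $0$ which commutes with the differentials, such that every $C^\infty$-derivation $d'$ of any degree $n$ with values in a graded module $\mathcal M$ is $\phi\circ d$ for a unique map of graded modules $\phi\colon T^*_{\mathcal X}\to\mathcal M$ of degree $n$. The tangent module is the internal hom $T_{\mathcal X}=\underline{\mathrm{Hom}}_{C^\infty(\mathcal X)}(T^*_{\mathcal X},C^\infty(\mathcal X))$ with differential $\phi\mapsto\delta_{\mathcal X}\circ\phi-(-1)^{|\phi|}\phi\circ\delta$, where $\delta$ is the differential of $T^*_{\mathcal X}$. For a $C^\infty(M)$-module $T$ and a vector space $U$ put $\iota^*_{\mathcal X}T=C^\infty(\mathcal X)\otimes_{C^\infty(M)}T$ and $U_{\mathcal X}=C^\infty(\mathcal X)\otimes_{\mathbb R}U$, with the differentials $\delta_{\mathcal X}\otimes\mathrm{id}$; let $T_M$ and $T^*_M$ be the $C^\infty(M)$-modules of smooth vector fields and of smooth one-forms on $M$. Let $(d\sigma)^*\colon V^*_{\mathcal X}\to\iota^*_{\mathcal X}T^*_M$ be the $C^\infty(\mathcal X)$-linear map with $(d\sigma)^*(\alpha)=d\langle\sigma,\alpha\rangle$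 for $\alpha\in V^*$, and let $d\sigma\colon\iota^*_{\mathcal X}T_M\to V_{\mathcal X}$ be the dual map, $d\sigma(W)=W(\sigma)$ for $W\in T_M$. For a morphism $f\colon\mathcal M\to\mathcal N$ of dg-modules let $\mathrm{cone}(f)=\mathcal M[1]\oplus\mathcal N$ with differential $(m,n)\mapsto(-\delta m,\,f(m)+\delta n)$ and $\mathrm{cocone}(f)=\mathcal M\oplus\mathcal N[-1]$ with differential $(m,n)\mapsto(\delta m,\,f(m)-\delta n)$. (Maps of degree $n$ and shifts follow the Koszul sign rule: $\phi(a\,m)=(-1)^{n|a|}a\,\phi(m)$, and $a$ acts on $\mathcal M[n]$ as $(-1)^{n|a|}a$.) Then a module of Kähler differentials of $\mathcal X$ exists: for a suitable $d$ the dg-module $\mathrm{cone}\bigl(V^*_{\mathcal X}\xrightarrow{(d\sigma)^*}\iota^*_{\mathcal X}T^*_M\bigr)$ is one. For every module of Kähler differentials $T^*_{\mathcal X}$, with tangent module $T_{\mathcal X}$, there are isomorphisms of dg-$C^\infty(\mathcal X)$-modules $$T^*_{\mathcal X}\cong\mathrm{cone}\bigl(V^*_{\mathcal X}\xrightarrow{(d\sigma)^*}\iota^*_{\mathcal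 X}T^*_M\bigr),\qquad T_{\mathcal X}\cong\mathrm{cocone}\bigl(\iota^*_{\mathcal X}T_M\xrightarrow{d\sigma}V_{\mathcal X}\bigr).$$ -/

import Mathlib

open scoped Manifold ContDiff Bundle TensorProduct

universe u v w u₁

noncomputable section

namespace DGManifold

/-! ### Smooth functions, vector fields and one-forms on a manifold -/

section Manifold
variable {E : Type*} [NormedAddCommGroup E] [NormedSpace ℝ E] {M : Type*} [TopologicalSpace M] [ChartedSpace E M]

section
variable (E M)
/-- The algebra `C^∞(M)` of smooth real functions on `M`. -/
abbrev SmoothFun : Type _ := C^∞⟮𝓘(ℝ, E), M; ℝ⟯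
variable [IsManifold 𝓘(ℝ, E) ∞ M]
/-- The module of smooth vector fields on `M`: smooth sections of the tangent bundle. -/
abbrev VectorFields : Type _ :=
  Cₛ^∞⟮𝓘(ℝ, E); E, (TangentSpace 𝓘(ℝ, E) : M → Type _)⟯
/-- The module of smooth one-forms on `M`: smooth sections of the cotangent bundle. -/
abbrev OneForms : Type _ :=
  Cₛ^∞⟮𝓘(ℝ, E); E →L[ℝ] ℝ, fun x : M => TangentSpace 𝓘(ℝ, E) x →L[ℝ] Bundle.Trivial M ℝ x⟯
end

section SectionModule
variable {F : Type*} [NormedAddCommGroup F] [NormedSpace ℝ F] {Z : M → Type*}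
  [TopologicalSpace (Bundle.TotalSpace F Z)] [∀ x, AddCommGroup (Z x)] [∀ x, Module ℝ (Z x)]
  [∀ x, TopologicalSpace (Z x)] [FiberBundle F Z] [VectorBundle ℝ F Z]

/-- The pointwise action of `C^∞(M)` on the smooth sections of a vector bundle. -/
instance sectionSMul : SMul (SmoothFun E M) Cₛ^∞⟮𝓘(ℝ, E); F, Z⟯ :=
  ⟨fun f s => ⟨fun x => f x • s x, f.contMDiff.smul_section s.contMDiff⟩⟩

instance sectionModule : Module (SmoothFun E M) Cₛ^∞⟮𝓘(ℝ, E); F, Z⟯ where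
  smul_add f s t := by ext x; exact smul_add (f x) (s x) (t x)
  add_smul f g s := by ext x; exact add_smul (f x) (g x) (s x)
  mul_smul f g s := by ext x; exact mul_smul (f x) (g x) (s x)
  one_smul s := by ext x; exact one_smul ℝ (s x)
  zero_smul s := by ext x; exact zero_smul ℝ (s x)
  smul_zero f := by ext x; exact smul_zero (f x)

instance sectionTower : IsScalarTower ℝ (SmoothFun E M) Cₛ^∞⟮𝓘(ℝ, E); F, Z⟯ where
  smul_assoc c f s := by ext x; exact smul_assoc c (f x) (s x)
end SectionModule

variable [IsManifold 𝓘(ℝ, E) ∞ M]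

/-- The differential of a smooth function is a smooth section of the cotangent bundle. -/
theorem contMDiff_mfderiv (f : SmoothFun E M) :
    ContMDiff 𝓘(ℝ, E) (𝓘(ℝ, E).prod 𝓘(ℝ, E →L[ℝ] ℝ)) ∞ (fun x : M =>
      Bundle.TotalSpace.mk' (E →L[ℝ] ℝ)
        (E := fun x : M => TangentSpace 𝓘(ℝ, E) x →L[ℝ] Bundle.Trivial M ℝ x) x
        (mfderiv 𝓘(ℝ, E) 𝓘(ℝ, ℝ) f x)) := by
  intro x
  rw [contMDiffAt_hom_bundle]
  refine ⟨contMDiffAt_id, ?_⟩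
  have := (f.contMDiff x).mfderiv_const (m := ∞) (by simp)
  refine this.congr_of_eventuallyEq ?_
  filter_upwards with y
  ext v
  simp [inTangentCoordinates, ContinuousLinearMap.inCoordinates]
  rfl

/-- The exterior derivative `f ↦ df` from smooth functions to one-forms. -/
def exteriorD : SmoothFun E M →ₗ[ℝ] OneForms E M where
  toFun f := ⟨fun x => mfderiv 𝓘(ℝ, E) 𝓘(ℝ, ℝ) f x, contMDiff_mfderiv f⟩
  map_add' f g := ContMDiffSection.ext fun x =>
    mfderiv_add ((f.contMDiff x).mdifferentiableAt (by simp))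
      ((g.contMDiff x).mdifferentiableAt (by simp))
  map_smul' c f := ContMDiffSection.ext fun x =>
    const_smul_mfderiv ((f.contMDiff x).mdifferentiableAt (by simp)) c

/-- The pairing `⟨θ, W⟩` of a one-form and a vector field. -/
def pairing : OneForms E M →ₗ[SmoothFun E M] VectorFields E M →ₗ[SmoothFun E M] SmoothFun E M :=
  LinearMap.mk₂ _ (fun θ W => ⟨fun x => θ x (W x), fun x =>
      (Bundle.contMDiffAt_section x).1 ((θ.contMDiff.clm_bundle_apply W.contMDiff) x)⟩)
    (fun _ _ _ => rfl) (fun _ _ _ => rfl)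
    (fun θ W U => by ext x; exact map_add (θ x) _ _) (fun f θ W => by ext x; exact map_smul (θ x) _ _)
end Manifold

/-! ### Dg-algebras of functions, dg-modules, Kähler differentials -/

/-- The Koszul sign `(-1)ⁿ`. -/
def koszulSign (n : ℤ) : ℝ := (-1) ^ n

theorem koszulSign_add (m n : ℤ) : koszulSign (m + n) = koszulSign m * koszulSign n :=
  zpow_add₀ (by norm_num) m n

theorem koszulSign_mul_self (n : ℤ) : koszulSign n * koszulSign n = 1 := by
  rw [koszulSign, ← mul_zpow]; norm_num

theorem koszulSign_zero : koszulSign 0 = 1 := zpow_zero _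

theorem koszulSign_one : koszulSign 1 = -1 := zpow_one _

/-- Smooth functions `ℝⁿ → ℝ`. -/
structure CInfFun (n : ℕ) where
  toFun : (Fin n → ℝ) → ℝ
  smooth : ContDiff ℝ ∞ toFun

namespace CInfFun

/-- The coordinate function `xᵢ`. -/
def proj {n : ℕ} (i : Fin n) : CInfFun n := ⟨fun x => x i, contDiff_apply ℝ ℝ i⟩

/-- A constant function. -/
def const (n : ℕ) (c : ℝ) : CInfFun n := ⟨fun _ => c, contDiff_const⟩

/-- Pointwise sum. -/
def add {n : ℕ} (f g : CInfFun n) : CInfFun n :=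
  ⟨fun x => f.toFun x + g.toFun x, f.smooth.add g.smooth⟩

/-- Pointwise product. -/
def mul {n : ℕ} (f g : CInfFun n) : CInfFun n :=
  ⟨fun x => f.toFun x * g.toFun x, f.smooth.mul g.smooth⟩

/-- The composition `f(g₁, …, gₘ)`. -/
def comp {m n : ℕ} (f : CInfFun m) (g : Fin m → CInfFun n) : CInfFun n :=
  ⟨fun x => f.toFun fun i => (g i).toFun x,
    f.smooth.comp (contDiff_pi.2 fun i => (g i).smooth)⟩

/-- The partial derivative `∂f/∂xᵢ`. -/
def partialDeriv {n : ℕ} (f : CInfFun n) (i : Fin n) : CInfFun n :=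
  ⟨fun x => fderiv ℝ f.toFun x (Pi.single i 1),
    (f.smooth.fderiv_right (by simp)).clm_apply contDiff_const⟩

end CInfFun

/-- A graded-commutative dg-algebra over `ℝ` (differential of degree `1`) whose part of degree `0`
is a `C^∞`-ring compatibly with its algebra structure: the algebraic structure carried by the global
functions of a dg-manifold. Graded objects are families indexed by `ℤ`. Operations that shift degrees
take the equation between the degrees as an argument, so that no transport along equalities of
integers is needed. -/
structure CInfDGAlgebra where
  carrier : ℤ → Type u
  [instGroup : ∀ i, AddCommGroup (carrier i)]
  [instModule : ∀ i, Module ℝ (carrier i)]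
  mul : ∀ {i j k : ℤ}, i + j = k → carrier i →ₗ[ℝ] carrier j →ₗ[ℝ] carrier k
  one : carrier 0
  one_mul : ∀ {i : ℤ} (h : 0 + i = i) (a : carrier i), mul h one a = a
  mul_assoc : ∀ {i j k ij jk l : ℤ} (h₁ : i + j = ij) (h₂ : ij + k = l) (h₃ : j + k = jk)
    (h₄ : i + jk = l) (a : carrier i) (b : carrier j) (c : carrier k),
    mul h₂ (mul h₁ a b) c = mul h₄ a (mul h₃ b c)
  mul_comm : ∀ {i j k : ℤ} (h : i + j = k) (h' : j + i = k) (a : carrier i) (b : carrier j),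
    mul h a b = koszulSign (i * j) • mul h' b a
  d : ∀ {i j : ℤ}, i + 1 = j → carrier i →ₗ[ℝ] carrier j
  d_d : ∀ {i j k : ℤ} (h : i + 1 = j) (h' : j + 1 = k) (a : carrier i), d h' (d h a) = 0
  d_mul : ∀ {i j k i' j' k' : ℤ} (h : i + j = k) (hi : i + 1 = i') (hj : j + 1 = j')
    (hk : k + 1 = k') (h₁ : i' + j = k') (h₂ : i + j' = k') (a : carrier i) (b : carrier j),
    d hk (mul h a b) = mul h₁ (d hi a) b + koszulSign i • mul h₂ a (d hj b)
  op : ∀ {n : ℕ}, CInfFun n → (Fin n → carrier 0) → carrier 0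
  op_proj : ∀ {n : ℕ} (i : Fin n) (a : Fin n → carrier 0), op (CInfFun.proj i) a = a i
  op_comp : ∀ {m n : ℕ} (f : CInfFun m) (g : Fin m → CInfFun n) (a : Fin n → carrier 0),
    op (f.comp g) a = op f fun i => op (g i) a
  op_const : ∀ {n : ℕ} (c : ℝ) (a : Fin n → carrier 0), op (CInfFun.const n c) a = c • one
  op_add : ∀ {n : ℕ} (f g : CInfFun n) (a : Fin n → carrier 0),
    op (f.add g) a = op f a + op g a
  op_mul : ∀ {n : ℕ} (f g : CInfFun n) (a : Fin n → carrier 0),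
    op (f.mul g) a = mul (add_zero 0) (op f a) (op g a)

attribute [instance] CInfDGAlgebra.instGroup CInfDGAlgebra.instModule

/-- A graded module over the graded algebra underlying `A`. -/
structure GrModule (A : CInfDGAlgebra.{u}) where
  carrier : ℤ → Type w
  [instGroup : ∀ i, AddCommGroup (carrier i)]
  [instModule : ∀ i, Module ℝ (carrier i)]
  smul : ∀ {i j k : ℤ}, i + j = k → A.carrier i →ₗ[ℝ] carrier j →ₗ[ℝ] carrier k
  one_smul : ∀ {i : ℤ} (h : 0 + i = i) (m : carrier i), smul h A.one m = m
  mul_smul : ∀ {i j k ij jk l : ℤ} (h₁ : i + j = ij) (h₂ : ij + k = l) (h₃ : j + k = jk)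
    (h₄ : i + jk = l) (a : A.carrier i) (b : A.carrier j) (m : carrier k),
    smul h₂ (A.mul h₁ a b) m = smul h₄ a (smul h₃ b m)

attribute [instance] GrModule.instGroup GrModule.instModule

/-- A dg-module over `A`. -/
structure DGModule (A : CInfDGAlgebra.{u}) extends GrModule.{u, w} A where
  d : ∀ {i j : ℤ}, i + 1 = j → carrier i →ₗ[ℝ] carrier j
  d_d : ∀ {i j k : ℤ} (h : i + 1 = j) (h' : j + 1 = k) (m : carrier i), d h' (d h m) = 0
  d_smul : ∀ {i j k i' j' k' : ℤ} (h : i + j = k) (hi : i + 1 = i') (hj : j + 1 = j')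
    (hk : k + 1 = k') (h₁ : i' + j = k') (h₂ : i + j' = k') (a : A.carrier i) (m : carrier j),
    d hk (smul h a m) = smul h₁ (A.d hi a) m + koszulSign i • smul h₂ a (d hj m)

section General

variable {A : CInfDGAlgebra.{u}}

theorem GrModule.smul_smul_comm (M : GrModule.{u, w} A) {p q i x y l : ℤ} (h₁ : q + i = x)
    (h₂ : p + x = l) (h₃ : p + i = y) (h₄ : q + y = l) (a : A.carrier p) (b : A.carrier q)
    (m : M.carrier i) :
    M.smul h₂ a (M.smul h₁ b m) = koszulSign (p * q) • M.smul h₄ b (M.smul h₃ a m) := by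
  rw [← M.mul_smul rfl (by omega) h₁ h₂, A.mul_comm rfl (add_comm q p), map_smul,
    LinearMap.smul_apply, M.mul_smul (add_comm q p) (by omega) h₃ h₄]

/-- The right action `m · a = (-1)^{|m||a|} a · m`. -/
def GrModule.rsmul (M : GrModule.{u, w} A) {i j k : ℤ} (h : i + j = k)
    (m : M.carrier i) (a : A.carrier j) : M.carrier k :=
  koszulSign (i * j) • M.smul (i := j) (j := i) (by omega) a m

/-- The pairs of degrees `(i, i + n)`, for the components of a map of degree `n`. -/
structure DegPair (n : ℤ) where
  src : ℤ
  tgt : ℤ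
  eq : src + n = tgt

/-- The degree `n` maps of graded modules `M → N`, i.e. `A`-linear maps of degree `0` from `M` to the
shift `N[n]`. The action on a shift carries the Koszul sign, so that `φ(a · m) = (-1)^{n|a|} a · φ(m)`. -/
def gradedHomSubmodule (n : ℤ) (M : GrModule.{u, v} A) (N : GrModule.{u, w} A) :
    Submodule ℝ (∀ p : DegPair n, M.carrier p.src →ₗ[ℝ] N.carrier p.tgt) where
  carrier := {φ | ∀ {i j k j' k' : ℤ} (h : i + j = k) (hj : j + n = j') (hk : k + n = k')
    (h' : i + j' = k') (a : A.carrier i) (m : M.carrier j),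
    φ ⟨k, k', hk⟩ (M.smul h a m) = koszulSign (n * i) • N.smul h' a (φ ⟨j, j', hj⟩ m)}
  zero_mem' := by simp
  add_mem' := by
    intro φ ψ hφ hψ i j k j' k' h hj hk h' a m
    simp only [Pi.add_apply, LinearMap.add_apply, map_add, smul_add]
    rw [hφ h hj hk h', hψ h hj hk h']
  smul_mem' := by
    intro c φ hφ i j k j' k' h hj hk h' a m
    simp only [Pi.smul_apply, LinearMap.smul_apply, map_smul]
    rw [hφ h hj hk h', smul_comm]

/-- The space of degree `n` maps of graded modules `M → N`. -/
abbrev GradedHom (n : ℤ) (M : GrModule.{u, v} A) (N : GrModule.{u, w} A) : Type (max v w) :=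
  gradedHomSubmodule n M N

namespace GradedHom

variable {n : ℤ} {M : GrModule.{u, v} A} {N : GrModule.{u, w} A}

/-- The component `Mᵢ → Nⱼ`, `j = i + n`. -/
def app (φ : GradedHom n M N) {i j : ℤ} (h : i + n = j) : M.carrier i →ₗ[ℝ] N.carrier j :=
  φ.1 ⟨i, j, h⟩

theorem app_smul (φ : GradedHom n M N) {i j k j' k' : ℤ} (h : i + j = k) (hj : j + n = j')
    (hk : k + n = k') (h' : i + j' = k') (a : A.carrier i) (m : M.carrier j) :
    φ.app hk (M.smul h a m) = koszulSign (n * i) • N.smul h' a (φ.app hj m) :=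
  φ.2 h hj hk h' a m

end GradedHom

/-- The dg-algebra `A` as a dg-module over itself. -/
def DGModule.self (A : CInfDGAlgebra.{u}) : DGModule.{u, u} A where
  carrier := A.carrier
  smul := A.mul
  one_smul := A.one_mul
  mul_smul := A.mul_assoc
  d := A.d
  d_d := A.d_d
  d_smul := A.d_mul

/-- A morphism of dg-modules: `A`-linear of degree `0` and compatible with the differentials. -/
structure DGHom (M : DGModule.{u, v} A) (N : DGModule.{u, w} A) where
  toFun : ∀ i, M.carrier i →ₗ[ℝ] N.carrier i
  map_smul : ∀ {i j k : ℤ} (h : i + j = k) (a : A.carrier i) (m : M.carrier j),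
    toFun k (M.smul h a m) = N.smul h a (toFun j m)
  map_d : ∀ {i j : ℤ} (h : i + 1 = j) (m : M.carrier i), toFun j (M.d h m) = N.d h (toFun i m)

namespace DGHom

variable {M : DGModule.{u, v} A} {N : DGModule.{u, w} A}

/-- The component in degree `i`, with values in `Nⱼ` for `j = i`. -/
def app (f : DGHom M N) {i j : ℤ} (h : i = j) : M.carrier i →ₗ[ℝ] N.carrier j :=
  h ▸ f.toFun i

theorem app_rfl (f : DGHom M N) (i : ℤ) : f.app (rfl : i = i) = f.toFun i := rfl

theorem app_smul (f : DGHom M N) {i j k j' k' : ℤ} (h : i + j = k) (hj : j = j') (hk : k = k')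
    (h' : i + j' = k') (a : A.carrier i) (m : M.carrier j) :
    f.app hk (M.smul h a m) = N.smul h' a (f.app hj m) := by
  subst hj hk
  exact f.map_smul h a m

theorem comm (f : DGHom M N) {i j i' j' : ℤ} (hi : i + 1 = i') (hj : j + 1 = j') (h : i = j)
    (h' : i' = j') (m : M.carrier i) : f.app h' (M.d hi m) = N.d hj (f.app h m) := by
  subst h h'
  exact f.map_d hi m

end DGHom

/-- An isomorphism of dg-modules. -/
structure DGIso (M : DGModule.{u, v} A) (N : DGModule.{u, w} A) where
  equiv : ∀ i, M.carrier i ≃ₗ[ℝ] N.carrier i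
  map_smul : ∀ {i j k : ℤ} (h : i + j = k) (a : A.carrier i) (m : M.carrier j),
    equiv k (M.smul h a m) = N.smul h a (equiv j m)
  map_d : ∀ {i j : ℤ} (h : i + 1 = j) (m : M.carrier i), equiv j (M.d h m) = N.d h (equiv i m)

/-- The internal hom of dg-modules: in degree `n` the maps of degree `n`, with action
`(a · φ)(m) = a · φ(m)` and differential `φ ↦ δ ∘ φ - (-1)^{|φ|} φ ∘ δ`. -/
def internalHom (M : DGModule.{u, v} A) (N : DGModule.{u, w} A) : DGModule.{u, max v w} A where
  carrier n := GradedHom n M.toGrModule N.toGrModule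
  smul {p n k} h := LinearMap.mk₂ ℝ
    (fun a φ => ⟨fun q => (N.smul (i := p) (j := q.src + n) (by have := q.eq; omega) a).comp
      (φ.app rfl), by
        intro i j l j' l' hl hj hk h' b m
        simp only [LinearMap.comp_apply]
        rw [φ.app_smul hl rfl rfl (by omega), map_smul,
          N.smul_smul_comm (p := p) (q := i) (by omega) (by omega) (by omega) h', smul_smul,
          ← koszulSign_add]
        congr 2
        rw [← h]; ring⟩)
    (by intros; ext; simp) (by intros; ext; simp)
    (by intros; ext; simp [GradedHom.app]) (by intros; ext; simp [GradedHom.app])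
  one_smul := by
    intro n h φ
    ext ⟨i, j, rfl⟩ m
    exact N.one_smul _ _
  mul_smul := by
    intro p q n pq qn l h₁ h₂ h₃ h₄ a b φ
    ext ⟨i, j, hj⟩ m
    exact N.mul_smul _ _ _ _ _ _ _
  d {n k} h :=
    { toFun := fun φ => ⟨fun q => (N.d (i := q.src + n) (by have := q.eq; omega)).comp (φ.app rfl)
        - koszulSign n • (φ.app (i := q.src + 1) (by have := q.eq; omega)).comp (M.d rfl), by
          intro i j l j' l' hl hj hk h' a m
          simp only [LinearMap.sub_apply, LinearMap.smul_apply, LinearMap.comp_apply]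
          rw [φ.app_smul hl rfl rfl (by omega), map_smul,
            N.d_smul (i' := i + 1) (k' := l') (j' := j') (by omega) rfl (by omega) (by omega) (by omega) h',
            M.d_smul (i' := i + 1) (j' := j + 1) hl rfl rfl rfl (by omega) (by omega), map_add,
            map_smul, φ.app_smul (j' := j + n) (by omega) rfl (by omega) (by omega),
            φ.app_smul (j' := j') (by omega) (by omega) (by omega) (by omega), map_sub, map_smul]
          have e1 : koszulSign (n * (i + 1)) = koszulSign (n * i) * koszulSign n := by
            rw [← koszulSign_add]; ring_nf
          have e2 : koszulSign (k * i) = koszulSign (n * i) * koszulSign i := by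
            rw [← koszulSign_add, ← h]; ring_nf
          have e3 := koszulSign_mul_self n
          rw [e1, e2]
          have e4 : koszulSign n * (koszulSign (n * i) * koszulSign n) = koszulSign (n * i) := by
            linear_combination koszulSign (n * i) * e3
          simp only [smul_add, smul_smul, smul_sub, e4]
          module⟩
      map_add' := by
        intro φ ψ; ext q m
        simp [GradedHom.app]; abel
      map_smul' := by
        intro c φ; ext q m
        simp [GradedHom.app, smul_sub, smul_comm c] }
  d_d := by
    intro n k l h h' φ
    ext ⟨i, j, hj⟩ m
    have e : koszulSign k = -koszulSign n := by
      rw [← h, koszulSign_add, koszulSign_one]; ring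
    have key : ∀ {x y : ℤ} (hx : i + 1 + n = x) (hy : i + 1 + n = y) (h₁ : x + 1 = j)
        (h₂ : y + 1 = j) (z : M.carrier (i + 1)),
        N.d h₁ (φ.1 ⟨i + 1, x, hx⟩ z) = N.d h₂ (φ.1 ⟨i + 1, y, hy⟩ z) := by
      intro x y hx hy h₁ h₂ z
      obtain rfl : x = y := by omega
      rfl
    simp only [GradedHom.app, LinearMap.coe_mk, AddHom.coe_mk, LinearMap.sub_apply,
      LinearMap.comp_apply, LinearMap.smul_apply, map_sub, map_smul, N.d_d, M.d_d, e, map_zero]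
    rw [key (y := i + 1 + n) (by omega) rfl (by omega) (by omega)]
    simp
  d_smul := by
    intro p n k p' n' k' h hp hn hk h₁ h₂ a φ
    ext ⟨i, j, hj⟩ m
    have e : koszulSign k = koszulSign p * koszulSign n := by rw [← h, koszulSign_add]
    simp only [GradedHom.app, LinearMap.mk₂_apply, LinearMap.coe_mk, AddHom.coe_mk, LinearMap.sub_apply,
      LinearMap.comp_apply, LinearMap.smul_apply, Submodule.coe_add, Submodule.coe_smul,
      LinearMap.add_apply, Pi.add_apply, Pi.smul_apply, map_sub, map_smul]
    rw [N.d_smul (i' := p') (j' := i + n') (k' := j) (by omega) hp (by omega) (by omega) (by omega)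
      (by omega), e]
    have key : ∀ {x y : ℤ} (hx : i + 1 + n = x) (hy : i + 1 + n = y) (h₁ : p + x = j)
        (h₂ : p + y = j) (z : M.carrier (i + 1)),
        N.smul h₁ a (φ.1 ⟨i + 1, x, hx⟩ z) = N.smul h₂ a (φ.1 ⟨i + 1, y, hy⟩ z) := by
      intro x y hx hy h₁ h₂ z
      obtain rfl : x = y := by omega
      rfl
    rw [key (y := i + n') (by omega) (by omega) (by omega) (by omega)]
    simp only [smul_sub, smul_smul]
    abel

/-- The cone `M[1] ⊕ N` of a morphism `f : M → N` of dg-modules, with differential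
`(m, n) ↦ (-δ m, f m + δ n)`. The action on the shift `M[1]` carries the Koszul sign. -/
def cone {M : DGModule.{u, v} A} {N : DGModule.{u, w} A} (f : DGHom M N) :
    DGModule.{u, max v w} A where
  carrier i := M.carrier (i + 1) × N.carrier i
  smul {i j k} h := LinearMap.mk₂ ℝ
    (fun a x => (koszulSign i • M.smul (by omega) a x.1, N.smul h a x.2))
    (by intros; ext <;> simp) (by intros; ext <;> simp [smul_comm (koszulSign i)])
    (by intros; ext <;> simp) (by intros; ext <;> simp [smul_comm (koszulSign i)])
  one_smul := by
    intro i h x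
    ext
    · simp [koszulSign_zero, M.one_smul]
    · simp [N.one_smul]
  mul_smul := by
    intro i j k ij jk l h₁ h₂ h₃ h₄ a b x
    have e : koszulSign ij = koszulSign i * koszulSign j := by rw [← h₁, koszulSign_add]
    ext
    · simp only [LinearMap.mk₂_apply, map_smul, smul_smul, e]
      rw [M.mul_smul h₁ _ (jk := jk + 1) (by omega) (by omega)]
    · exact N.mul_smul _ _ _ _ _ _ _
  d {i j} h :=
    { toFun := fun x => (-M.d (by omega) x.1, f.app (by omega) x.1 + N.d h x.2)
      map_add' := by
        intros; ext
        · simp; abel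
        · simp; abel
      map_smul' := by intros; ext <;> simp }
  d_d := by
    intro i j k h h' x
    ext
    · simp [M.d_d]
    · simp only [LinearMap.coe_mk, AddHom.coe_mk, map_neg, map_add, N.d_d, Prod.snd_zero]
      rw [f.comm (j := j) (j' := k) (by omega) (by omega) (by omega) (by omega)]
      abel
  d_smul := by
    intro i j k i' j' k' h hi hj hk h₁ h₂ a x
    have e : koszulSign i' = -koszulSign i := by
      rw [← hi, koszulSign_add, koszulSign_one]; ring
    have e' := koszulSign_mul_self i
    ext
    · simp only [LinearMap.mk₂_apply, LinearMap.coe_mk, AddHom.coe_mk, map_smul, Prod.fst_add, Prod.smul_fst]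
      rw [M.d_smul (i' := i') (j' := j' + 1) (k' := k' + 1) (by omega) hi (by omega) (by omega)
        (by omega) (by omega), e]
      simp only [smul_add, smul_smul, e', map_neg]
      module
    · simp only [LinearMap.mk₂_apply, LinearMap.coe_mk, AddHom.coe_mk, map_smul, Prod.snd_add, Prod.smul_snd,
        map_add]
      rw [N.d_smul h hi hj hk h₁ h₂,
        f.app_smul (j := j + 1) (j' := j') (by omega) (by omega) (by omega) h₂]
      simp only [smul_add]
      abel

/-- The cocone `M ⊕ N[-1]` of a morphism `f : M → N` of dg-modules, with differential
`(m, n) ↦ (δ m, f m - δ n)`. The action on the shift `N[-1]` carries the Koszul sign. -/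
def cocone {M : DGModule.{u, v} A} {N : DGModule.{u, w} A} (f : DGHom M N) :
    DGModule.{u, max v w} A where
  carrier i := M.carrier i × N.carrier (i - 1)
  smul {i j k} h := LinearMap.mk₂ ℝ
    (fun a x => (M.smul h a x.1, koszulSign i • N.smul (by omega) a x.2))
    (by intros; ext <;> simp) (by intros; ext <;> simp [smul_comm (koszulSign i)])
    (by intros; ext <;> simp) (by intros; ext <;> simp [smul_comm (koszulSign i)])
  one_smul := by
    intro i h x
    ext
    · simp [M.one_smul]
    · simp [koszulSign_zero, N.one_smul]
  mul_smul := by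
    intro i j k ij jk l h₁ h₂ h₃ h₄ a b x
    have e : koszulSign ij = koszulSign i * koszulSign j := by rw [← h₁, koszulSign_add]
    ext
    · exact M.mul_smul _ _ _ _ _ _ _
    · simp only [LinearMap.mk₂_apply, map_smul, smul_smul, e]
      rw [N.mul_smul h₁ _ (jk := jk - 1) (by omega) (by omega)]
  d {i j} h :=
    { toFun := fun x => (M.d h x.1, f.app (by omega) x.1 - N.d (by omega) x.2)
      map_add' := by
        intros; ext
        · simp
        · simp; abel
      map_smul' := by intros; ext <;> simp [smul_sub] }
  d_d := by
    intro i j k h h' x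
    ext
    · simp [M.d_d]
    · simp only [LinearMap.coe_mk, AddHom.coe_mk, map_sub, N.d_d, Prod.snd_zero]
      rw [f.comm (j := i) (j' := k - 1) h (by omega) (by omega) (by omega)]
      have : i = j - 1 := by omega
      subst this
      abel
  d_smul := by
    intro i j k i' j' k' h hi hj hk h₁ h₂ a x
    have e : koszulSign i' = -koszulSign i := by
      rw [← hi, koszulSign_add, koszulSign_one]; ring
    have e' := koszulSign_mul_self i
    ext
    · exact M.d_smul h hi hj hk h₁ h₂ a x.1
    · simp only [LinearMap.mk₂_apply, LinearMap.coe_mk, AddHom.coe_mk, map_smul, Prod.snd_add, Prod.smul_snd,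
        map_sub]
      rw [N.d_smul (i' := i') (j' := j' - 1) (k' := k' - 1) (by omega) hi (by omega) (by omega)
        (by omega) (by omega), e,
        f.app_smul (j := j) (j' := j' - 1) (by omega) (by omega) (by omega) (by omega)]
      simp only [smul_add, smul_smul, e', smul_sub]
      module

/-- A `C^∞`-derivation of degree `n` of `A` with values in a graded module `M`: it satisfies
`d'(ab) = d'(a) · b + (-1)^{n|a|} a · d'(b)` and the chain rule for the `C^∞`-operations in degree `0`. -/
structure CInfDerivation (n : ℤ) (M : GrModule.{u, w} A) where
  toFun : ∀ {i j : ℤ}, i + n = j → A.carrier i →ₗ[ℝ] M.carrier j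
  leibniz : ∀ {i j k i' j' k' : ℤ} (h : i + j = k) (hi : i + n = i') (hj : j + n = j')
    (hk : k + n = k') (h₁ : i' + j = k') (h₂ : i + j' = k') (a : A.carrier i) (b : A.carrier j),
    toFun hk (A.mul h a b) =
      M.rsmul h₁ (toFun hi a) b + koszulSign (n * i) • M.smul h₂ a (toFun hj b)
  chain_rule : ∀ {k : ℕ} (f : CInfFun k) (a : Fin k → A.carrier 0),
    toFun (zero_add n) (A.op f a) =
      ∑ i, M.smul (zero_add n) (A.op (f.partialDeriv i) a) (toFun (zero_add n) (a i))

/-- The pair `(Ω, d)` is a module of Kähler differentials of `A`: `d` is a `C^∞`-derivation of degree `0`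
compatible with the differentials, and every `C^∞`-derivation `d'` of any degree `n` with values in a
graded module factors uniquely as `φ ∘ d` with `φ` a map of graded modules of degree `n`. -/
structure IsKahlerDifferentials (Ω : DGModule.{u, w} A) (d : CInfDerivation 0 Ω.toGrModule) :
    Prop where
  comm : ∀ {i j i' j' : ℤ} (hi : i + 1 = i') (hj : j + 1 = j') (h : i + 0 = j)
    (h' : i' + 0 = j') (a : A.carrier i), d.toFun h' (A.d hi a) = Ω.d hj (d.toFun h a)
  universal : ∀ (M : GrModule.{u, v} A) (n : ℤ) (d' : CInfDerivation n M),
    ∃! φ : GradedHom n Ω.toGrModule M, ∀ {i j k : ℤ} (h : i + 0 = j) (h' : j + n = k)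
      (h'' : i + n = k) (a : A.carrier i), φ.app h' (d.toFun h a) = d'.toFun h'' a

/-- The tangent module, for a module `Ω` of Kähler differentials: the internal hom from `Ω` to `A`. -/
def tangentModule (Ω : DGModule.{u, w} A) : DGModule.{u, max w u} A :=
  internalHom Ω (DGModule.self A)

/-- The trivial module `A ⊗ V` with differential `δ ⊗ id`. -/
def trivialModule (A : CInfDGAlgebra.{u}) (V : Type v) [AddCommGroup V] [Module ℝ V] :
    DGModule.{u, max u v} A where
  carrier i := A.carrier i ⊗[ℝ] V
  smul h := (LinearMap.rTensorHom V).comp (A.mul h)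
  one_smul h m := by
    have : A.mul h A.one = LinearMap.id := LinearMap.ext (A.one_mul h)
    simp [this]
  mul_smul h₁ h₂ h₃ h₄ a b m := by
    have : A.mul h₂ (A.mul h₁ a b) = (A.mul h₄ a).comp (A.mul h₃ b) :=
      LinearMap.ext (A.mul_assoc h₁ h₂ h₃ h₄ a b)
    simp [this, LinearMap.rTensor_comp]
  d h := (A.d h).rTensor V
  d_d h h' m := by
    have : (A.d h').comp (A.d h) = 0 := LinearMap.ext (A.d_d h h')
    rw [← LinearMap.comp_apply, ← LinearMap.rTensor_comp, this]
    simp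
  d_smul h hi hj hk h₁ h₂ a m := by
    have : (A.d hk).comp (A.mul h a) =
        A.mul h₁ (A.d hi a) + koszulSign _ • (A.mul h₂ a).comp (A.d hj) :=
      LinearMap.ext (A.d_mul h hi hj hk h₁ h₂ a)
    simp only [LinearMap.comp_apply, LinearMap.coe_rTensorHom]
    rw [← LinearMap.comp_apply, ← LinearMap.rTensor_comp, this, LinearMap.rTensor_add,
      LinearMap.rTensor_smul, LinearMap.rTensor_comp]
    rfl
end General

/-! ### The algebra `B ⊗ ⋀V*` with the contraction differential -/

section Koszul
variable (B : Type*) [CommRing B] [Algebra ℝ B] (V : Type*) [AddCommGroup V] [Module ℝ V]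

/-- The algebra `B ⊗ ⋀V*`. -/
abbrev KoszulTotal : Type _ := B ⊗[ℝ] ExteriorAlgebra ℝ (Module.Dual ℝ V)

/-- The part of degree `i` of `B ⊗ ⋀V*`: it is `B ⊗ ⋀ᵏV*` for `i = -k`, and zero for `i > 0`. -/
def koszulPiece (i : ℤ) : Submodule B (KoszulTotal B V) :=
  if 0 < i then ⊥ else (⋀[ℝ]^((-i).toNat) (Module.Dual ℝ V)).baseChange B

variable {B V}

theorem koszulPiece_induction {i : ℤ} {p : KoszulTotal B V → Prop} (h0 : p 0)
    (hadd : ∀ x y, p x → p y → p (x + y))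
    (ht : ∀ (k : ℕ), i = -k → ∀ (f : B) (x : ExteriorAlgebra ℝ (Module.Dual ℝ V)),
      x ∈ ⋀[ℝ]^k (Module.Dual ℝ V) → p (f ⊗ₜ x)) {x : KoszulTotal B V}
    (hx : x ∈ koszulPiece B V i) : p x := by
  unfold koszulPiece at hx
  split_ifs at hx with hi
  · rw [Submodule.mem_bot] at hx
    exact hx ▸ h0
  · obtain ⟨y, rfl⟩ := hx
    induction y with
    | zero => simpa using h0
    | add y z hy hz => rw [map_add]; exact hadd _ _ hy hz
    | tmul f x => exact ht _ (by omega) f x x.2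

theorem tmul_mem_koszulPiece (k : ℕ) (f : B) {x : ExteriorAlgebra ℝ (Module.Dual ℝ V)}
    (hx : x ∈ ⋀[ℝ]^k (Module.Dual ℝ V)) : f ⊗ₜ x ∈ koszulPiece B V (-k) := by
  rw [koszulPiece, if_neg (by omega)]
  apply Submodule.tmul_mem_baseChange_of_mem
  simpa using hx

theorem koszul_mul_mem {i j : ℤ} {x y : KoszulTotal B V} (hx : x ∈ koszulPiece B V i)
    (hy : y ∈ koszulPiece B V j) : x * y ∈ koszulPiece B V (i + j) := by
  refine koszulPiece_induction (p := fun x => x * y ∈ koszulPiece B V (i + j)) (by simp) (fun x x' hx hx' => ?_) (fun k hk f x hx => ?_) hx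
  · rw [add_mul]; exact add_mem hx hx'
  · refine koszulPiece_induction (p := fun y => (f ⊗ₜ x) * y ∈ koszulPiece B V (i + j)) (by simp) (fun x x' hx hx' => ?_) (fun l hl g y hy => ?_) hy
    · rw [mul_add]; exact add_mem hx hx'
    · rw [Algebra.TensorProduct.tmul_mul_tmul]
      have := tmul_mem_koszulPiece (k + l) (f * g)
        (SetLike.GradedMul.mul_mem (A := fun i : ℕ ↦ ⋀[ℝ]^i (Module.Dual ℝ V)) hx hy)
      convert this using 2
      push_cast; omega

/-- The contraction of `⋀V*` with a vector `ξ`. -/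
def contr (ξ : V) : ExteriorAlgebra ℝ (Module.Dual ℝ V) →ₗ[ℝ] ExteriorAlgebra ℝ (Module.Dual ℝ V) :=
  CliffordAlgebra.contractLeft (Module.Dual.eval ℝ V ξ)

theorem contr_mul (ξ : V) {k : ℕ} {x : ExteriorAlgebra ℝ (Module.Dual ℝ V)}
    (hx : x ∈ ⋀[ℝ]^k (Module.Dual ℝ V)) (y : ExteriorAlgebra ℝ (Module.Dual ℝ V)) :
    contr ξ (x * y) = contr ξ x * y + (-1 : ℝ) ^ k • (x * contr ξ y) := by
  induction k generalizing x y with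
  | zero =>
    rw [ExteriorAlgebra.exteriorPower, pow_zero, Submodule.mem_one] at hx
    obtain ⟨c, rfl⟩ := hx
    rw [← Algebra.smul_def, map_smul, contr]
    erw [CliffordAlgebra.contractLeft_algebraMap]
    simp [Algebra.smul_def]
  | succ k ih =>
    rw [ExteriorAlgebra.exteriorPower, pow_succ'] at hx
    induction hx using Submodule.mul_induction_on' with
    | mem_mul_mem a ha b hb =>
      obtain ⟨α, rfl⟩ := ha
      have h := ih hb y
      have e (z) : contr ξ (ExteriorAlgebra.ι ℝ α * z) = α ξ • z - ExteriorAlgebra.ι ℝ α * contr ξ z :=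
        CliffordAlgebra.contractLeft_ι_mul _ _ _
      rw [mul_assoc, e, e, h, sub_mul, mul_add, pow_succ]
      simp only [smul_mul_assoc, mul_smul_comm, mul_assoc]
      module
    | add a _ b _ ha hb =>
      rw [add_mul, map_add, map_add, ha, hb, add_mul, add_mul, smul_add]
      abel

theorem ext_mul_comm {k l : ℕ} {x y : ExteriorAlgebra ℝ (Module.Dual ℝ V)}
    (hx : x ∈ ⋀[ℝ]^k (Module.Dual ℝ V)) (hy : y ∈ ⋀[ℝ]^l (Module.Dual ℝ V)) :
    x * y = (-1 : ℝ) ^ (k * l) • (y * x) := by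
  have key (α : Module.Dual ℝ V) {l : ℕ} {y : ExteriorAlgebra ℝ (Module.Dual ℝ V)}
      (hy : y ∈ ⋀[ℝ]^l (Module.Dual ℝ V)) :
      ExteriorAlgebra.ι ℝ α * y = (-1 : ℝ) ^ l • (y * ExteriorAlgebra.ι ℝ α) := by
    induction l generalizing y with
    | zero =>
      rw [ExteriorAlgebra.exteriorPower, pow_zero, Submodule.mem_one] at hy
      obtain ⟨c, rfl⟩ := hy
      simp [Algebra.commutes]
    | succ l ih =>
      rw [ExteriorAlgebra.exteriorPower, pow_succ'] at hy
      induction hy using Submodule.mul_induction_on' with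
      | mem_mul_mem a ha b hb =>
        obtain ⟨β, rfl⟩ := ha
        have h : ExteriorAlgebra.ι ℝ α * ExteriorAlgebra.ι ℝ β =
          - (ExteriorAlgebra.ι ℝ β * ExteriorAlgebra.ι ℝ α) :=
          eq_neg_of_add_eq_zero_left (ExteriorAlgebra.ι_add_mul_swap α β)
        rw [← mul_assoc, h, neg_mul, mul_assoc, ih hb, mul_assoc, pow_succ]
        simp
      | add a _ b _ ha hb => rw [mul_add, ha, hb, add_mul, smul_add]
  induction k generalizing x with
  | zero =>
    rw [ExteriorAlgebra.exteriorPower, pow_zero, Submodule.mem_one] at hx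
    obtain ⟨c, rfl⟩ := hx
    simp [Algebra.commutes]
  | succ k ih =>
    rw [ExteriorAlgebra.exteriorPower, pow_succ'] at hx
    induction hx using Submodule.mul_induction_on' with
    | mem_mul_mem a ha b hb =>
      obtain ⟨α, rfl⟩ := ha
      rw [mul_assoc, ih hb, mul_smul_comm, ← mul_assoc, key α hy, smul_mul_assoc, smul_smul,
        mul_assoc, ← pow_add]
      ring_nf
    | add a _ b _ ha hb => rw [add_mul, ha, hb, mul_add, smul_add]

theorem contr_mem (ξ : V) {k l : ℕ} (hkl : l + 1 = k) {x : ExteriorAlgebra ℝ (Module.Dual ℝ V)}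
    (hx : x ∈ ⋀[ℝ]^k (Module.Dual ℝ V)) : contr ξ x ∈ ⋀[ℝ]^l (Module.Dual ℝ V) := by
  subst hkl
  induction l generalizing x with
  | zero =>
    rw [ExteriorAlgebra.exteriorPower, zero_add, pow_one] at hx
    obtain ⟨α, rfl⟩ := hx
    rw [ExteriorAlgebra.exteriorPower, pow_zero, Submodule.mem_one]
    exact ⟨α ξ, (CliffordAlgebra.contractLeft_ι (0 : QuadraticForm ℝ (Module.Dual ℝ V))
      (Module.Dual.eval ℝ V ξ) α).symm⟩
  | succ k ih =>
    rw [ExteriorAlgebra.exteriorPower, pow_succ'] at hx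
    induction hx using Submodule.mul_induction_on' with
    | mem_mul_mem a ha b hb =>
      obtain ⟨α, rfl⟩ := ha
      have e : contr ξ (ExteriorAlgebra.ι ℝ α * b) = α ξ • b - ExteriorAlgebra.ι ℝ α * contr ξ b :=
        CliffordAlgebra.contractLeft_ι_mul _ _ _
      rw [e]
      refine sub_mem (Submodule.smul_mem _ _ hb) ?_
      rw [ExteriorAlgebra.exteriorPower, pow_succ']
      exact Submodule.mul_mem_mul ⟨α, rfl⟩ (ih hb)
    | add a _ b _ ha hb => rw [map_add]; exact add_mem ha hb

theorem contr_zero (ξ : V) {x : ExteriorAlgebra ℝ (Module.Dual ℝ V)}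
    (hx : x ∈ ⋀[ℝ]^0 (Module.Dual ℝ V)) : contr ξ x = 0 := by
  rw [ExteriorAlgebra.exteriorPower, pow_zero, Submodule.mem_one] at hx
  obtain ⟨c, rfl⟩ := hx
  exact CliffordAlgebra.contractLeft_algebraMap _ _ _

theorem koszul_mul_comm {i j : ℤ} {x y : KoszulTotal B V} (hx : x ∈ koszulPiece B V i)
    (hy : y ∈ koszulPiece B V j) : x * y = koszulSign (i * j) • (y * x) := by
  refine koszulPiece_induction (p := fun x => x * y = koszulSign (i * j) • (y * x)) (by simp) (fun x x' hx hx' => ?_) (fun k hk f x hx => ?_) hx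
  · beta_reduce at hx hx' ⊢; rw [add_mul, hx, hx', mul_add, smul_add]
  · refine koszulPiece_induction (p := fun y => (f ⊗ₜ x) * y = koszulSign (i * j) • (y * f ⊗ₜ x)) (by simp) (fun x x' hx hx' => ?_) (fun l hl g y hy => ?_) hy
    · beta_reduce at hx hx' ⊢; rw [mul_add, hx, hx', add_mul, smul_add]
    · rw [Algebra.TensorProduct.tmul_mul_tmul, Algebra.TensorProduct.tmul_mul_tmul,
        ext_mul_comm hx hy, TensorProduct.tmul_smul, mul_comm f g, koszulSign, hk, hl,
        neg_mul_neg, ← Nat.cast_mul, zpow_natCast]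

variable [FiniteDimensional ℝ V]

/-- The contraction of `B ⊗ ⋀V*` with an element `s` of `B ⊗ V`, given as the linear map
`α ↦ ⟨s, α⟩` from `V*` to `B`. It is `∑ⱼ ⟨s, eʲ⟩ ι_{eⱼ}` for a basis `eⱼ` of `V`. -/
def koszulD (s : Module.Dual ℝ V →ₗ[ℝ] B) : KoszulTotal B V →ₗ[B] KoszulTotal B V :=
  ∑ j, s ((Module.finBasis ℝ V).coord j) • (contr (Module.finBasis ℝ V j)).baseChange B

theorem koszulD_tmul (s : Module.Dual ℝ V →ₗ[ℝ] B) (f : B)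
    (x : ExteriorAlgebra ℝ (Module.Dual ℝ V)) : koszulD s (f ⊗ₜ x) =
      ∑ j, (s ((Module.finBasis ℝ V).coord j) * f) ⊗ₜ[ℝ] contr (Module.finBasis ℝ V j) x := by
  simp [koszulD, LinearMap.sum_apply, TensorProduct.smul_tmul']

theorem sum_coord {U : Type*} [AddCommGroup U] [Module ℝ U] (s : Module.Dual ℝ V →ₗ[ℝ] U) (α : Module.Dual ℝ V) :
    ∑ j, α (Module.finBasis ℝ V j) • s ((Module.finBasis ℝ V).coord j) = s α := by
  conv_rhs => rw [← (Module.finBasis ℝ V).sum_dual_apply_smul_coord α, map_sum]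
  simp only [map_smul]

/-- The formula that determines the contraction: `ι_s(f α ∧ x) = f ⟨s, α⟩ x - α ∧ ι_s(f x)`. -/
theorem koszulD_tmul_ι_mul (s : Module.Dual ℝ V →ₗ[ℝ] B) (f : B) (α : Module.Dual ℝ V)
    (x : ExteriorAlgebra ℝ (Module.Dual ℝ V)) :
    koszulD s (f ⊗ₜ (ExteriorAlgebra.ι ℝ α * x)) =
      (s α * f) ⊗ₜ x - (1 ⊗ₜ ExteriorAlgebra.ι ℝ α) * koszulD s (f ⊗ₜ x) := by
  have e (ξ : V) : contr ξ (ExteriorAlgebra.ι ℝ α * x) = α ξ • x - ExteriorAlgebra.ι ℝ α * contr ξ x :=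
        CliffordAlgebra.contractLeft_ι_mul _ _ _
  simp only [koszulD_tmul, e, TensorProduct.tmul_sub, Finset.sum_sub_distrib, Finset.mul_sum,
    Algebra.TensorProduct.tmul_mul_tmul, one_mul]
  congr 1
  rw [← sum_coord s α, Finset.sum_mul, TensorProduct.sum_tmul]
  simp only [TensorProduct.tmul_smul, TensorProduct.smul_tmul', smul_mul_assoc]

theorem koszulD_mem (s : Module.Dual ℝ V →ₗ[ℝ] B) {i : ℤ} {x : KoszulTotal B V}
    (hx : x ∈ koszulPiece B V i) : koszulD s x ∈ koszulPiece B V (i + 1) := by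
  refine koszulPiece_induction (p := fun x => koszulD s x ∈ koszulPiece B V (i + 1)) (by simp) (fun x x' hx hx' => ?_) (fun k hk f x hx => ?_) hx
  · rw [map_add]; exact add_mem hx hx'
  · rw [koszulD_tmul]
    refine sum_mem fun j _ => ?_
    obtain _ | k := k
    · rw [contr_zero _ hx]; simp
    · convert tmul_mem_koszulPiece k _ (contr_mem _ rfl hx) using 2
      push_cast at hk; omega

theorem koszulD_koszulD (s : Module.Dual ℝ V →ₗ[ℝ] B) (x : KoszulTotal B V) :
    koszulD s (koszulD s x) = 0 := by
  induction x using TensorProduct.induction_on with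
  | zero => simp
  | add x y hx hy => rw [map_add, map_add, hx, hy, add_zero]
  | tmul f x =>
    have h2 : ∀ z : KoszulTotal B V, z = -z → z = 0 := fun z hz => by
      have : (2 : ℝ) • z = 0 := by rw [two_smul]; nth_rewrite 1 [hz]; simp
      simpa using this
    apply h2
    simp only [koszulD_tmul, map_sum]
    conv_lhs => rw [Finset.sum_comm]
    rw [← Finset.sum_neg_distrib]
    refine Finset.sum_congr rfl fun i _ => ?_
    rw [← Finset.sum_neg_distrib]
    refine Finset.sum_congr rfl fun j _ => ?_
    rw [← TensorProduct.tmul_neg, mul_left_comm]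
    exact congrArg _ (CliffordAlgebra.contractLeft_comm _ _ _)

theorem koszulD_mul (s : Module.Dual ℝ V →ₗ[ℝ] B) {i : ℤ} {x : KoszulTotal B V}
    (hx : x ∈ koszulPiece B V i) (y : KoszulTotal B V) :
    koszulD s (x * y) = koszulD s x * y + koszulSign i • (x * koszulD s y) := by
  refine koszulPiece_induction (p := fun x => koszulD s (x * y) = koszulD s x * y + koszulSign i • (x * koszulD s y)) (by simp) (fun x x' hx hx' => ?_) (fun k hk f x hx => ?_) hx
  · rw [add_mul, map_add, hx, hx', map_add, add_mul, add_mul, smul_add]; abel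
  · induction y using TensorProduct.induction_on with
    | zero => simp
    | add y z hy hz => rw [mul_add, map_add, hy, hz, map_add, mul_add, mul_add, smul_add]; abel
    | tmul g y =>
      have e : koszulSign i = (-1) ^ k := by
        rw [koszulSign, hk, zpow_neg, zpow_natCast, ← inv_pow]; norm_num
      simp only [Algebra.TensorProduct.tmul_mul_tmul, koszulD_tmul, contr_mul _ hx,
        TensorProduct.tmul_add, Finset.sum_add_distrib, Finset.sum_mul, Finset.mul_sum,
        Finset.smul_sum, e, TensorProduct.tmul_smul]
      congr 1
      · simp only [mul_assoc]
      · simp only [mul_left_comm]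

end Koszul

/-! ### Its homogeneous parts and the modules built from them -/

section QuasiSmooth

variable {B : Type u} [CommRing B] [Algebra ℝ B] {V : Type v} [AddCommGroup V] [Module ℝ V]

variable (B V) in
/-- The homogeneous part of degree `i` of `B ⊗ ⋀V*`, as a type. -/
def KoszulPart (i : ℤ) : Type (max u v) := koszulPiece B V i

instance koszulPartGroup (i : ℤ) : AddCommGroup (KoszulPart B V i) :=
  inferInstanceAs (AddCommGroup (koszulPiece B V i))

instance koszulPartModule (i : ℤ) : Module B (KoszulPart B V i) :=
  inferInstanceAs (Module B (koszulPiece B V i))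

instance koszulPartRealModule (i : ℤ) : Module ℝ (KoszulPart B V i) :=
  inferInstanceAs (Module ℝ (koszulPiece B V i))

instance koszulPartTower (i : ℤ) : IsScalarTower ℝ B (KoszulPart B V i) :=
  inferInstanceAs (IsScalarTower ℝ B (koszulPiece B V i))

/-- The product `A_i × A_j → A_{i+j}` of the homogeneous parts of `B ⊗ ⋀V*`. -/
def koszulMul {i j k : ℤ} (h : i + j = k) :
    KoszulPart B V i →ₗ[B] KoszulPart B V j →ₗ[B] KoszulPart B V k :=
  LinearMap.mk₂ B (fun a b => ⟨a.1 * b.1, h ▸ koszul_mul_mem a.2 b.2⟩)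
    (fun _ _ _ => Subtype.ext (add_mul _ _ _)) (fun _ _ _ => Subtype.ext (smul_mul_assoc _ _ _))
    (fun _ _ _ => Subtype.ext (mul_add _ _ _)) (fun _ _ _ => Subtype.ext (mul_smul_comm _ _ _))

/-- The same product, as an `ℝ`-bilinear map. -/
def koszulMulReal {i j k : ℤ} (h : i + j = k) :
    KoszulPart B V i →ₗ[ℝ] KoszulPart B V j →ₗ[ℝ] KoszulPart B V k :=
  LinearMap.mk₂ ℝ (fun a b => koszulMul h a b)
    (fun _ _ _ => Subtype.ext (add_mul _ _ _)) (fun _ _ _ => Subtype.ext (smul_mul_assoc _ _ _))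
    (fun _ _ _ => Subtype.ext (mul_add _ _ _)) (fun _ _ _ => Subtype.ext (mul_smul_comm _ _ _))

theorem koszulMul_real_smul {i j k : ℤ} (h : i + j = k) (c : ℝ) (a : KoszulPart B V i)
    (b : KoszulPart B V j) : koszulMul h (c • a) b = c • koszulMul h a b :=
  Subtype.ext (smul_mul_assoc c a.1 b.1)

theorem koszulMul_one {i : ℤ} (h : 0 + i = i) (o : KoszulPart B V 0) (ho : o.1 = 1)
    (b : KoszulPart B V i) : koszulMul h o b = b :=
  Subtype.ext ((congrArg (· * b.1) ho).trans (one_mul b.1))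

theorem koszulMul_assoc {i j k ij jk l : ℤ} (h₁ : i + j = ij) (h₂ : ij + k = l)
    (h₃ : j + k = jk) (h₄ : i + jk = l) (a : KoszulPart B V i) (b : KoszulPart B V j)
    (c : KoszulPart B V k) :
    koszulMul h₂ (koszulMul h₁ a b) c = koszulMul h₄ a (koszulMul h₃ b c) :=
  Subtype.ext (mul_assoc a.1 b.1 c.1)

/-- The inclusion of `B` as the part of degree `0`. -/
def koszulIncl : B →ₗ[B] KoszulPart B V 0 where
  toFun f := ⟨f ⊗ₜ 1, by
    simpa using tmul_mem_koszulPiece (V := V) 0 f (Submodule.mem_one.2 ⟨1, map_one _⟩)⟩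
  map_add' f g := Subtype.ext (TensorProduct.add_tmul f g 1)
  map_smul' _ _ := rfl

/-- The projection of `B ⊗ ⋀V*` to `B ⊗ ⋀⁰V* = B`. -/
def koszulBody : KoszulTotal B V →ₐ[B] B :=
  (Algebra.TensorProduct.rid ℝ B B).toAlgHom.comp
    (Algebra.TensorProduct.map (AlgHom.id B B) ExteriorAlgebra.algebraMapInv)

theorem koszulIncl_one : (koszulIncl (1 : B) : KoszulPart B V 0).1 = 1 := rfl

theorem koszulBody_incl (f : B) : koszulBody (koszulIncl (V := V) f).1 = f := by
  show koszulBody (f ⊗ₜ 1) = f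
  simp [koszulBody]

theorem koszulIncl_body (a : KoszulPart B V 0) : koszulIncl (koszulBody a.1) = a := by
  refine Subtype.ext ?_
  show koszulBody a.1 ⊗ₜ 1 = a.1
  refine koszulPiece_induction (p := fun x => koszulBody x ⊗ₜ 1 = x) (by simp)
    (fun x y hx hy => ?_) (fun k hk f x hx => ?_) a.2
  · beta_reduce at hx hy ⊢
    rw [map_add, TensorProduct.add_tmul, hx, hy]
  · obtain rfl : k = 0 := by omega
    rw [ExteriorAlgebra.exteriorPower, pow_zero, Submodule.mem_one] at hx
    obtain ⟨c, rfl⟩ := hx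
    have e : koszulBody (f ⊗ₜ[ℝ] algebraMap ℝ (ExteriorAlgebra ℝ (Module.Dual ℝ V)) c) = c • f := by
      simp only [koszulBody, AlgHom.comp_apply, Algebra.TensorProduct.map_tmul, AlgHom.commutes]
      exact TensorProduct.rid_tmul _ _
    rw [e, Algebra.algebraMap_eq_smul_one, TensorProduct.smul_tmul]

section Pull

variable {T : Type w} [AddCommGroup T] [Module B T]

/-- The action of `A_i` on `A_• ⊗_B T`. -/
def pullSmul {i j k : ℤ} (h : i + j = k) : KoszulPart B V i →ₗ[ℝ]
    (KoszulPart B V j ⊗[B] T) →ₗ[ℝ] (KoszulPart B V k ⊗[B] T) where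
  toFun a := ((koszulMul h a).rTensor T).restrictScalars ℝ
  map_add' a b := by
    refine LinearMap.ext fun m => ?_
    simp [LinearMap.rTensor_add]
  map_smul' c a := by
    refine LinearMap.ext fun m => ?_
    simp only [LinearMap.coe_restrictScalars, RingHom.id_apply, LinearMap.smul_apply]
    induction m using TensorProduct.induction_on with
    | zero => simp only [map_zero, smul_zero]
    | add x y hx hy => rw [map_add, hx, hy, map_add, smul_add]
    | tmul b t =>
      rw [LinearMap.rTensor_tmul, LinearMap.rTensor_tmul, koszulMul_real_smul,
        TensorProduct.smul_tmul']

theorem pullSmul_tmul {i j k : ℤ} (h : i + j = k) (a : KoszulPart B V i) (b : KoszulPart B V j)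
    (t : T) : pullSmul h a (b ⊗ₜ[B] t) = koszulMul h a b ⊗ₜ[B] t := rfl

theorem pullSmul_one {i : ℤ} (h : 0 + i = i) (m : KoszulPart B V i ⊗[B] T) :
    pullSmul h (koszulIncl 1) m = m := by
  induction m using TensorProduct.induction_on with
  | zero => simp
  | add x y hx hy => rw [map_add, hx, hy]
  | tmul b t => rw [pullSmul_tmul, koszulMul_one h (koszulIncl 1) koszulIncl_one]

theorem pullSmul_mul {i j k ij jk l : ℤ} (h₁ : i + j = ij) (h₂ : ij + k = l) (h₃ : j + k = jk)
    (h₄ : i + jk = l) (a : KoszulPart B V i) (b : KoszulPart B V j)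
    (m : KoszulPart B V k ⊗[B] T) :
    pullSmul h₂ (koszulMul h₁ a b) m = pullSmul h₄ a (pullSmul h₃ b m) := by
  induction m using TensorProduct.induction_on with
  | zero => simp
  | add x y hx hy => rw [map_add, hx, hy, map_add, map_add]
  | tmul c t => rw [pullSmul_tmul, pullSmul_tmul, pullSmul_tmul, koszulMul_assoc h₁ h₂ h₃ h₄]

/-- The map `A_i ⊗_ℝ U → A_i ⊗_B T`, `a ⊗ u ↦ a ⊗ D u`, for an `ℝ`-linear map `D : U → T`. -/
def extendLinear {U : Type u₁} [AddCommGroup U] [Module ℝ U] [Module ℝ T] [IsScalarTower ℝ B T]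
    (D : U →ₗ[ℝ] T) (i : ℤ) : (KoszulPart B V i ⊗[ℝ] U) →ₗ[ℝ] (KoszulPart B V i ⊗[B] T) :=
  TensorProduct.lift (LinearMap.mk₂ ℝ (fun a u => a ⊗ₜ[B] D u)
    (fun _ _ _ => TensorProduct.add_tmul _ _ _) (fun _ _ _ => rfl)
    (fun a u v => by rw [map_add, TensorProduct.tmul_add])
    (fun c a u => by rw [map_smul, TensorProduct.tmul_smul]))

theorem extendLinear_smul {U : Type u₁} [AddCommGroup U] [Module ℝ U] [Module ℝ T]
    [IsScalarTower ℝ B T] (D : U →ₗ[ℝ] T) {i j k : ℤ} (h : i + j = k)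
    (a : KoszulPart B V i) (m : KoszulPart B V j ⊗[ℝ] U) :
    extendLinear D k ((koszulMulReal h a).rTensor U m) = pullSmul h a (extendLinear D j m) := by
  induction m using TensorProduct.induction_on with
  | zero => simp only [map_zero]
  | add x y hx hy => simp only [map_add, hx, hy]
  | tmul b t => rfl

end Pull

variable [FiniteDimensional ℝ V]

/-- The contraction with `s` on homogeneous parts. -/
def koszulDiff (s : Module.Dual ℝ V →ₗ[ℝ] B) {i j : ℤ} (h : i + 1 = j) :
    KoszulPart B V i →ₗ[B] KoszulPart B V j :=
  (koszulD s).restrict fun _ hx => h ▸ koszulD_mem s hx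

theorem koszulDiff_koszulDiff (s : Module.Dual ℝ V →ₗ[ℝ] B) {i j k : ℤ} (h : i + 1 = j)
    (h' : j + 1 = k) (a : KoszulPart B V i) : koszulDiff s h' (koszulDiff s h a) = 0 :=
  Subtype.ext (koszulD_koszulD s a.1)

theorem koszulDiff_mul (s : Module.Dual ℝ V →ₗ[ℝ] B) {i j k i' j' k' : ℤ} (h : i + j = k)
    (hi : i + 1 = i') (hj : j + 1 = j') (hk : k + 1 = k') (h₁ : i' + j = k') (h₂ : i + j' = k')
    (a : KoszulPart B V i) (b : KoszulPart B V j) :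
    koszulDiff s hk (koszulMul h a b) =
      koszulMul h₁ (koszulDiff s hi a) b + koszulSign i • koszulMul h₂ a (koszulDiff s hj b) := by
  apply Subtype.ext
  exact koszulD_mul s a.2 b.1

section Pull

variable {T : Type w} [AddCommGroup T] [Module B T] (s : Module.Dual ℝ V →ₗ[ℝ] B)

/-- The differential `ι_s ⊗ id` on `A_• ⊗_B T`. -/
def pullDiff {i j : ℤ} (h : i + 1 = j) :
    (KoszulPart B V i ⊗[B] T) →ₗ[ℝ] (KoszulPart B V j ⊗[B] T) :=
  ((koszulDiff s h).rTensor T).restrictScalars ℝ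

theorem pullDiff_tmul {i j : ℤ} (h : i + 1 = j) (a : KoszulPart B V i) (t : T) :
    pullDiff s h (a ⊗ₜ[B] t) = koszulDiff s h a ⊗ₜ[B] t := rfl

theorem pullDiff_pullDiff {i j k : ℤ} (h : i + 1 = j) (h' : j + 1 = k)
    (m : KoszulPart B V i ⊗[B] T) : pullDiff s h' (pullDiff s h m) = 0 := by
  induction m using TensorProduct.induction_on with
  | zero => simp
  | add x y hx hy => rw [map_add, map_add, hx, hy, add_zero]
  | tmul a t =>
    rw [pullDiff_tmul, pullDiff_tmul, koszulDiff_koszulDiff, TensorProduct.zero_tmul]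

theorem pullDiff_smul {i j k i' j' k' : ℤ} (h : i + j = k) (hi : i + 1 = i') (hj : j + 1 = j')
    (hk : k + 1 = k') (h₁ : i' + j = k') (h₂ : i + j' = k') (a : KoszulPart B V i)
    (m : KoszulPart B V j ⊗[B] T) :
    pullDiff s hk (pullSmul h a m) =
      pullSmul h₁ (koszulDiff s hi a) m + koszulSign i • pullSmul h₂ a (pullDiff s hj m) := by
  induction m using TensorProduct.induction_on with
  | zero => simp
  | add x y hx hy => simp only [map_add, hx, hy, smul_add]; abel
  | tmul b t =>
    rw [pullSmul_tmul, pullDiff_tmul, koszulDiff_mul s h hi hj hk h₁ h₂, TensorProduct.add_tmul, pullSmul_tmul, pullDiff_tmul,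
      pullSmul_tmul, TensorProduct.smul_tmul']

end Pull

section Maps

variable {T : Type w} [AddCommGroup T] [Module B T]

theorem extendLinear_diff {U : Type u₁} [AddCommGroup U] [Module ℝ U] [Module ℝ T]
    [IsScalarTower ℝ B T] (D : U →ₗ[ℝ] T) (s : Module.Dual ℝ V →ₗ[ℝ] B) {i j : ℤ} (h : i + 1 = j)
    (m : KoszulPart B V i ⊗[ℝ] U) :
    extendLinear D j (((koszulDiff s h).restrictScalars ℝ).rTensor U m) =
      pullDiff s h (extendLinear D i m) := by
  induction m using TensorProduct.induction_on with
  | zero => simp only [map_zero]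
  | add x y hx hy => simp only [map_add, hx, hy]
  | tmul b t => rfl

/-- The map `A_i ⊗_B T → A_i ⊗_ℝ V`, `a ⊗ t ↦ ∑ⱼ P(t, eʲ) a ⊗ eⱼ`, for a basis `eⱼ` of `V` with dual
basis `eʲ`. -/
def contractLinear (P : Module.Dual ℝ V →ₗ[ℝ] T →ₗ[B] B) (i : ℤ) :
    (KoszulPart B V i ⊗[B] T) →ₗ[ℝ] (KoszulPart B V i ⊗[ℝ] V) :=
  (TensorProduct.lift (LinearMap.mk₂ B
    (fun (a : KoszulPart B V i) (t : T) =>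
      ∑ j, (P ((Module.finBasis ℝ V).coord j) t • a) ⊗ₜ[ℝ] Module.finBasis ℝ V j)
    (fun _ _ _ => by simp [TensorProduct.add_tmul, Finset.sum_add_distrib])
    (fun c a t => by
      rw [Finset.smul_sum]
      exact Finset.sum_congr rfl fun j _ => by rw [TensorProduct.smul_tmul', smul_comm])
    (fun _ _ _ => by simp [TensorProduct.add_tmul, Finset.sum_add_distrib, add_smul])
    (fun c a t => by
      rw [Finset.smul_sum]
      exact Finset.sum_congr rfl fun j _ => by
        rw [TensorProduct.smul_tmul', map_smul, smul_eq_mul, mul_smul]))).restrictScalars ℝ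

theorem contractLinear_tmul (P : Module.Dual ℝ V →ₗ[ℝ] T →ₗ[B] B) (i : ℤ)
    (a : KoszulPart B V i) (t : T) : contractLinear P i (a ⊗ₜ[B] t) =
      ∑ j, (P ((Module.finBasis ℝ V).coord j) t • a) ⊗ₜ[ℝ] Module.finBasis ℝ V j := rfl

/-- The map does not depend on the basis: pairing its value with `α` gives `P(t, α) a`. -/
theorem contractLinear_pairing (P : Module.Dual ℝ V →ₗ[ℝ] T →ₗ[B] B) (i : ℤ)
    (a : KoszulPart B V i) (t : T) (α : Module.Dual ℝ V) :
    TensorProduct.rid ℝ _ (α.lTensor (KoszulPart B V i) (contractLinear P i (a ⊗ₜ[B] t))) =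
      P α t • a := by
  rw [contractLinear_tmul, map_sum, map_sum]
  simp only [LinearMap.lTensor_tmul, TensorProduct.rid_tmul]
  rw [← sum_coord P α, LinearMap.sum_apply, Finset.sum_smul]
  exact Finset.sum_congr rfl fun j _ => by rw [LinearMap.smul_apply, smul_assoc]

theorem contractLinear_smul (P : Module.Dual ℝ V →ₗ[ℝ] T →ₗ[B] B) {i j k : ℤ} (h : i + j = k)
    (a : KoszulPart B V i) (m : KoszulPart B V j ⊗[B] T) :
    contractLinear P k (pullSmul h a m) = (koszulMulReal h a).rTensor V (contractLinear P j m) := by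
  induction m using TensorProduct.induction_on with
  | zero => simp
  | add x y hx hy => simp only [map_add, hx, hy]
  | tmul b t =>
    rw [pullSmul_tmul, contractLinear_tmul, contractLinear_tmul, map_sum]
    refine Finset.sum_congr rfl fun l _ => ?_
    rw [LinearMap.rTensor_tmul, ← map_smul]
    rfl

theorem contractLinear_diff (P : Module.Dual ℝ V →ₗ[ℝ] T →ₗ[B] B) (s : Module.Dual ℝ V →ₗ[ℝ] B)
    {i j : ℤ} (h : i + 1 = j) (m : KoszulPart B V i ⊗[B] T) :
    contractLinear P j (pullDiff s h m) =
      ((koszulDiff s h).restrictScalars ℝ).rTensor V (contractLinear P i m) := by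
  induction m using TensorProduct.induction_on with
  | zero => simp
  | add x y hx hy => simp only [map_add, hx, hy]
  | tmul b t =>
    rw [pullDiff_tmul, contractLinear_tmul, contractLinear_tmul, map_sum]
    refine Finset.sum_congr rfl fun l _ => ?_
    rw [LinearMap.rTensor_tmul, ← map_smul]
    rfl

end Maps

end QuasiSmooth

/-! ### The quasi-smooth dg-manifold of a function `σ : M → V` -/

section Main

variable {E : Type u} [NormedAddCommGroup E] [NormedSpace ℝ E]
  {M : Type v} [TopologicalSpace M] [ChartedSpace E M]
  {V : Type w} [NormedAddCommGroup V] [NormedSpace ℝ V] [FiniteDimensional ℝ V]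

/-- The function `f(b₁, …, bₙ)` on `M`. -/
def cinfApply {n : ℕ} (f : CInfFun n) (b : Fin n → SmoothFun E M) : SmoothFun E M :=
  ⟨fun x => f.toFun fun i => b i x,
    f.smooth.contMDiff.comp (contMDiff_pi_space.2 fun i => (b i).contMDiff)⟩

/-- The map `α ↦ ⟨σ, α⟩` from `V*` to `C^∞(M)`. -/
def sigmaPairing (σ : C^∞⟮𝓘(ℝ, E), M; 𝓘(ℝ, V), V⟯) : Module.Dual ℝ V →ₗ[ℝ] SmoothFun E M where
  toFun α := ⟨fun x => α (σ x), (LinearMap.toContinuousLinearMap α).contMDiff.comp σ.contMDiff⟩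
  map_add' _ _ := rfl
  map_smul' _ _ := rfl

/-- The dg-algebra of functions on the quasi-smooth dg-manifold of `σ : M → V`: the graded algebra
`C^∞(M) ⊗ ⋀V*` with `⋀ᵏV*` in degree `-k`, with the contraction `ι_σ` as differential and the
operations `f(b₁, …, bₙ)` on `C^∞(M)` in degree `0`. -/
def quasiSmooth (σ : C^∞⟮𝓘(ℝ, E), M; 𝓘(ℝ, V), V⟯) : CInfDGAlgebra.{max v w} where
  carrier i := KoszulPart (SmoothFun E M) V i
  instGroup i := koszulPartGroup i
  instModule i := koszulPartRealModule i
  mul h := koszulMulReal h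
  one := koszulIncl 1
  one_mul h a := koszulMul_one h _ koszulIncl_one a
  mul_assoc := koszulMul_assoc
  mul_comm h h' a b := Subtype.ext (koszul_mul_comm a.2 b.2)
  d h := (koszulDiff (sigmaPairing σ) h).restrictScalars ℝ
  d_d := koszulDiff_koszulDiff (sigmaPairing σ)
  d_mul := koszulDiff_mul (sigmaPairing σ)
  op f a := koszulIncl (cinfApply f fun i => koszulBody (a i).1)
  op_proj i a := koszulIncl_body (a i)
  op_comp f g a := by
    simp only [koszulBody_incl]
    rfl
  op_const c a := by
    have : cinfApply (CInfFun.const _ c) (fun i => koszulBody (a i).1) = c • (1 : SmoothFun E M) := by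
      ext x; simp [cinfApply, CInfFun.const]
    rw [this]
    exact Subtype.ext (TensorProduct.smul_tmul' c _ _).symm
  op_add f g a := map_add koszulIncl (cinfApply f fun i => koszulBody (a i).1)
    (cinfApply g fun i => koszulBody (a i).1)
  op_mul f g a := Subtype.ext (by
    refine Eq.trans ?_ (Algebra.TensorProduct.tmul_mul_tmul _ _ _ _).symm
    rw [mul_one]
    rfl)

/-- The pullback `ι^*T = C^∞(X) ⊗_{C^∞(M)} T` of a `C^∞(M)`-module `T`, with differential `ι_σ ⊗ id`. -/
def pullback (σ : C^∞⟮𝓘(ℝ, E), M; 𝓘(ℝ, V), V⟯) (T : Type u₁) [AddCommGroup T]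
    [Module (SmoothFun E M) T] : DGModule.{max v w, max v w u₁} (quasiSmooth σ) where
  carrier i := KoszulPart (SmoothFun E M) V i ⊗[SmoothFun E M] T
  instGroup _ := TensorProduct.addCommGroup
  instModule _ := TensorProduct.leftModule
  smul h := pullSmul h
  one_smul := pullSmul_one
  mul_smul := pullSmul_mul
  d h := pullDiff (sigmaPairing σ) h
  d_d := pullDiff_pullDiff (sigmaPairing σ)
  d_smul := pullDiff_smul (sigmaPairing σ)

variable [IsManifold 𝓘(ℝ, E) ∞ M]

/-- The morphism `(dσ)^* : V*_X → ι^*T*_M`, `a ⊗ α ↦ a ⊗ d⟨σ, α⟩`. -/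
def dSigmaDual (σ : C^∞⟮𝓘(ℝ, E), M; 𝓘(ℝ, V), V⟯) :
    DGHom (trivialModule (quasiSmooth σ) (Module.Dual ℝ V)) (pullback σ (OneForms E M)) where
  toFun i := extendLinear (exteriorD ∘ₗ sigmaPairing σ) i
  map_smul h a m := extendLinear_smul _ h a m
  map_d h m := extendLinear_diff _ (sigmaPairing σ) h m

/-- The map `α ↦ (W ↦ ⟨d⟨σ, α⟩, W⟩)`. -/
def derivSigma (σ : C^∞⟮𝓘(ℝ, E), M; 𝓘(ℝ, V), V⟯) :
    Module.Dual ℝ V →ₗ[ℝ] VectorFields E M →ₗ[SmoothFun E M] SmoothFun E M where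
  toFun α := pairing (exteriorD (sigmaPairing σ α))
  map_add' α β := by rw [map_add, map_add, map_add]
  map_smul' c α := by
    rw [map_smul, map_smul]
    rfl

/-- The morphism `dσ : ι^*T_M → V_X`, `a ⊗ W ↦ a · W(σ)`, where `W(σ) = ∑ⱼ W(⟨σ, eʲ⟩) ⊗ eⱼ`. -/
def dSigma (σ : C^∞⟮𝓘(ℝ, E), M; 𝓘(ℝ, V), V⟯) :
    DGHom (pullback σ (VectorFields E M)) (trivialModule (quasiSmooth σ) V) where
  toFun i := contractLinear (derivSigma σ) i
  map_smul h a m := contractLinear_smul _ h a m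
  map_d h m := contractLinear_diff _ (sigmaPairing σ) h m
/-- `dσ` is dual to `(dσ)^*`: pairing `dσ(a ⊗ W)` with `α` gives the pairing of `a ⊗ W` with
`(dσ)^* α = d⟨σ, α⟩`. -/
theorem dSigma_dual (σ : C^∞⟮𝓘(ℝ, E), M; 𝓘(ℝ, V), V⟯) (i : ℤ)
    (a : KoszulPart (SmoothFun E M) V i) (W : VectorFields E M) (α : Module.Dual ℝ V) :
    TensorProduct.rid ℝ _ (α.lTensor (KoszulPart (SmoothFun E M) V i)
      ((dSigma σ).toFun i (a ⊗ₜ[SmoothFun E M] W))) =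
      pairing (exteriorD (sigmaPairing σ α)) W • a :=
  contractLinear_pairing (derivSigma σ) i a W α

end Main

end DGManifold

end

open DGManifold

/-! As a graded algebra `C^∞(X)` is generated over `C^∞(M)` by the covectors in degree `-1`, with no
relations beyond linearity and graded commutativity. A `C^∞`-derivation is therefore a
`C^∞`-derivation of `C^∞(M)` together with an arbitrary linear map on `V*`. The second datum is
represented by `V*_X[1]`. Once the first is known to be represented by `ι^*T*_M`, the graded module
of differentials is the sum of the two, and its differential is forced by `δ(dα) = d(δα) = d⟨σ, α⟩`.
This is the cone of `(dσ)^*`.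

The analytic core is that one-forms represent the `C^∞`-derivations `D` of `C^∞(M)` with values in
an arbitrary module. Neither continuity of `D` nor a pointwise description of the module is
available, only the chain rule, which involves finitely many functions at a time. So every `g` has
to be expressed, on the members of a finite cover, as a smooth function of a fixed finite list of
functions. For noncompact `M` the cover is made of open sets that are disjoint unions of countably
many chart pieces (`exists_finite_chartSum_cover`): shifted grids in the charts and three families
of shells of an exhaustion suffice. On such a set `g` is a smooth function of the chart coordinates
and of the integer label of the piece. A derivation kills the label (`smul_labelFun_eq_zero`), which
leaves the usual coordinate formula (`smul_derivation_eq_sum`). A partition of unity then gives a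
`DifferentialFrame`: finitely many functions `xᵢ` and vector fields `Xᵢ` with `D g = ∑ dg(Xᵢ) D xᵢ`
for every `D`. The `dxᵢ` and `Xᵢ` are at the same time dual generating systems of the one-forms and
the vector fields.

On the algebraic side, `coneDerivation` is the universal derivation. Its universality
(`isKahlerDifferentials_cone`) combines the frame with the fact that a derivation is determined on
functions and covectors. Universal objects are unique, and even the compatibility of the comparison
map with the differentials follows from universality (`hom_comm`). For the tangent module, a map `φ`
from the cone is recorded by `∑ φ(dxᵢ) ⊗ Xᵢ` and, up to sign, `∑ φ(deˡ) ⊗ eₗ`. In the differential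
of `φ` the term `φ(d⟨σ, α⟩)` becomes `dσ` of the first component, which is the differential of the
cocone (`dualConeIso`). -/

namespace DGManifold

/-! ### Covering a manifold by finitely many sums of charts. -/

section ChartCover
open Set Filter Topology

theorem continuousAt_floor_of_notMem_range {z : ℝ} (hz : z ∉ range ((↑) : ℤ → ℝ)) :
    ContinuousAt (Int.floor : ℝ → ℤ) z := by
  have hlt : (⌊z⌋ : ℝ) < z := lt_of_le_of_ne (Int.floor_le z) fun h => hz ⟨_, h⟩
  refine (continuousAt_const (y := ⌊z⌋)).congr ?_
  filter_upwards [Ioo_mem_nhds hlt (Int.lt_floor_add_one z)] with y hy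
  exact (Int.floor_eq_iff.2 ⟨hy.1.le, hy.2⟩).symm

/-- A finite-dimensional normed space is covered by `2ⁿ` open sets, each of which is a disjoint union
of open cells (the fibres of a locally constant map) of small diameter. -/
theorem exists_cell_cover (E : Type*) [NormedAddCommGroup E] [NormedSpace ℝ E]
    [FiniteDimensional ℝ E] {δ : ℝ} (hδ : 0 < δ) :
    ∃ (U : (Fin (Module.finrank ℝ E) → Fin 2) → Set E)
      (cell : (Fin (Module.finrank ℝ E) → Fin 2) → E → (Fin (Module.finrank ℝ E) → ℤ)),
      (∀ c, IsOpen (U c)) ∧ (∀ c, ContinuousOn (cell c) (U c)) ∧ (∀ y, ∃ c, y ∈ U c) ∧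
      ∀ c x y, cell c x = cell c y → dist x y < δ := by
  set n := Module.finrank ℝ E
  let φ : E ≃L[ℝ] (Fin n → ℝ) := ContinuousLinearEquiv.ofFinrankEq (by simp [n])
  obtain ⟨K, hK, hφ⟩ := φ.symm.toContinuousLinearMap.bound
  -- The cells are cubes of side `2ε` in linear coordinates, and `c` shifts the grid by `ε` in the
  -- selected directions. A cell has diameter at most `2Kε < δ` in the norm of `E`.
  let ε : ℝ := δ / (2 * K + 1)
  have hε : 0 < ε := by positivity
  let r : (Fin n → Fin 2) → Fin n → E → ℝ := fun c i y => (φ y i / ε - (c i : ℕ)) / 2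
  have hr : ∀ c i, Continuous (r c i) := fun c i => by
    have : Continuous fun y => φ y i := (continuous_apply i).comp φ.continuous
    fun_prop
  refine ⟨fun c => ⋂ i, (r c i) ⁻¹' (range ((↑) : ℤ → ℝ))ᶜ, fun c y i => ⌊r c i y⌋, fun c => ?_,
    fun c => ?_, fun y => ?_, fun c x y h => ?_⟩
  · exact isOpen_iInter_of_finite fun i =>
      Int.isClosedEmbedding_coe_real.isClosed_range.isOpen_compl.preimage (hr c i)
  · refine continuousOn_pi.2 fun i y hy => ?_
    exact ((continuousAt_floor_of_notMem_range (mem_iInter.1 hy i)).comp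
      (hr c i).continuousAt).continuousWithinAt
  -- The two shifts differ by half a cell, so a coordinate cannot lie on the walls of both grids.
  · have : ∀ i, ∃ c : Fin 2, (φ y i / ε - (c : ℕ)) / 2 ∉ range ((↑) : ℤ → ℝ) := by
      intro i
      by_contra! h
      obtain ⟨a, ha⟩ := h 0
      obtain ⟨b, hb⟩ := h 1
      have : (2 * (a - b) : ℝ) = 1 := by rw [ha, hb]; push_cast [Fin.val_zero, Fin.val_one]; ring
      have : 2 * (a - b) = 1 := by exact_mod_cast this
      omega
    choose c hc using this
    exact ⟨c, mem_iInter.2 hc⟩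
  · have hn : ‖φ x - φ y‖ ≤ 2 * ε := by
      refine (pi_norm_le_iff_of_nonneg (by positivity)).2 fun i => ?_
      have := Int.abs_sub_lt_one_of_floor_eq_floor (congrFun h i)
      have e : r c i x - r c i y = (φ x i - φ y i) / (2 * ε) := by
        simp only [r]; field_simp; ring
      rw [e, abs_div, abs_of_pos (by positivity : 0 < 2 * ε), div_lt_one (by positivity)] at this
      exact this.le
    calc dist x y = ‖φ.symm (φ x - φ y)‖ := by rw [map_sub]; simp [dist_eq_norm]
      _ ≤ K * ‖φ x - φ y‖ := hφ _
      _ ≤ K * (2 * ε) := by gcongr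
      _ < δ := by
        simp only [ε]
        rw [mul_div_assoc', mul_div_assoc', div_lt_iff₀ (by positivity)]
        nlinarith

variable (E : Type*) [NormedAddCommGroup E] {M : Type*} [TopologicalSpace M] [ChartedSpace E M]

/-- An open set is a sum of charts if it is the disjoint union of countably many open pieces (the
fibres of a locally constant function), each contained in a compact subset of a chart domain. -/
structure IsChartSum (W : Set M) : Prop where
  isOpen : IsOpen W
  exists_label : ∃ t : M → ℕ, ContinuousOn t W ∧ ∀ x ∈ W, ∃ p : M, ∃ L : Set M, IsCompact L ∧
    L ⊆ (chartAt E p).source ∧ ∀ y ∈ W, t y = t x → y ∈ L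

variable {E}

theorem IsChartSum.mono {W P : Set M} (h : IsChartSum E W) (hP : IsOpen P) (hPW : P ⊆ W) :
    IsChartSum E P := by
  obtain ⟨t, ht, hL⟩ := h.exists_label
  refine ⟨hP, t, ht.mono hPW, fun x hx => ?_⟩
  obtain ⟨p, L, h₁, h₂, h₃⟩ := hL x (hPW hx)
  exact ⟨p, L, h₁, h₂, fun y hy => h₃ y (hPW hy)⟩

theorem isChartSum_of_subset_compact {P L : Set M} (hP : IsOpen P) (hL : IsCompact L) (p : M)
    (hLp : L ⊆ (chartAt E p).source) (hPL : P ⊆ L) : IsChartSum E P :=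
  ⟨hP, fun _ => 0, continuousOn_const, fun _ _ => ⟨p, L, hL, hLp, fun _ hy _ => hPL hy⟩⟩

/-- Disjointness makes the index of the member containing a point locally constant on the union.
Pairing this index with the label inside the member is again a label, because countably many
families of countably many pieces form a countable family. -/
theorem isChartSum_iUnion {W : ℕ → Set M} (h : ∀ k, IsChartSum E (W k))
    (hd : Pairwise (Function.onFun Disjoint W)) : IsChartSum E (⋃ k, W k) := by
  classical
  choose t ht hL using fun k => (h k).exists_label
  have hidx : ∃ s : M → ℕ, ∀ k, ∀ x ∈ W k, s x = k := by
    refine ⟨fun x => if hx : ∃ k, x ∈ W k then hx.choose else 0, fun k x hx => ?_⟩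
    have hx' : ∃ k, x ∈ W k := ⟨k, hx⟩
    simp only [dif_pos hx']
    by_contra hne
    exact (hd hne).le_bot ⟨hx'.choose_spec, hx⟩
  obtain ⟨s, hs⟩ := hidx
  refine ⟨isOpen_iUnion fun k => (h k).isOpen, fun x => Nat.pair (s x) (t (s x) x), ?_, ?_⟩
  · intro x hx
    obtain ⟨k, hk⟩ := mem_iUnion.1 hx
    have hc : ContinuousAt (fun x => Nat.pair k (t k x)) x :=
      (continuous_of_discreteTopology (f := Nat.pair k)).continuousAt.comp
        ((ht k).continuousAt ((h k).isOpen.mem_nhds hk))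
    refine (hc.congr ?_).continuousWithinAt
    filter_upwards [(h k).isOpen.mem_nhds hk] with y hy
    rw [hs k y hy]
  · intro x hx
    obtain ⟨k, hk⟩ := mem_iUnion.1 hx
    obtain ⟨p, L, h₁, h₂, h₃⟩ := hL k x hk
    refine ⟨p, L, h₁, h₂, fun y hy hxy => ?_⟩
    obtain ⟨l, hl⟩ := mem_iUnion.1 hy
    simp only [hs k x hk, hs l y hl, Nat.pair_eq_pair] at hxy
    obtain ⟨rfl, hxy⟩ := hxy
    exact h₃ y hl hxy

theorem IsChartSum.union {P Q : Set M} (hP : IsChartSum E P) (hQ : IsChartSum E Q)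
    (hd : Disjoint P Q) : IsChartSum E (P ∪ Q) := by
  have hempty : IsChartSum E (∅ : Set M) :=
    ⟨isOpen_empty, fun _ => 0, continuousOn_const, fun x hx => hx.elim⟩
  let W : ℕ → Set M := fun k => if k = 0 then P else if k = 1 then Q else ∅
  have hU : P ∪ Q = ⋃ k, W k := by
    ext x
    simp only [mem_union, mem_iUnion, W]
    constructor
    · rintro (h | h)
      · exact ⟨0, by simpa using h⟩
      · exact ⟨1, by simpa using h⟩
    · rintro ⟨k, hk⟩
      split_ifs at hk with h0 h1
      exacts [Or.inl hk, Or.inr hk, hk.elim]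
  rw [hU]
  refine isChartSum_iUnion (fun k => ?_) fun k l hkl => ?_
  · simp only [W]; split_ifs <;> assumption
  · simp only [Function.onFun, W]
    split_ifs with h0 h1 h2 h3 h4 h5 <;> first | (exfalso; omega) | simp [hd, hd.symm]

variable [NormedSpace ℝ E] [FiniteDimensional ℝ E] [T2Space M]

theorem isOpen_inter_preimage_discrete {X D : Type*} [TopologicalSpace X] [TopologicalSpace D]
    [DiscreteTopology D] {f : X → D} {U : Set X} (hU : IsOpen U) (hf : ContinuousOn f U)
    (S : Set D) : IsOpen (U ∩ f ⁻¹' S) :=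
  hf.isOpen_inter_preimage hU (isOpen_discrete S)

/-- A compact subset of a chart domain can be added to a set covered by sums of charts, without
increasing the number of sums. -/
theorem exists_chartSum_cover_union {A K : Set M} (hA : IsCompact A) (hK : IsCompact K) (p : M)
    (hKp : K ⊆ (chartAt E p).source) {W : (Fin (Module.finrank ℝ E) → Fin 2) → Set M}
    (hW : ∀ c, IsChartSum E (W c)) (hAW : A ⊆ ⋃ c, W c) :
    ∃ W' : (Fin (Module.finrank ℝ E) → Fin 2) → Set M,
      (∀ c, IsChartSum E (W' c)) ∧ A ∪ K ⊆ ⋃ c, W' c := by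
  have : LocallyCompactSpace M := ChartedSpace.locallyCompactSpace E M
  -- Each `W c` is shrunk to an open `Y c` with compact closure inside `W c`, the `Y c` still
  -- covering `A`. The compactness gives a uniform margin in which whole cells can be added.
  obtain ⟨C, hC, hCW, hAC⟩ := hA.finite_compact_cover Finset.univ W (fun c _ => (hW c).isOpen)
    (by simpa using hAW)
  choose Y hYo hCY hYW hYc using fun c =>
    exists_open_between_and_isCompact_closure (hC c) (hW c).isOpen (hCW c)
  set e := chartAt E p
  obtain ⟨L, hL, hKL, hLe⟩ := exists_compact_between hK e.open_source hKp
  have heopen : ∀ {S : Set M}, IsOpen S → S ⊆ e.source → IsOpen (e '' S) := fun hS hSe =>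
    e.isOpen_image_of_subset_source hS hSe
  obtain ⟨δ₀, hδ₀, hδ₀K⟩ := (hK.image_of_continuousOn (e.continuousOn.mono hKp)).exists_thickening_subset_open
    (heopen isOpen_interior (interior_subset.trans hLe)) (image_mono hKL)
  -- Below this scale a cell that meets `Y c` within `L` stays inside `W c`. Below the scale `δ₀` a
  -- cell that meets `K` stays inside `L`.
  have hδ : ∀ c, ∃ δ, 0 < δ ∧ Metric.thickening δ (e '' (closure (Y c) ∩ L)) ⊆
      e '' (W c ∩ e.source) := fun c =>
    (((hYc c).inter hL).image_of_continuousOn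
      (e.continuousOn.mono (inter_subset_right.trans hLe))).exists_thickening_subset_open
      (heopen ((hW c).isOpen.inter e.open_source) inter_subset_right)
      (image_mono (inter_subset_inter (hYW c) hLe))
  choose δ hδpos hδW using hδ
  obtain ⟨η, hη, hηδ₀, hηδ⟩ : ∃ η, 0 < η ∧ η ≤ δ₀ ∧ ∀ c, η ≤ δ c := by
    have hne : (Finset.univ : Finset (Fin (Module.finrank ℝ E) → Fin 2)).Nonempty :=
      Finset.univ_nonempty
    refine ⟨min δ₀ (Finset.univ.inf' hne δ), lt_min hδ₀ ?_, min_le_left _ _, fun c =>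
      (min_le_right _ _).trans (Finset.inf'_le _ (Finset.mem_univ c))⟩
    exact (Finset.lt_inf'_iff _).2 fun c _ => hδpos c
  obtain ⟨U, cell, hU, hcell, hcov, hdist⟩ := exists_cell_cover E hη
  let O : (Fin (Module.finrank ℝ E) → Fin 2) → Set M := fun c => e.source ∩ e ⁻¹' (U c)
  have hO : ∀ c, IsOpen (O c) := fun c => e.isOpen_inter_preimage (hU c)
  have hlab : ∀ c, ContinuousOn (fun x => cell c (e x)) (O c) := fun c =>
    (hcell c).comp (e.continuousOn.mono inter_subset_left) fun x hx => hx.2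
  -- `near` selects the cells containing points of `K`, and `meets` the cells containing points of
  -- `Y c`.
  let near : (Fin (Module.finrank ℝ E) → Fin 2) → Set (Fin (Module.finrank ℝ E) → ℤ) :=
    fun c => {k | ∃ y ∈ K, cell c (e y) = k}
  let meets : (Fin (Module.finrank ℝ E) → Fin 2) → Set (Fin (Module.finrank ℝ E) → ℤ) :=
    fun c => {k | ∃ y ∈ O c ∩ Y c, cell c (e y) = k}
  have hL' : ∀ c, ∀ x ∈ O c, cell c (e x) ∈ near c → x ∈ L := by
    rintro c x hx ⟨y, hy, hxy⟩
    have : e x ∈ Metric.thickening δ₀ (e '' K) :=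
      Metric.mem_thickening_iff.2 ⟨e y, mem_image_of_mem _ hy,
        (hdist c _ _ hxy.symm).trans_le hηδ₀⟩
    obtain ⟨z, hz, hzx⟩ := hδ₀K this
    rw [← e.injOn (hLe (interior_subset hz)) hx.1 hzx]
    exact interior_subset hz
  -- A cell near `K` that touches `Y c` already lies in `W c`, so it can be absorbed there without
  -- spoiling the decomposition. The cells near `K` that miss `Y c` form a set disjoint from this
  -- and contained in the compact `L` of a single chart. The number of colours therefore does not
  -- grow.
  refine ⟨fun c => (Y c ∪ (O c ∩ (fun x => cell c (e x)) ⁻¹' (near c ∩ meets c))) ∪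
    (O c ∩ (fun x => cell c (e x)) ⁻¹' (near c \ meets c)), fun c => ?_, ?_⟩
  · refine IsChartSum.union ((hW c).mono ?_ ?_) ?_ ?_
    · exact (hYo c).union (isOpen_inter_preimage_discrete (hO c) (hlab c) _)
    · refine union_subset (subset_closure.trans (hYW c)) ?_
      rintro x ⟨hx, hxn, y, hy, hxy⟩
      have hyL : y ∈ L := hL' c y hy.1 (by rw [hxy]; exact hxn)
      have : e x ∈ Metric.thickening (δ c) (e '' (closure (Y c) ∩ L)) :=
        Metric.mem_thickening_iff.2 ⟨e y, mem_image_of_mem _ ⟨subset_closure hy.2, hyL⟩,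
          (hdist c _ _ hxy.symm).trans_le (hηδ c)⟩
      obtain ⟨z, hz, hzx⟩ := hδW c this
      rw [← e.injOn hz.2 hx.1 hzx]
      exact hz.1
    · exact isChartSum_of_subset_compact (isOpen_inter_preimage_discrete (hO c) (hlab c) _) hL p hLe
        fun x hx => hL' c x hx.1 hx.2.1
    · refine disjoint_left.2 ?_
      rintro x (hx | hx) ⟨hxO, hxn, hxm⟩
      · exact hxm ⟨x, ⟨hxO, hx⟩, rfl⟩
      · exact hxm hx.2.2
  · rintro x (hx | hx)
    · rw [hAC] at hx
      obtain ⟨c, -, hc⟩ := mem_iUnion₂.1 hx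
      exact mem_iUnion.2 ⟨c, Or.inl (Or.inl (hCY c hc))⟩
    · obtain ⟨c, hc⟩ := hcov (e x)
      refine mem_iUnion.2 ⟨c, ?_⟩
      by_cases hm : cell c (e x) ∈ meets c
      · exact Or.inl (Or.inr ⟨⟨hKp hx, hc⟩, ⟨x, hx, rfl⟩, hm⟩)
      · exact Or.inr ⟨⟨hKp hx, hc⟩, ⟨x, hx, rfl⟩, hm⟩

/-- Finitely many compact pieces of chart domains cover `K`, and they are added one at a time with
the set of colours kept fixed. -/
theorem exists_chartSum_cover_of_isCompact {K : Set M} (hK : IsCompact K) :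
    ∃ W : (Fin (Module.finrank ℝ E) → Fin 2) → Set M,
      (∀ c, IsChartSum E (W c)) ∧ K ⊆ ⋃ c, W c := by
  classical
  have : LocallyCompactSpace M := ChartedSpace.locallyCompactSpace E M
  choose L hLc hL hLe using fun p : M =>
    exists_compact_subset (chartAt E p).open_source (mem_chart_source E p)
  obtain ⟨F, hF⟩ := hK.elim_finite_subcover (fun p => interior (L p)) (fun _ => isOpen_interior)
    fun x _ => mem_iUnion.2 ⟨x, hL x⟩
  have key : ∀ F : Finset M, ∃ W : (Fin (Module.finrank ℝ E) → Fin 2) → Set M,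
      (∀ c, IsChartSum E (W c)) ∧ ⋃ p ∈ F, L p ⊆ ⋃ c, W c := by
    intro F
    induction F using Finset.induction with
    | empty =>
      exact ⟨fun _ => ∅, fun _ => ⟨isOpen_empty, fun _ => 0, continuousOn_const,
        fun x hx => hx.elim⟩, by simp⟩
    | insert p F _ ih =>
      obtain ⟨W, hW, hFW⟩ := ih
      obtain ⟨W', hW', h⟩ := exists_chartSum_cover_union (F.isCompact_biUnion fun p _ => hLc p)
        (hLc p) p (hLe p) hW hFW
      refine ⟨W', hW', ?_⟩
      rw [Finset.set_biUnion_insert, union_comm]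
      exact h
  obtain ⟨W, hW, hFW⟩ := key F
  exact ⟨W, hW, hF.trans ((iUnion₂_mono fun p _ => interior_subset).trans hFW)⟩

variable (E M) in
/-- A manifold is covered by finitely many sums of charts. -/
theorem exists_finite_chartSum_cover [SigmaCompactSpace M] :
    ∃ W : Fin 3 × (Fin (Module.finrank ℝ E) → Fin 2) → Set M,
      (∀ c, IsChartSum E (W c)) ∧ ⋃ c, W c = univ := by
  have : LocallyCompactSpace M := ChartedSpace.locallyCompactSpace E M
  -- The shift makes `K 0` empty, so the least `m` with `x ∈ K m` is positive and the truncated `m -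
  -- 2` is strictly smaller than `m`.
  let K : CompactExhaustion M := (default : CompactExhaustion M).shiftr
  choose W hW hKW using fun m => exists_chartSum_cover_of_isCompact (E := E) (K.isCompact m)
  -- Shells whose indices differ by at least three are disjoint, so the shells in one residue class
  -- modulo `3` combine into a single chart sum for each colour.
  let O : ℕ → Set M := fun m => interior (K (m + 1)) \ K (m - 2)
  have hO : ∀ m, IsOpen (O m) := fun m => isOpen_interior.sdiff (K.isCompact _).isClosed
  have hOO : ∀ a b, a + 3 ≤ b → Disjoint (O a) (O b) := fun a b hab =>
    disjoint_left.2 fun x hx hx' => hx'.2 (K.subset (by omega) (interior_subset hx.1))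
  refine ⟨fun c => ⋃ k, O (3 * k + c.1) ∩ W (3 * k + c.1) c.2, fun c =>
    isChartSum_iUnion (fun k => (hW _ _).mono ((hO _).inter (hW _ _).isOpen) inter_subset_right)
      fun k l hkl => ?_, ?_⟩
  · refine Disjoint.mono inter_subset_left inter_subset_left ?_
    rcases lt_or_gt_of_ne hkl with h | h
    · exact hOO _ _ (by omega)
    · exact (hOO _ _ (by omega)).symm
  · refine eq_univ_of_forall fun x => ?_
    classical
    have hx := K.exists_mem x
    have hm := Nat.find_spec hx
    have hpos : Nat.find hx ≠ 0 := fun h0 => by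
      rw [h0] at hm
      exact hm
    obtain ⟨c, hc⟩ := mem_iUnion.1 (hKW _ hm)
    refine mem_iUnion.2 ⟨(⟨Nat.find hx % 3, Nat.mod_lt _ (by norm_num)⟩, c),
      mem_iUnion.2 ⟨Nat.find hx / 3, ?_⟩⟩
    dsimp only
    rw [Nat.div_add_mod]
    exact ⟨⟨K.subset_interior_succ _ hm, Nat.find_min hx (by omega)⟩, hc⟩

end ChartCover

/-! ### `C^∞`-derivations of `C^∞(M)` and the chain rule. -/

section Derivations

variable {E : Type*} [NormedAddCommGroup E] [NormedSpace ℝ E]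
  {M : Type*} [TopologicalSpace M] [ChartedSpace E M]
  {N : Type*} [AddCommGroup N] [Module (SmoothFun E M) N]

/-- A map from `C^∞(M)` to a module is a `C^∞`-derivation if it satisfies the chain rule for all smooth
functions of several variables. -/
def IsCInfDer (D : SmoothFun E M → N) : Prop :=
  ∀ {k : ℕ} (f : CInfFun k) (a : Fin k → SmoothFun E M),
    D (cinfApply f a) = ∑ i, cinfApply (f.partialDeriv i) a • D (a i)

theorem CInfFun.partialDeriv_apply {n : ℕ} (f : CInfFun n) (i : Fin n) (x : Fin n → ℝ)
    {f' : (Fin n → ℝ) →L[ℝ] ℝ} (h : HasFDerivAt f.toFun f' x) :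
    (f.partialDeriv i).toFun x = f' (Pi.single i 1) := by
  show fderiv ℝ f.toFun x _ = _
  rw [h.fderiv]

variable {D : SmoothFun E M → N}

/-- The Leibniz rule is the chain rule for the smooth function `x₀ x₁` of two variables. -/
theorem IsCInfDer.mul (hD : IsCInfDer D) (a b : SmoothFun E M) :
    D (a * b) = a • D b + b • D a := by
  have h := hD ((CInfFun.proj (0 : Fin 2)).mul (CInfFun.proj 1)) ![a, b]
  have key0 : cinfApply
      (((CInfFun.proj (0 : Fin 2)).mul (CInfFun.proj 1)).partialDeriv 0) ![a, b] = b := by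
    ext x
    refine (CInfFun.partialDeriv_apply _ 0 _ ((hasFDerivAt_apply (0 : Fin 2) _).mul
      (hasFDerivAt_apply (1 : Fin 2) _))).trans ?_
    simp [CInfFun.proj]
  have key1 : cinfApply
      (((CInfFun.proj (0 : Fin 2)).mul (CInfFun.proj 1)).partialDeriv 1) ![a, b] = a := by
    ext x
    refine (CInfFun.partialDeriv_apply _ 1 _ ((hasFDerivAt_apply (0 : Fin 2) _).mul
      (hasFDerivAt_apply (1 : Fin 2) _))).trans ?_
    simp [CInfFun.proj]
  rw [Fin.sum_univ_two, key0, key1, add_comm] at h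
  exact h

/-- The chain rule for a smooth function of one variable. -/
theorem IsCInfDer.comp_one (hD : IsCInfDer D) (h : ℝ → ℝ) (hh : ContDiff ℝ ∞ h)
    (a : SmoothFun E M) {c : SmoothFun E M} (hc : ∀ x, c x = h (a x)) {c' : SmoothFun E M}
    (hc' : ∀ x, c' x = deriv h (a x)) : D c = c' • D a := by
  let f : CInfFun 1 := ⟨fun y => h (y 0), hh.comp (contDiff_apply ℝ ℝ 0)⟩
  have := hD f ![a]
  have e1 : cinfApply f ![a] = c := by
    ext x
    exact (hc x).symm
  have e2 : cinfApply (f.partialDeriv 0) ![a] = c' := by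
    ext x
    have hd : HasDerivAt h (deriv h (a x)) (a x) :=
      (hh.differentiable (by simp)).differentiableAt.hasDerivAt
    refine (CInfFun.partialDeriv_apply f 0 (fun i => ![a] i x)
      (HasFDerivAt.comp (g := h) _ hd.hasFDerivAt (hasFDerivAt_apply (0 : Fin 1) _))).trans ?_
    rw [hc']
    simp
  rw [Fin.sum_univ_one, e1, e2] at this
  exact this

/-- The differential of a smooth function at a point. -/
noncomputable def differentialAt (f : SmoothFun E M) (x : M) : TangentSpace 𝓘(ℝ, E) x →L[ℝ] ℝ :=
  mfderiv 𝓘(ℝ, E) 𝓘(ℝ, ℝ) f x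

theorem differentialAt_cinfApply {k : ℕ} (f : CInfFun k) (a : Fin k → SmoothFun E M) (x : M)
    (v : TangentSpace 𝓘(ℝ, E) x) : differentialAt (cinfApply f a) x v =
      ∑ i, (f.partialDeriv i).toFun (fun j => a j x) * differentialAt (a i) x v := by
  let A : M → (Fin k → ℝ) := fun y i => a i y
  have hA : MDifferentiableAt 𝓘(ℝ, E) 𝓘(ℝ, Fin k → ℝ) A x :=
    (contMDiff_pi_space.2 fun i => (a i).contMDiff).mdifferentiable (by simp) x
  let A' : E →L[ℝ] (Fin k → ℝ) := mfderiv 𝓘(ℝ, E) 𝓘(ℝ, Fin k → ℝ) A x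
  have h1 : ∀ i, differentialAt (a i) x v = A' v i := by
    intro i
    have := mfderiv_comp (I := 𝓘(ℝ, E)) (I' := 𝓘(ℝ, Fin k → ℝ)) (I'' := 𝓘(ℝ, ℝ)) x
      (g := fun y : Fin k → ℝ => y i) (f := A)
      (hasFDerivAt_apply i (A x)).differentiableAt.mdifferentiableAt hA
    rw [mfderiv_eq_fderiv, (hasFDerivAt_apply i (A x)).fderiv] at this
    exact DFunLike.congr_fun this v
  have hf : DifferentiableAt ℝ f.toFun (A x) := (f.smooth.differentiable (by simp)) _
  have h2 : differentialAt (cinfApply f a) x v = fderiv ℝ f.toFun (A x) (A' v) := by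
    have := mfderiv_comp (I := 𝓘(ℝ, E)) (I' := 𝓘(ℝ, Fin k → ℝ)) (I'' := 𝓘(ℝ, ℝ)) x
      (g := f.toFun) (f := A) hf.mdifferentiableAt hA
    rw [mfderiv_eq_fderiv] at this
    exact DFunLike.congr_fun this v
  rw [h2]
  conv_lhs => rw [pi_eq_sum_univ' (A' v), map_sum]
  refine Finset.sum_congr rfl fun i _ => ?_
  rw [map_smul, h1, smul_eq_mul, mul_comm]
  rfl

variable [IsManifold 𝓘(ℝ, E) ∞ M]

theorem pairing_exteriorD_apply (f : SmoothFun E M) (X : VectorFields E M) (x : M) :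
    pairing (exteriorD f) X x = differentialAt f x (X x) := rfl

/-- The exterior derivative satisfies the chain rule. -/
theorem isCInfDer_exteriorD : IsCInfDer (exteriorD : SmoothFun E M → OneForms E M) := by
  intro k f a
  refine ContMDiffSection.ext fun x => ContinuousLinearMap.ext fun v => ?_
  let ev : OneForms E M →+ ℝ :=
    { toFun := fun θ => θ x v, map_zero' := rfl, map_add' := fun _ _ => rfl }
  show _ = ev _
  rw [map_sum]
  exact differentialAt_cinfApply f a x v

end Derivations

/-! ### Cutoff functions and locality of derivations. -/

section Local

variable {E : Type*} [NormedAddCommGroup E] [NormedSpace ℝ E] [FiniteDimensional ℝ E]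
  {M : Type*} [TopologicalSpace M] [ChartedSpace E M] [IsManifold 𝓘(ℝ, E) ∞ M]
  [T2Space M] [SigmaCompactSpace M]
  {N : Type*} [AddCommGroup N] [Module (SmoothFun E M) N] {D : SmoothFun E M → N}

open Set Filter Topology

theorem exists_cutoff {S W : Set M} (hS : IsClosed S) (hW : IsOpen W) (hSW : S ⊆ W) :
    ∃ χ : SmoothFun E M, (∀ᶠ x in 𝓝ˢ S, χ x = 1) ∧ tsupport χ ⊆ W := by
  have : LocallyCompactSpace M := ChartedSpace.locallyCompactSpace E M
  obtain ⟨U, hU, hSU, hUW⟩ := normal_exists_closure_subset hS hW hSW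
  obtain ⟨χ, h1, h0, -⟩ := exists_contMDiffMap_one_nhds_of_subset_interior (n := ⊤) 𝓘(ℝ, E) hS
    (t := closure U) (hSU.trans (interior_maximal subset_closure hU))
  refine ⟨χ, h1, (closure_minimal (fun x hx => ?_) isClosed_closure).trans hUW⟩
  by_contra h
  exact hx (h0 x h)

/-- `C^∞`-derivations are local. -/
theorem IsCInfDer.local (hD : IsCInfDer D) (ψ a b : SmoothFun E M)
    (hab : ∀ᶠ x in 𝓝ˢ (tsupport ψ), a x = b x) : ψ • D a = ψ • D b := by
  obtain ⟨U, hU, hψU, hUab⟩ := mem_nhdsSet_iff_exists.1 hab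
  obtain ⟨χ, h1, hχ⟩ := exists_cutoff (E := E) (isClosed_tsupport ψ) hU hψU
  -- With `χ = 1` near the support of `ψ` and `χ` supported where `a = b`, the products `χ a` and `χ
  -- b` agree globally. Applying `D` and multiplying by `ψ`, the terms in `D χ` cancel because `ψ a
  -- = ψ b`.
  have e1 : χ * a = χ * b := by
    ext x
    by_cases hx : x ∈ U
    · show χ x * a x = χ x * b x
      rw [hUab hx]
    · have : χ x = 0 := image_eq_zero_of_notMem_tsupport fun h => hx (hχ h)
      show χ x * a x = χ x * b x
      rw [this, zero_mul, zero_mul]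
  have e2 : ψ * χ = ψ := by
    ext x
    show ψ x * χ x = ψ x
    by_cases hx : x ∈ tsupport ψ
    · rw [h1.self_of_nhdsSet x hx, mul_one]
    · rw [image_eq_zero_of_notMem_tsupport hx, zero_mul]
  have e3 : ψ * a = ψ * b := by
    ext x
    show ψ x * a x = ψ x * b x
    by_cases hx : x ∈ tsupport ψ
    · rw [hUab (hψU hx)]
    · rw [image_eq_zero_of_notMem_tsupport hx, zero_mul, zero_mul]
  have h := congrArg (ψ • ·) (congrArg D e1)
  simp only [hD.mul, smul_add, smul_smul, e2, e3, add_left_inj] at h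
  exact h

end Local

end DGManifold

namespace DGManifold

open Set Filter Topology

/-! ### Coordinates and coordinate vector fields on a sum of charts. -/

section Label

variable {E : Type*} [NormedAddCommGroup E] {M : Type*} [TopologicalSpace M] [ChartedSpace E M]

variable (E) in
/-- A presentation of an open set as the sum of the fibres of a locally constant function, each contained
in a compact piece of a chart domain. -/
structure ChartLabel (W : Set M) where
  isOpen : IsOpen W
  label : M → ℕ
  center : ℕ → M
  piece : ℕ → Set M
  continuousOn : ContinuousOn label W
  isCompact : ∀ k, IsCompact (piece k)
  subset : ∀ k, piece k ⊆ (chartAt E (center k)).source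
  mem : ∀ x ∈ W, x ∈ piece (label x)

/-- A chart and a compact piece are chosen for each label value instead of each point. An unused
label gets the empty piece and an arbitrary centre, which is why `M` has to be nonempty. -/
theorem IsChartSum.nonempty_chartLabel [Nonempty M] {W : Set M} (h : IsChartSum E W) :
    Nonempty (ChartLabel E W) := by
  obtain ⟨t, ht, hL⟩ := h.exists_label
  have : ∀ k, ∃ p : M, ∃ L : Set M, IsCompact L ∧ L ⊆ (chartAt E p).source ∧
      ∀ y ∈ W, t y = k → y ∈ L := by
    intro k
    by_cases hk : ∃ x ∈ W, t x = k
    · obtain ⟨x, hx, rfl⟩ := hk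
      exact hL x hx
    · exact ⟨Classical.arbitrary M, ∅, isCompact_empty, empty_subset _,
        fun y hy hyk => hk ⟨y, hy, hyk⟩⟩
  choose p L h₁ h₂ h₃ using this
  exact ⟨⟨h.isOpen, t, p, L, ht, h₁, h₂, fun x hx => h₃ _ x hx rfl⟩⟩

variable {W : Set M} (Λ : ChartLabel E W)

namespace ChartLabel

theorem eventually_label {x : M} (hx : x ∈ W) : ∀ᶠ y in 𝓝 x, y ∈ W ∧ Λ.label y = Λ.label x := by
  filter_upwards [Λ.isOpen.mem_nhds hx, (Λ.continuousOn.continuousAt (Λ.isOpen.mem_nhds hx)).eventually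
    (IsOpen.mem_nhds (isOpen_discrete {Λ.label x}) rfl)] with y hy hy'
  exact ⟨hy, hy'⟩

theorem mem_source {x : M} (hx : x ∈ W) : x ∈ (chartAt E (Λ.center (Λ.label x))).source :=
  Λ.subset _ (Λ.mem x hx)

variable [NormedSpace ℝ E]

/-- The coordinate of a point in the chart assigned to it. -/
noncomputable def chart (x : M) : E := extChartAt 𝓘(ℝ, E) (Λ.center (Λ.label x)) x

theorem eventually_chart {x : M} (hx : x ∈ W) :
    Λ.chart =ᶠ[𝓝 x] extChartAt 𝓘(ℝ, E) (Λ.center (Λ.label x)) := by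
  filter_upwards [Λ.eventually_label hx] with y hy
  rw [chart, hy.2]

variable [IsManifold 𝓘(ℝ, E) ∞ M]

theorem contMDiffAt_chart {x : M} (hx : x ∈ W) : ContMDiffAt 𝓘(ℝ, E) 𝓘(ℝ, E) ∞ Λ.chart x :=
  (contMDiffAt_extChartAt' (Λ.mem_source hx)).congr_of_eventuallyEq (Λ.eventually_chart hx)

variable {χ : SmoothFun E M} (hχ : tsupport χ ⊆ W)

/-- A function that is smooth on `W`, cut off by `χ`. -/
noncomputable def cutoff (f : M → ℝ) (hf : ∀ x ∈ W, ContMDiffAt 𝓘(ℝ, E) 𝓘(ℝ, ℝ) ∞ f x) : SmoothFun E M :=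
  ⟨fun x => χ x * f x, contMDiff_of_tsupport fun x hx => (χ.contMDiff x).mul
    (hf x (hχ (closure_mono (Function.support_mul_subset_left _ _) hx)))⟩

/-- The label, cut off by `χ`. -/
noncomputable def labelFun : SmoothFun E M :=
  cutoff hχ (fun x => (Λ.label x : ℝ)) fun x hx =>
    (contMDiffAt_const (c := (Λ.label x : ℝ))).congr_of_eventuallyEq
      ((Λ.eventually_label hx).mono fun _ hy => congrArg Nat.cast hy.2)

/-- The function equal to `χ g` on the `k`-th part of `W`, and zero elsewhere. -/
noncomputable def part (g : SmoothFun E M) (k : ℕ) : SmoothFun E M :=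
  cutoff hχ (fun x => if Λ.label x = k then g x else 0) fun x hx => by
    by_cases h : Λ.label x = k
    · refine (g.contMDiff x).congr_of_eventuallyEq ?_
      filter_upwards [Λ.eventually_label hx] with y hy
      rw [if_pos (hy.2.trans h)]
    · refine (contMDiffAt_const (c := (0 : ℝ))).congr_of_eventuallyEq ?_
      filter_upwards [Λ.eventually_label hx] with y hy
      rw [if_neg (by rwa [hy.2])]

variable [FiniteDimensional ℝ E]

/-- Linear coordinates on the model space. -/
noncomputable def modelCoord (E : Type*) [NormedAddCommGroup E] [NormedSpace ℝ E] [FiniteDimensional ℝ E] :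
    E ≃L[ℝ] (Fin (Module.finrank ℝ E) → ℝ) := ContinuousLinearEquiv.ofFinrankEq (by simp)

/-- The `j`-th coordinate, cut off by `χ`. -/
noncomputable def coord (j : Fin (Module.finrank ℝ E)) : SmoothFun E M :=
  cutoff hχ (fun x => modelCoord E (Λ.chart x) j) fun x hx => by
    have h : ContDiff ℝ ∞ fun y : E => modelCoord E y j :=
      (contDiff_apply ℝ ℝ j).comp (modelCoord E).contDiff
    exact h.contMDiff.contMDiffAt.comp x (Λ.contMDiffAt_chart hx)

/-- The basis of the model space dual to the linear coordinates. -/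
noncomputable def modelBasis (E : Type*) [NormedAddCommGroup E] [NormedSpace ℝ E] [FiniteDimensional ℝ E] :
    Module.Basis (Fin (Module.finrank ℝ E)) ℝ E := Module.Basis.ofEquivFun (modelCoord E).toLinearEquiv

variable {ψ : SmoothFun E M} (hψ : tsupport ψ ⊆ W)

/-- The `j`-th coordinate vector field, cut off by `ψ`. -/
noncomputable def field (j : Fin (Module.finrank ℝ E)) : VectorFields E M where
  toFun x := ψ x • (trivializationAt E (TangentSpace 𝓘(ℝ, E)) (Λ.center (Λ.label x))).localFrame
    (modelBasis E) j x
  contMDiff_toFun x := by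
    by_cases hx : x ∈ tsupport ψ
    · have h := (ψ.contMDiff x).smul_section (contMDiffAt_localFrame_of_mem (I := 𝓘(ℝ, E)) ∞
        (trivializationAt E (TangentSpace 𝓘(ℝ, E)) (Λ.center (Λ.label x))) (modelBasis E) j
        (x := x) (Λ.mem_source (hψ hx)))
      refine h.congr_of_eventuallyEq ?_
      filter_upwards [Λ.eventually_label (hψ hx)] with y hy
      rw [hy.2]
      rfl
    · refine (Bundle.contMDiff_zeroSection ℝ (TangentSpace 𝓘(ℝ, E) : M → Type _) x).congr_of_eventuallyEq ?_
      filter_upwards [(notMem_tsupport_iff_eventuallyEq.1 hx)] with y hy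
      rw [hy]
      simp [Bundle.zeroSection]

/-- The coordinate vector fields of the chart assigned to a point. -/
noncomputable def frame (x : M) (j : Fin (Module.finrank ℝ E)) : TangentSpace 𝓘(ℝ, E) x :=
  (trivializationAt E (TangentSpace 𝓘(ℝ, E)) (Λ.center (Λ.label x))).localFrame (modelBasis E) j x

theorem field_apply (j : Fin (Module.finrank ℝ E)) (x : M) :
    Λ.field hψ j x = ψ x • Λ.frame x j := rfl

/-- The derivative of the chart assigned to a point. -/
noncomputable def chartDeriv (x : M) : TangentSpace 𝓘(ℝ, E) x →L[ℝ] E :=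
  mfderiv 𝓘(ℝ, E) 𝓘(ℝ, E) (extChartAt 𝓘(ℝ, E) (Λ.center (Λ.label x))) x

theorem chartDeriv_injective {x : M} (hx : x ∈ W) : Function.Injective (Λ.chartDeriv x) :=
  (isInvertible_mfderiv_extChartAt
    (by rw [extChartAt_source]; exact Λ.mem_source hx)).injective

/-- The trivialization of the tangent bundle at the centre of the chart acts on fibres as the
derivative of the chart, and the local frame is by construction the preimage of `modelBasis E` under
it. -/
theorem chartDeriv_frame {x : M} (hx : x ∈ W) (j : Fin (Module.finrank ℝ E)) :
    Λ.chartDeriv x (Λ.frame x j) = modelBasis E j := by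
  have hb : x ∈ (trivializationAt E (TangentSpace 𝓘(ℝ, E)) (Λ.center (Λ.label x))).baseSet :=
    Λ.mem_source hx
  rw [chartDeriv, ← TangentBundle.continuousLinearMapAt_trivializationAt (Λ.mem_source hx), frame,
    Bundle.Trivialization.localFrame_apply_of_mem_baseSet _ _ hb]
  simp only [Bundle.Trivialization.basisAt, Module.Basis.map_apply]
  rw [Bundle.Trivialization.continuousLinearMapAt_apply,
    Bundle.Trivialization.linearMapAt_def_of_mem _ hb]
  exact LinearEquiv.apply_symm_apply _ _

/-- Near `x` the cutoff is `1` and the assigned chart does not change, so the function is a linear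
coordinate composed with one fixed chart. -/
theorem differentialAt_coord {x : M} (hx : x ∈ W) (h1 : ∀ᶠ y in 𝓝 x, χ y = 1)
    (j : Fin (Module.finrank ℝ E)) (v : TangentSpace 𝓘(ℝ, E) x) :
    differentialAt (Λ.coord hχ j) x v = modelCoord E (Λ.chartDeriv x v) j := by
  let ℓ : E →L[ℝ] ℝ := (ContinuousLinearMap.proj j).comp (modelCoord E).toContinuousLinearMap
  have he : (Λ.coord hχ j : M → ℝ) =ᶠ[𝓝 x] ℓ ∘ extChartAt 𝓘(ℝ, E) (Λ.center (Λ.label x)) := by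
    filter_upwards [h1, Λ.eventually_chart hx] with y hy hy'
    show χ y * modelCoord E (Λ.chart y) j = modelCoord E _ j
    rw [hy, hy', one_mul]
  have h := mfderiv_comp (I := 𝓘(ℝ, E)) (I' := 𝓘(ℝ, E)) (I'' := 𝓘(ℝ, ℝ)) x (g := ℓ)
    ℓ.differentiableAt.mdifferentiableAt
    ((contMDiffAt_extChartAt' (n := ∞) (Λ.mem_source hx)).mdifferentiableAt (by simp))
  rw [mfderiv_eq_fderiv, ℓ.fderiv] at h
  rw [differentialAt, he.mfderiv_eq, h]
  rfl

theorem differentialAt_labelFun {x : M} (hx : x ∈ W) (h1 : ∀ᶠ y in 𝓝 x, χ y = 1)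
    (v : TangentSpace 𝓘(ℝ, E) x) : differentialAt (Λ.labelFun hχ) x v = 0 := by
  have he : (Λ.labelFun hχ : M → ℝ) =ᶠ[𝓝 x] fun _ => (Λ.label x : ℝ) := by
    filter_upwards [h1, Λ.eventually_label hx] with y hy hy'
    show χ y * (Λ.label y : ℝ) = _
    rw [hy, hy'.2, one_mul]
  rw [differentialAt, he.mfderiv_eq, mfderiv_const]
  rfl

/-- The coordinates are cut off by `χ` and the fields by `ψ`. Where `ψ` lives, `χ` is locally `1`
and contributes no derivative, and elsewhere both sides vanish. -/
theorem differentialAt_coord_field (h1 : ∀ᶠ y in 𝓝ˢ (tsupport ψ), χ y = 1)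
    (i j : Fin (Module.finrank ℝ E)) (x : M) :
    differentialAt (Λ.coord hχ i) x (Λ.field hψ j x) = if i = j then ψ x else 0 := by
  by_cases hx : x ∈ tsupport ψ
  · rw [Λ.differentialAt_coord hχ (hψ hx) (h1.filter_mono (nhds_le_nhdsSet hx))]
    rw [field_apply, map_smul, Λ.chartDeriv_frame (hψ hx), map_smul]
    have : modelCoord E (modelBasis E j) = Pi.single j 1 := by
      simp [modelBasis]
    rw [this]
    simp [Pi.single_apply]
  · have h0 := image_eq_zero_of_notMem_tsupport hx
    simp [field_apply, h0]

/-- The vector fields and the differentials of the coordinates are dual on the support of `ψ`. -/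
theorem sum_differentialAt_smul_field (h1 : ∀ᶠ y in 𝓝ˢ (tsupport ψ), χ y = 1) (x : M)
    (v : TangentSpace 𝓘(ℝ, E) x) :
    ∑ j, differentialAt (Λ.coord hχ j) x v • Λ.field hψ j x = ψ x • v := by
  by_cases hx : x ∈ tsupport ψ
  · apply Λ.chartDeriv_injective (hψ hx)
    simp only [Λ.differentialAt_coord hχ (hψ hx) (h1.filter_mono (nhds_le_nhdsSet hx)), map_sum,
      map_smul, field_apply, Λ.chartDeriv_frame (hψ hx)]
    simp only [smul_comm _ (ψ x), ← Finset.smul_sum]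
    congr 1
    exact (modelBasis E).sum_equivFun (Λ.chartDeriv x v)
  · have h0 := image_eq_zero_of_notMem_tsupport hx
    simp [field_apply, h0]

end ChartLabel
end Label

/-! ### Functions on a sum of charts as smooth functions of the label and the coordinates. -/

section Extend

variable {E : Type*} [NormedAddCommGroup E] [NormedSpace ℝ E]
  {M : Type*} [TopologicalSpace M] [ChartedSpace E M] [IsManifold 𝓘(ℝ, E) ∞ M]

/-- The expression in a chart of a function with compact support in the chart domain. -/
noncomputable def chartExtend (u : M → ℝ) (p : M) : E → ℝ :=
  (extChartAt 𝓘(ℝ, E) p).target.indicator (u ∘ (extChartAt 𝓘(ℝ, E) p).symm)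

/-- Inside the target this is a composition with the inverse chart. The image of the compact `L` is
closed in all of `E`, so a point outside the target has a neighbourhood missing that image, and
there the extension is zero. -/
theorem contDiff_chartExtend {u : SmoothFun E M} {p : M} {L : Set M} (hL : IsCompact L)
    (hLp : L ⊆ (chartAt E p).source) (hu : ∀ x ∉ L, u x = 0) : ContDiff ℝ ∞ (chartExtend (E := E) u p) := by
  have hLe : L ⊆ (extChartAt 𝓘(ℝ, E) p).source := by rwa [extChartAt_source]
  have hc : IsClosed (extChartAt 𝓘(ℝ, E) p '' L) :=
    (hL.image_of_continuousOn ((continuousOn_extChartAt p).mono hLe)).isClosed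
  refine contDiff_iff_contDiffAt.2 fun z => ?_
  by_cases hz : z ∈ (extChartAt 𝓘(ℝ, E) p).target
  · have hn : (extChartAt 𝓘(ℝ, E) p).target ∈ 𝓝 z := (isOpen_extChartAt_target p).mem_nhds hz
    have h := ContMDiffAt.comp z (u.contMDiff ((extChartAt 𝓘(ℝ, E) p).symm z))
      ((contMDiffOn_extChartAt_symm (I := 𝓘(ℝ, E)) (n := ∞) p).contMDiffAt hn)
    refine (contMDiffAt_iff_contDiffAt.1 h).congr_of_eventuallyEq ?_
    filter_upwards [hn] with y hy
    exact indicator_of_mem hy _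
  · have hn : (extChartAt 𝓘(ℝ, E) p '' L)ᶜ ∈ 𝓝 z := hc.isOpen_compl.mem_nhds fun ⟨x, hx, hxz⟩ =>
      hz (hxz ▸ (extChartAt 𝓘(ℝ, E) p).map_source (hLe hx))
    refine (contDiffAt_const (c := (0 : ℝ))).congr_of_eventuallyEq ?_
    filter_upwards [hn] with y hy
    by_cases hyt : y ∈ (extChartAt 𝓘(ℝ, E) p).target
    · refine (indicator_of_mem hyt _).trans (hu _ fun hyL => hy ⟨_, hyL, ?_⟩)
      exact (extChartAt 𝓘(ℝ, E) p).right_inv hyt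
    · exact indicator_of_notMem hyt _

theorem chartExtend_apply (u : M → ℝ) (p : M) {x : M} (hx : x ∈ (chartAt E p).source) :
    chartExtend u p (extChartAt 𝓘(ℝ, E) p x) = u x := by
  have hx' : x ∈ (extChartAt 𝓘(ℝ, E) p).source := by rwa [extChartAt_source]
  rw [chartExtend, indicator_of_mem ((extChartAt 𝓘(ℝ, E) p).map_source hx'), Function.comp_apply,
    (extChartAt 𝓘(ℝ, E) p).left_inv hx']

end Extend

namespace ChartLabel

variable {E : Type*} [NormedAddCommGroup E] [NormedSpace ℝ E] [FiniteDimensional ℝ E]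
  {M : Type*} [TopologicalSpace M] [ChartedSpace E M] [IsManifold 𝓘(ℝ, E) ∞ M]
  {W : Set M} (Λ : ChartLabel E W) {χ ψ : SmoothFun E M} (hχ : tsupport χ ⊆ W)
  (hψ : tsupport ψ ⊆ W)

/-- A bump function separating the integers. -/
noncomputable def integerBump : ContDiffBump (0 : ℝ) :=
  ⟨1 / 4, 1 / 2, by norm_num, by norm_num⟩

theorem integerBump_natCast_sub {k l : ℕ} (h : k ≠ l) : integerBump ((k : ℝ) - l) = 0 := by
  refine integerBump.zero_of_le_dist ?_
  have : (1 : ℝ) ≤ |(k : ℝ) - l| := by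
    have : (1 : ℤ) ≤ |(k : ℤ) - l| := Int.one_le_abs (by omega)
    exact_mod_cast this
  rw [Real.dist_0_eq_abs]
  exact le_trans (by norm_num [integerBump]) this

/-- When `z 0` is within `1/2` of `y 0`, the `k`-th bump is nonzero only if `k < y 0 + 1`. This
allows finitely many natural numbers. -/
theorem locallyFinite_integerBump {n : ℕ} (f : ℕ → (Fin (n + 1) → ℝ) → ℝ) :
    LocallyFinite fun k : ℕ => Function.support fun y => integerBump (y 0 - k) * f k y := by
  intro y
  refine ⟨(fun z : Fin (n + 1) → ℝ => z 0) ⁻¹' Metric.ball (y 0) (1 / 2),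
    (continuous_apply 0).continuousAt.preimage_mem_nhds (Metric.ball_mem_nhds _ (by norm_num)), ?_⟩
  refine (Set.finite_le_nat ⌈y 0 + 1⌉₊).subset ?_
  rintro k ⟨z, hz, hzy⟩
  have h1 : integerBump (z 0 - k) ≠ 0 := left_ne_zero_of_mul hz
  have h2 : z 0 - k ∈ Metric.ball (0 : ℝ) integerBump.rOut := by
    rw [← integerBump.support_eq]; exact h1
  rw [mem_ball_zero_iff, Real.norm_eq_abs] at h2
  have h3 : |z 0 - y 0| < 1 / 2 := by simpa [Real.dist_eq] using hzy
  have h4 : |z 0 - k| < 1 / 2 := h2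
  rw [abs_lt] at h3 h4
  have : (k : ℝ) ≤ ⌈y 0 + 1⌉₊ := le_trans (by linarith) (Nat.le_ceil _)
  exact_mod_cast this

/-- A function of the label and the coordinates whose value is `χ g`. -/
noncomputable def expression (g : SmoothFun E M) : CInfFun (Module.finrank ℝ E + 1) where
  -- The variable `y 0` selects the piece and the other variables are the coordinates in its chart.
  -- One smooth function on a finite-dimensional space thus stores the expressions of `χ g` in all
  -- the charts at once.
  toFun y := ∑ᶠ k : ℕ, integerBump (y 0 - k) *
    chartExtend (Λ.part hχ g k) (Λ.center k) ((modelCoord E).symm (Fin.tail y))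
  smooth := by
    rw [← contMDiff_iff_contDiff]
    refine contMDiff_finsum (fun k => ContDiff.contMDiff ?_) (locallyFinite_integerBump _)
    refine ContDiff.mul (integerBump.contDiff.comp ((contDiff_apply ℝ ℝ 0).sub contDiff_const)) ?_
    refine (contDiff_chartExtend (Λ.isCompact k) (Λ.subset k) fun x hx => ?_).comp
      ((modelCoord E).symm.contDiff.comp (contDiff_pi.2 fun i => contDiff_apply ℝ ℝ i.succ))
    by_cases hxW : x ∈ W
    · have : Λ.label x ≠ k := fun h => hx (h ▸ Λ.mem x hxW)
      show χ x * (if Λ.label x = k then g x else 0) = 0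
      rw [if_neg this, mul_zero]
    · show χ x * _ = 0
      rw [image_eq_zero_of_notMem_tsupport fun h => hxW (hχ h), zero_mul]

/-- The label and the coordinates, cut off by `χ`. -/
noncomputable def labelCoord : Fin (Module.finrank ℝ E + 1) → SmoothFun E M :=
  Fin.cons (Λ.labelFun hχ) (Λ.coord hχ)

/-- At a point where `χ = 1` the zeroth argument is exactly the label. The bumps of all other
integers vanish there and its own bump is `1`, so only the expression in the chart of the point
remains. -/
theorem cinfApply_expression (g : SmoothFun E M) {x : M} (hx : χ x = 1) :
    cinfApply (Λ.expression hχ g) (Λ.labelCoord hχ) x = g x := by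
  have hxW : x ∈ W := by
    by_contra h
    rw [image_eq_zero_of_notMem_tsupport fun h' => h (hχ h')] at hx
    exact zero_ne_one hx
  have h0 : Λ.labelCoord hχ 0 x = Λ.label x := by
    show χ x * (Λ.label x : ℝ) = _
    rw [hx, one_mul]
  have hs : (modelCoord E).symm (Fin.tail fun i => Λ.labelCoord hχ i x) = Λ.chart x := by
    rw [ContinuousLinearEquiv.symm_apply_eq]
    ext j
    show χ x * modelCoord E (Λ.chart x) j = _
    rw [hx, one_mul]
  show ∑ᶠ k : ℕ, integerBump (Λ.labelCoord hχ 0 x - k) *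
    chartExtend (Λ.part hχ g k) (Λ.center k) ((modelCoord E).symm
      (Fin.tail fun i => Λ.labelCoord hχ i x)) = g x
  rw [hs, h0, finsum_eq_single _ (Λ.label x) fun k hk => by
    rw [integerBump_natCast_sub hk.symm, zero_mul]]
  rw [chart, chartExtend_apply _ _ (Λ.mem_source hxW), sub_self,
    integerBump.one_of_mem_closedBall (Metric.mem_closedBall_self integerBump.rIn_pos.le)]
  show 1 * (χ x * if Λ.label x = Λ.label x then g x else 0) = g x
  rw [hx, if_pos rfl, one_mul, one_mul]

variable [T2Space M] [SigmaCompactSpace M] {N : Type*} [AddCommGroup N] [Module (SmoothFun E M) N]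
  {D : SmoothFun E M → N}

/-- The label may take infinitely many values, so it is not a finite combination of locally constant
cutoffs. Instead use a smooth `h` with `h(k) = k` and `h'(k) = 0` at all natural numbers `k`. By
locality the label `l` may be replaced by `h(l)`, and the chain rule gives `ψ D l = ψ h'(l) D l =
0`. -/
theorem smul_labelFun_eq_zero (hD : IsCInfDer D) (h1 : ∀ᶠ y in 𝓝ˢ (tsupport ψ), χ y = 1) :
    ψ • D (Λ.labelFun hχ) = 0 := by
  let h : ℝ → ℝ := fun s => s - Real.sin (2 * Real.pi * s) / (2 * Real.pi)
  have hh : ContDiff ℝ ∞ h := by fun_prop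
  have hderiv : ∀ k : ℕ, deriv h k = 0 := by
    intro k
    have e : HasDerivAt h (1 - Real.cos (2 * Real.pi * k) * (2 * Real.pi * 1) / (2 * Real.pi)) k :=
      (hasDerivAt_id _).sub ((((hasDerivAt_id _).const_mul (2 * Real.pi)).sin).div_const _)
    rw [e.deriv, mul_comm (2 * Real.pi) (k : ℝ), Real.cos_nat_mul_two_pi]
    field_simp
    ring
  have hval : ∀ k : ℕ, h k = k := by
    intro k
    have : Real.sin (2 * Real.pi * k) = 0 := by
      rw [show 2 * Real.pi * (k : ℝ) = ((2 * k : ℕ) : ℝ) * Real.pi by push_cast; ring,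
        Real.sin_nat_mul_pi]
    simp [h, this]
  have hl : ∀ x, χ x = 1 → Λ.labelFun hχ x = Λ.label x := fun x hx => by
    show χ x * (Λ.label x : ℝ) = _
    rw [hx, one_mul]
  let c : SmoothFun E M := ⟨fun x => h (Λ.labelFun hχ x), hh.contMDiff.comp (Λ.labelFun hχ).contMDiff⟩
  have hh' : ContDiff ℝ ∞ (deriv h) := by
    exact (contDiff_infty_iff_deriv.1 hh).2
  let c' : SmoothFun E M :=
    ⟨fun x => deriv h (Λ.labelFun hχ x), hh'.contMDiff.comp (Λ.labelFun hχ).contMDiff⟩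
  have e1 := hD.comp_one h hh (Λ.labelFun hχ) (c := c) (fun _ => rfl) (c' := c') fun _ => rfl
  rw [hD.local ψ (Λ.labelFun hχ) c ?_, e1, smul_smul]
  · have : ψ * c' = 0 := by
      ext x
      show ψ x * deriv h (Λ.labelFun hχ x) = 0
      by_cases hx : x ∈ tsupport ψ
      · rw [hl x (h1.self_of_nhdsSet x hx), hderiv, mul_zero]
      · rw [image_eq_zero_of_notMem_tsupport hx, zero_mul]
    rw [← smul_eq_mul] at this
    rw [← smul_eq_mul, this, zero_smul]
  · filter_upwards [h1] with x hx
    show _ = h (Λ.labelFun hχ x)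
    rw [hl x hx, hval]

/-- A `C^∞`-derivation is given on `W` by the coordinate vector fields. -/
theorem smul_derivation_eq_sum (hD : IsCInfDer D) (h1 : ∀ᶠ y in 𝓝ˢ (tsupport ψ), χ y = 1)
    (g : SmoothFun E M) : ψ • D g =
      ∑ j, pairing (exteriorD g) (Λ.field hψ j) • D (Λ.coord hχ j) := by
  have hg : ∀ᶠ x in 𝓝ˢ (tsupport ψ), g x =
      cinfApply (Λ.expression hχ g) (Λ.labelCoord hχ) x :=
    h1.mono fun x hx => (Λ.cinfApply_expression hχ g hx).symm
  -- Locality replaces `g` by its expression in the label and the coordinates. The chain rule then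
  -- produces one term for the label, which vanishes, and one for each coordinate.
  rw [hD.local ψ _ _ hg, hD, Finset.smul_sum, Fin.sum_univ_succ, smul_comm]
  have e0 : ψ • D (Λ.labelCoord hχ 0) = 0 := Λ.smul_labelFun_eq_zero hχ hD h1
  rw [e0, smul_zero, zero_add]
  refine Finset.sum_congr rfl fun j _ => ?_
  rw [smul_smul]
  refine congrArg (· • D (Λ.coord hχ j)) ?_
  ext x
  rw [pairing_exteriorD_apply]
  show ψ x * ((Λ.expression hχ g).partialDeriv j.succ).toFun (fun i => Λ.labelCoord hχ i x) = _
  by_cases hx : x ∈ tsupport ψ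
  · have he : (g : M → ℝ) =ᶠ[𝓝 x] cinfApply (Λ.expression hχ g) (Λ.labelCoord hχ) :=
      hg.filter_mono (nhds_le_nhdsSet hx)
    have hd : differentialAt g x =
        differentialAt (cinfApply (Λ.expression hχ g) (Λ.labelCoord hχ)) x := by
      ext v
      rw [differentialAt, he.mfderiv_eq]
      rfl
    -- The partial derivative is identified by the same chain rule for the ordinary differential,
    -- evaluated on the `j`-th coordinate field: the label contributes nothing and the coordinates
    -- are dual to the fields.
    rw [hd, differentialAt_cinfApply, Fin.sum_univ_succ]
    have e1 : differentialAt (Λ.labelCoord hχ 0) x (Λ.field hψ j x) = 0 :=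
      Λ.differentialAt_labelFun hχ (hψ hx) (h1.filter_mono (nhds_le_nhdsSet hx)) _
    have e2 : ∀ i : Fin (Module.finrank ℝ E),
        differentialAt (Λ.labelCoord hχ i.succ) x (Λ.field hψ j x) = if i = j then ψ x else 0 :=
      fun i => Λ.differentialAt_coord_field hχ hψ h1 i j x
    simp only [e1, e2]
    simp [mul_comm]
  · have h0 := image_eq_zero_of_notMem_tsupport hx
    simp [field_apply, h0]

end ChartLabel

/-! ### A finite global frame that computes all derivations. -/

section Frame

variable (E : Type u) [NormedAddCommGroup E] [NormedSpace ℝ E] [FiniteDimensional ℝ E]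
  (M : Type v) [TopologicalSpace M] [ChartedSpace E M] [IsManifold 𝓘(ℝ, E) ∞ M]

/-- Finitely many functions and vector fields such that the vector fields are dual to the differentials
of the functions, and express all `C^∞`-derivations. -/
structure DifferentialFrame where
  ι : Type
  [fintype : Fintype ι]
  coord : ι → SmoothFun E M
  field : ι → VectorFields E M
  sum_smul_field : ∀ (x : M) (v : TangentSpace 𝓘(ℝ, E) x),
    ∑ i, differentialAt (coord i) x v • field i x = v
  derivation_eq_sum : ∀ {N : Type w} [AddCommGroup N] [Module (SmoothFun E M) N]
    {D : SmoothFun E M → N}, IsCInfDer D → ∀ g : SmoothFun E M,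
      D g = ∑ i, pairing (exteriorD g) (field i) • D (coord i)

attribute [instance] DifferentialFrame.fintype

theorem nonempty_differentialFrame [T2Space M] [SigmaCompactSpace M] :
    Nonempty (DifferentialFrame.{u, v, w} E M) := by
  -- On the empty manifold `C^∞(M)` is the zero ring, so every module over it is trivial and the
  -- empty frame works.
  rcases isEmpty_or_nonempty M with hM | hM
  · refine ⟨⟨Empty, Empty.elim, Empty.elim, fun x => hM.elim x, fun {N} _ _ {D} _ g => ?_⟩⟩
    have : Subsingleton (SmoothFun E M) := ⟨fun f g => by ext x; exact hM.elim x⟩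
    have : Subsingleton N := Module.subsingleton (SmoothFun E M) N
    exact Subsingleton.elim _ _
  obtain ⟨W, hW, hcov⟩ := exists_finite_chartSum_cover E M
  obtain ⟨ρ, hρ⟩ := SmoothPartitionOfUnity.exists_isSubordinate 𝓘(ℝ, E) isClosed_univ W
    (fun c => (hW c).isOpen) hcov.ge
  have Λ := fun c => (hW c).nonempty_chartLabel.some
  choose χ h1 hχ using fun c => exists_cutoff (E := E) (isClosed_tsupport (ρ c)) (hW c).isOpen (hρ c)
  have hsum : ∀ x, ∑ c, ρ c x = 1 := fun x => by
    rw [← finsum_eq_sum_of_fintype]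
    exact ρ.sum_eq_one (mem_univ x)
  -- The fields carry the partition of unity `ρ`, the functions a cutoff equal to `1` near the
  -- support of its member. The local formulas, each multiplied by `ρ c`, therefore add up to the
  -- global one.
  refine ⟨⟨_ × _, fun i => (Λ i.1).coord (hχ i.1) i.2, fun i => (Λ i.1).field (hρ i.1) i.2,
    fun x v => ?_, fun {N} _ _ {D} hD g => ?_⟩⟩
  · rw [Fintype.sum_prod_type]
    simp only [(Λ _).sum_differentialAt_smul_field (hχ _) (hρ _) (h1 _)]
    rw [← Finset.sum_smul, hsum, one_smul]
  · rw [Fintype.sum_prod_type]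
    simp only [← (Λ _).smul_derivation_eq_sum (hχ _) (hρ _) hD (h1 _)]
    rw [← Finset.sum_smul]
    have : ∑ c, (ρ c : SmoothFun E M) = 1 := by
      ext x
      let ev : SmoothFun E M →+ ℝ := ⟨⟨fun f => f x, rfl⟩, fun _ _ => rfl⟩
      show ev _ = 1
      rw [map_sum]
      exact hsum x
    rw [this, one_smul]

variable {E M} (Φ : DifferentialFrame.{u, v, w} E M)

/-- At each point this is `θ` applied to the expansion `v = ∑ dxᵢ(v) Xᵢ`. -/
theorem DifferentialFrame.oneForm_eq_sum (θ : OneForms E M) :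
    ∑ i, pairing θ (Φ.field i) • exteriorD (Φ.coord i) = θ := by
  refine ContMDiffSection.ext fun x => ContinuousLinearMap.ext fun v => ?_
  let ev : OneForms E M →+ ℝ :=
    { toFun := fun θ => θ x v, map_zero' := rfl, map_add' := fun _ _ => rfl }
  show ev _ = θ x v
  conv_rhs => rw [← Φ.sum_smul_field x v]
  rw [map_sum, map_sum]
  refine Finset.sum_congr rfl fun i _ => ?_
  exact (mul_comm _ _).trans (map_smul (θ x) _ _).symm

theorem DifferentialFrame.vectorField_eq_sum (X : VectorFields E M) :
    ∑ i, pairing (exteriorD (Φ.coord i)) X • Φ.field i = X := by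
  refine ContMDiffSection.ext fun x => ?_
  let ev : VectorFields E M →+ TangentSpace 𝓘(ℝ, E) x :=
    { toFun := fun θ => θ x, map_zero' := rfl, map_add' := fun _ _ => rfl }
  show ev _ = X x
  conv_rhs => rw [← Φ.sum_smul_field x (X x)]
  rw [map_sum]
  rfl

end Frame

end DGManifold

namespace DGManifold

/-! ### Uniqueness of Kähler differentials and invariance of internal homs. -/

section General

variable {A : CInfDGAlgebra.{u}}

namespace GradedHom

theorem ext_app {n : ℤ} {M : GrModule.{u, v} A} {N : GrModule.{u, w} A}
    {φ ψ : GradedHom n M N} (h : ∀ {i j : ℤ} (hj : i + n = j) (m : M.carrier i),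
      φ.app hj m = ψ.app hj m) : φ = ψ :=
  Subtype.ext (funext fun p => LinearMap.ext fun m => h p.eq m)

/-- A map of degree `0` from its components. -/
noncomputable def ofDegreeZero {M : GrModule.{u, v} A} {N : GrModule.{u, w} A}
    (f : ∀ i, M.carrier i →ₗ[ℝ] N.carrier i)
    (hf : ∀ {i j k : ℤ} (h : i + j = k) (a : A.carrier i) (m : M.carrier j),
      f k (M.smul h a m) = N.smul h a (f j m)) : GradedHom 0 M N :=
  ⟨fun p => (show p.src = p.tgt by have := p.eq; omega) ▸ f p.src, by
    intro i j k j' k' h hj hk h' a m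
    obtain rfl : j = j' := by omega
    obtain rfl : k = k' := by omega
    simp [hf, koszulSign_zero]⟩

theorem app_zero_smul {M : GrModule.{u, v} A} {N : GrModule.{u, w} A} (φ : GradedHom 0 M N)
    {i j k : ℤ} (h : i + j = k) (a : A.carrier i) (m : M.carrier j) :
    φ.app (add_zero k) (M.smul h a m) = N.smul h a (φ.app (add_zero j) m) := by
  rw [φ.app_smul h (add_zero j) (add_zero k) h, zero_mul, koszulSign_zero, one_smul]

end GradedHom

/-- The zero derivation. -/
noncomputable def zeroDerivation (n : ℤ) (M : GrModule.{u, w} A) : CInfDerivation n M where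
  toFun _ := 0
  leibniz := by intros; simp [GrModule.rsmul]
  chain_rule := by intros; simp

namespace IsKahlerDifferentials

variable {Ω Ω' : DGModule.{u, w} A} {d : CInfDerivation 0 Ω.toGrModule}
  {d' : CInfDerivation 0 Ω'.toGrModule}

/-- Maps from a module of Kähler differentials that agree on exact elements are equal. -/
theorem hom_ext (hd : IsKahlerDifferentials.{u, v, w} Ω d) {M : GrModule.{u, v} A} {n : ℤ}
    {d₁ : CInfDerivation n M} {φ ψ : GradedHom n Ω.toGrModule M}
    (hφ : ∀ {i k : ℤ} (h : i + n = k) (a : A.carrier i),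
      φ.app h (d.toFun (add_zero i) a) = d₁.toFun h a)
    (hψ : ∀ {i k : ℤ} (h : i + n = k) (a : A.carrier i),
      ψ.app h (d.toFun (add_zero i) a) = d₁.toFun h a) : φ = ψ := by
  refine (hd.universal M n d₁).unique (fun {i j k} h h' h'' a => ?_) fun {i j k} h h' h'' a => ?_
  · obtain rfl : i = j := by omega
    exact hφ h'' a
  · obtain rfl : i = j := by omega
    exact hψ h'' a

theorem exists_hom (hd : IsKahlerDifferentials.{u, v, w} Ω d) {M : GrModule.{u, v} A}
    (d₁ : CInfDerivation 0 M) : ∃ φ : GradedHom 0 Ω.toGrModule M,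
      ∀ (i : ℤ) (a : A.carrier i),
        φ.app (add_zero i) (d.toFun (add_zero i) a) = d₁.toFun (add_zero i) a := by
  obtain ⟨φ, hφ, -⟩ := hd.universal M 0 d₁
  exact ⟨φ, fun i a => hφ (add_zero i) (add_zero i) (add_zero i) a⟩

/-- The composite and the identity both factor `d` through itself, so they agree by the uniqueness
part of the universal property. -/
theorem left_inverse (hd : IsKahlerDifferentials.{u, w, w} Ω d)
    {φ : GradedHom 0 Ω.toGrModule Ω'.toGrModule} {ψ : GradedHom 0 Ω'.toGrModule Ω.toGrModule}
    (hφ : ∀ (i : ℤ) (a : A.carrier i),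
      φ.app (add_zero i) (d.toFun (add_zero i) a) = d'.toFun (add_zero i) a)
    (hψ : ∀ (i : ℤ) (a : A.carrier i),
      ψ.app (add_zero i) (d'.toFun (add_zero i) a) = d.toFun (add_zero i) a)
    (i : ℤ) (m : Ω.carrier i) : ψ.app (add_zero i) (φ.app (add_zero i) m) = m := by
  have h : GradedHom.ofDegreeZero (M := Ω.toGrModule) (N := Ω.toGrModule)
      (fun i => (ψ.app (add_zero i)).comp (φ.app (add_zero i)))
      (fun h a m => by simp only [LinearMap.comp_apply, GradedHom.app_zero_smul]) =
      GradedHom.ofDegreeZero (fun _ => LinearMap.id) (fun _ _ _ => rfl) := by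
    refine hd.hom_ext (d₁ := d) (fun {i k} h a => ?_) fun {i k} h a => ?_
    · obtain rfl : i = k := by omega
      show ψ.app _ (φ.app _ _) = _
      rw [hφ, hψ]
    · obtain rfl : i = k := by omega
      rfl
  exact LinearMap.congr_fun (congrArg (fun φ => φ.app (add_zero i)) h) m

/-- The commutator of `φ` with the differentials is its differential in the internal hom, a graded
map of degree `1`. It kills every `d a`, since `d` and `d'` commute with the differentials. Hence it
factors the zero derivation and vanishes by uniqueness. Here the universal property is needed in a
degree other than zero. -/
theorem hom_comm (hd : IsKahlerDifferentials.{u, w, w} Ω d)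
    (hd' : IsKahlerDifferentials.{u, w, w} Ω' d') {φ : GradedHom 0 Ω.toGrModule Ω'.toGrModule}
    (hφ : ∀ (i : ℤ) (a : A.carrier i),
      φ.app (add_zero i) (d.toFun (add_zero i) a) = d'.toFun (add_zero i) a)
    {i j : ℤ} (h : i + 1 = j) (m : Ω.carrier i) :
    φ.app (add_zero j) (Ω.d h m) = Ω'.d h (φ.app (add_zero i) m) := by
  let δφ : GradedHom 1 Ω.toGrModule Ω'.toGrModule := (internalHom Ω Ω').d (zero_add 1) φ
  have key : ∀ {i j : ℤ} (h : i + 1 = j) (m : Ω.carrier i), δφ.app h m =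
      Ω'.d h (φ.app (add_zero i) m) - φ.app (add_zero j) (Ω.d h m) := by
    intro i j h m
    subst h
    have e : koszulSign 0 = 1 := koszulSign_zero
    show Ω'.d _ (φ.app rfl m) - koszulSign 0 • φ.app _ (Ω.d rfl m) = _
    rw [e, one_smul]
    congr 1
    have : ∀ {x : ℤ} (hx : i + 0 = x) (hx' : x + 1 = i + 1),
        Ω'.d hx' (φ.app hx m) = Ω'.d rfl (φ.app (add_zero i) m) := by
      intro x hx hx'
      obtain rfl : x = i := by omega
      rfl
    exact this _ _
  have h0 : δφ = 0 := by
    refine hd.hom_ext (d₁ := zeroDerivation 1 Ω'.toGrModule) (fun {i k} h a => ?_)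
      fun {i k} h a => rfl
    rw [key, hφ, ← hd.comm h h (add_zero i) (add_zero k), hφ, hd'.comm h h (add_zero i) (add_zero k),
      sub_self]
    rfl
  have := key h m
  rw [h0] at this
  exact (sub_eq_zero.1 this.symm).symm

/-- Modules of Kähler differentials are unique up to isomorphism of dg-modules. -/
theorem nonempty_iso (hd : IsKahlerDifferentials.{u, w, w} Ω d)
    (hd' : IsKahlerDifferentials.{u, w, w} Ω' d') : Nonempty (DGIso Ω Ω') := by
  obtain ⟨φ, hφ⟩ := hd.exists_hom d'
  obtain ⟨ψ, hψ⟩ := hd'.exists_hom d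
  exact ⟨{
    equiv := fun i => LinearEquiv.ofLinearMap (φ.app (add_zero i)) (ψ.app (add_zero i))
      (LinearMap.ext fun m => left_inverse hd' hψ hφ i m)
      (LinearMap.ext fun m => left_inverse hd hφ hψ i m)
    map_smul := fun h a m => φ.app_zero_smul h a m
    map_d := fun h m => hd.hom_comm hd' hφ h m }⟩

end IsKahlerDifferentials

theorem DGIso.symm_smul {M : DGModule.{u, v} A} {N : DGModule.{u, w} A} (e : DGIso M N) {i j k : ℤ}
    (h : i + j = k) (a : A.carrier i) (m : N.carrier j) :
    (e.equiv k).symm (N.smul h a m) = M.smul h a ((e.equiv j).symm m) := by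
  rw [LinearEquiv.symm_apply_eq, e.map_smul, LinearEquiv.apply_symm_apply]

/-- The inverse of an isomorphism. -/
noncomputable def DGIso.symm {M : DGModule.{u, v} A} {N : DGModule.{u, w} A} (e : DGIso M N) :
    DGIso N M where
  equiv i := (e.equiv i).symm
  map_smul h a m := e.symm_smul h a m
  map_d h m := by
    rw [LinearEquiv.symm_apply_eq, e.map_d, LinearEquiv.apply_symm_apply]

/-- The composition of isomorphisms. -/
noncomputable def DGIso.trans {M : DGModule.{u, v} A} {N : DGModule.{u, w} A}
    {P : DGModule.{u, u₁} A} (e : DGIso M N) (f : DGIso N P) : DGIso M P where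
  equiv i := (e.equiv i).trans (f.equiv i)
  map_smul h a m := by simp [e.map_smul, f.map_smul]
  map_d h m := by simp [e.map_d, f.map_d]

/-- Composition of a map of degree `n` with an isomorphism. -/
noncomputable def GradedHom.precomp {M : DGModule.{u, v} A} {N : DGModule.{u, w} A} (e : DGIso M N)
    (P : GrModule.{u, u₁} A) (n : ℤ) :
    GradedHom n N.toGrModule P →ₗ[ℝ] GradedHom n M.toGrModule P where
  toFun φ := ⟨fun p => (φ.app p.eq).comp (e.equiv p.src).toLinearMap, by
    intro i j k j' k' h hj hk h' a m
    simp only [LinearMap.comp_apply, LinearEquiv.coe_coe]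
    rw [e.map_smul, φ.app_smul h hj hk h']⟩
  map_add' _ _ := rfl
  map_smul' _ _ := rfl

/-- Isomorphic dg-modules have isomorphic internal homs. -/
noncomputable def DGIso.internalHom {M : DGModule.{u, v} A} {N : DGModule.{u, w} A} (e : DGIso M N)
    (P : DGModule.{u, u₁} A) : DGIso (internalHom M P) (internalHom N P) where
  equiv n := LinearEquiv.ofLinearMap (GradedHom.precomp e.symm P.toGrModule n)
    (GradedHom.precomp e P.toGrModule n)
    (LinearMap.ext fun φ => GradedHom.ext_app fun {i j} h m =>
      congrArg (φ.app h) ((e.equiv i).apply_symm_apply m))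
    (LinearMap.ext fun φ => GradedHom.ext_app fun {i j} h m =>
      congrArg (φ.app h) ((e.equiv i).symm_apply_apply m))
  map_smul h a φ := rfl
  map_d {n k} h φ := GradedHom.ext_app fun {i j} hj m => by
    subst h
    show P.d _ (φ.app _ ((e.equiv i).symm m)) - koszulSign n • φ.app _ (M.d rfl ((e.equiv i).symm m)) =
      P.d _ (φ.app _ ((e.equiv i).symm m)) - koszulSign n • φ.app _ ((e.equiv (i + 1)).symm (N.d rfl m))
    have := e.symm.map_d (rfl : i + 1 = i + 1) m
    rw [show (e.equiv (i + 1)).symm (N.d rfl m) = M.d rfl ((e.equiv i).symm m) from this]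

end General

/-! ### Differential calculus on `B ⊗ ⋀V*`. -/

section KoszulCalculus

variable {B : Type u} [CommRing B] [Algebra ℝ B] {V : Type v} [AddCommGroup V] [Module ℝ V]

/-- An element of `B ⊗ ⋀V*` is constant if it comes from `⋀V*`. -/
def IsConst {i : ℤ} (c : KoszulPart B V i) : Prop :=
  ∃ x : ExteriorAlgebra ℝ (Module.Dual ℝ V), c.1 = 1 ⊗ₜ x

/-- Homogeneous elements are sums of products of a function with a homogeneous constant element, and
`D` acts only on the first factor. Membership in the homogeneous part is carried through the
induction because `p` is defined only there. -/
theorem koszulPart_induction {i : ℤ} {p : KoszulPart B V i → Prop} (h0 : p 0)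
    (hadd : ∀ a b, p a → p b → p (a + b)) (ht : ∀ (f : B) (c : KoszulPart B V i), IsConst c → p (f • c))
    (a : KoszulPart B V i) : p a := by
  have : ∃ h : a.1 ∈ koszulPiece B V i, p ⟨a.1, h⟩ := by
    refine koszulPiece_induction (p := fun x => ∃ h : x ∈ koszulPiece B V i, p ⟨x, h⟩)
      ⟨zero_mem _, h0⟩ (fun x y ⟨hx, hpx⟩ ⟨hy, hpy⟩ => ⟨add_mem hx hy, hadd _ _ hpx hpy⟩)
      (fun k hk f x hx => ?_) a.2
    subst hk
    refine ⟨tmul_mem_koszulPiece k f hx, ?_⟩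
    have h := ht f ⟨1 ⊗ₜ x, tmul_mem_koszulPiece k 1 hx⟩ ⟨x, rfl⟩
    have e : f • (⟨1 ⊗ₜ x, tmul_mem_koszulPiece k 1 hx⟩ : KoszulPart B V (-k)) =
        ⟨f ⊗ₜ x, tmul_mem_koszulPiece k f hx⟩ := by
      refine Subtype.ext ?_
      show f • (1 : B) ⊗ₜ[ℝ] x = f ⊗ₜ[ℝ] x
      rw [TensorProduct.smul_tmul', smul_eq_mul, mul_one]
    exact e ▸ h
  exact this.2

theorem koszulPart_eq_zero {i : ℤ} (h : 0 < i) (a : KoszulPart B V i) : a = 0 :=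
  Subtype.ext ((Submodule.mem_bot B).1 ((if_pos h : koszulPiece B V i = ⊥).le a.2))

theorem IsConst.koszulMul {i j k : ℤ} (h : i + j = k) {c : KoszulPart B V i} {c' : KoszulPart B V j}
    (hc : IsConst c) (hc' : IsConst c') : IsConst (koszulMul h c c') := by
  obtain ⟨x, hx⟩ := hc
  obtain ⟨y, hy⟩ := hc'
  refine ⟨x * y, ?_⟩
  show c.1 * c'.1 = _
  rw [hx, hy, Algebra.TensorProduct.tmul_mul_tmul, one_mul]

/-- The projection of `⋀V*` to its homogeneous part of degree `k`. -/
noncomputable def exteriorProj (k : ℕ) :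
    ExteriorAlgebra ℝ (Module.Dual ℝ V) →ₗ[ℝ] ⋀[ℝ]^k (Module.Dual ℝ V) :=
  DirectSum.component ℝ ℕ (fun k => ⋀[ℝ]^k (Module.Dual ℝ V)) k ∘ₗ
    (DirectSum.decomposeLinearEquiv (fun k => ⋀[ℝ]^k (Module.Dual ℝ V))).toLinearMap

theorem exteriorProj_of_mem {k : ℕ} {x : ExteriorAlgebra ℝ (Module.Dual ℝ V)}
    (hx : x ∈ ⋀[ℝ]^k (Module.Dual ℝ V)) : (exteriorProj k x : ExteriorAlgebra ℝ (Module.Dual ℝ V)) = x :=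
  DirectSum.decompose_of_mem_same (fun k => ⋀[ℝ]^k (Module.Dual ℝ V)) hx

variable (B V) in
/-- The projection of `⋀V*` to the homogeneous part of degree `i` of `B ⊗ ⋀V*`. -/
noncomputable def koszulProj (i : ℤ) : ExteriorAlgebra ℝ (Module.Dual ℝ V) →ₗ[ℝ] KoszulPart B V i :=
  if h : 0 < i then 0 else
    { toFun := fun x => ⟨1 ⊗ₜ (exteriorProj (-i).toNat x).1, by
        have := tmul_mem_koszulPiece (-i).toNat (1 : B) (exteriorProj (-i).toNat x).2
        rwa [show (-((-i).toNat : ℤ)) = i by omega] at this⟩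
      map_add' := fun x y => Subtype.ext (by simp [TensorProduct.tmul_add]; rfl)
      map_smul' := fun c x => Subtype.ext (by simp; rfl) }

/-- The element `x` need not be homogeneous when `B` is zero, so it is not compared with its
projection. The base change of the projection is the identity on the part of degree `i`, and it can
be applied to `c = 1 ⊗ x`. -/
theorem koszulProj_of_eq {i : ℤ} {c : KoszulPart B V i} {x : ExteriorAlgebra ℝ (Module.Dual ℝ V)}
    (hc : c.1 = 1 ⊗ₜ x) : koszulProj B V i x = c := by
  by_cases h : 0 < i
  · exact (koszulPart_eq_zero h _).trans (koszulPart_eq_zero h c).symm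
  · let Q : KoszulTotal B V →ₗ[B] KoszulTotal B V :=
      ((⋀[ℝ]^((-i).toNat) (Module.Dual ℝ V)).subtype ∘ₗ exteriorProj (-i).toNat).baseChange B
    have hQ : Q c.1 = c.1 := by
      refine koszulPiece_induction (p := fun x => Q x = x) (map_zero _)
        (fun x y hx hy => by rw [map_add, hx, hy]) (fun k hk f x hx => ?_) c.2
      obtain rfl : k = (-i).toNat := by omega
      show f ⊗ₜ[ℝ] (exteriorProj (-i).toNat x).1 = _
      rw [exteriorProj_of_mem hx]
    rw [koszulProj, dif_neg h]
    refine Subtype.ext ?_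
    show 1 ⊗ₜ[ℝ] (exteriorProj (-i).toNat x).1 = _
    rw [← hQ, hc]
    rfl

section DeRham

variable {T : Type w} [AddCommGroup T] [Module B T] [Module ℝ T] [IsScalarTower ℝ B T] (D : B →ₗ[ℝ] T)

/-- The extension `f ⊗ x ↦ x ⊗ D f` of a map `D : B → T` to `B ⊗ ⋀V*`. -/
noncomputable def koszulDeRham (i : ℤ) : KoszulTotal B V →ₗ[ℝ] KoszulPart B V i ⊗[B] T :=
  TensorProduct.lift (LinearMap.mk₂ ℝ (fun f x => koszulProj B V i x ⊗ₜ[B] D f)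
    (fun _ _ _ => by rw [map_add, TensorProduct.tmul_add])
    (fun c f x => by rw [map_smul, TensorProduct.tmul_smul])
    (fun _ _ _ => by rw [map_add, TensorProduct.add_tmul])
    (fun c f x => by rw [map_smul, TensorProduct.smul_tmul']))

theorem koszulDeRham_smul_const {i : ℤ} (f : B) {c : KoszulPart B V i} (hc : IsConst c) :
    koszulDeRham D i (f • c).1 = c ⊗ₜ[B] D f := by
  obtain ⟨x, hx⟩ := hc
  have : (f • c).1 = f ⊗ₜ[ℝ] x := by
    show f • c.1 = _
    rw [hx, TensorProduct.smul_tmul', smul_eq_mul, mul_one]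
  rw [this]
  show koszulProj B V i x ⊗ₜ[B] D f = _
  rw [koszulProj_of_eq hx]

theorem koszulMul_comm {i j k : ℤ} (h : i + j = k) (h' : j + i = k) (a : KoszulPart B V i)
    (b : KoszulPart B V j) : koszulMul h a b = koszulSign (i * j) • koszulMul h' b a :=
  Subtype.ext (koszul_mul_comm a.2 b.2)

/-- On `f c` and `g c'` with `c`, `c'` constant this is the Leibniz rule for `D (f g)`. The sign
comes from exchanging `c` and `c'`. -/
theorem koszulDeRham_mul (hD : ∀ f g, D (f * g) = f • D g + g • D f) {i j k : ℤ} (h : i + j = k)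
    (h' : j + i = k) (a : KoszulPart B V i) (b : KoszulPart B V j) :
    koszulDeRham D k (koszulMul h a b).1 =
      koszulSign (i * j) • pullSmul h' b (koszulDeRham D i a.1) +
        pullSmul h a (koszulDeRham D j b.1) := by
  have hzero : ∀ i : ℤ, (0 : KoszulPart B V i).1 = 0 := fun _ => rfl
  have hadd : ∀ (i : ℤ) (x y : KoszulPart B V i), (x + y).1 = x.1 + y.1 := fun _ _ _ => rfl
  induction a using koszulPart_induction with
  | h0 => simp [hzero]
  | hadd x y hx hy =>
    simp only [map_add, LinearMap.add_apply, hadd, hx, hy, smul_add]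
    abel
  | ht f c hc =>
    induction b using koszulPart_induction with
    | h0 => simp [hzero]
    | hadd x y hx hy =>
      simp only [map_add, LinearMap.add_apply, hadd, hx, hy, smul_add]
      abel
    | ht g c' hc' =>
      have e : koszulMul h (f • c) (g • c') = (f * g) • koszulMul h c c' := by
        rw [map_smul (koszulMul h), LinearMap.smul_apply, map_smul, smul_smul]
      rw [e, koszulDeRham_smul_const D _ (hc.koszulMul h hc'), koszulDeRham_smul_const D _ hc,
        koszulDeRham_smul_const D _ hc', hD, pullSmul_tmul, pullSmul_tmul, TensorProduct.tmul_add,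
        map_smul, map_smul, LinearMap.smul_apply, LinearMap.smul_apply, add_comm,
        TensorProduct.tmul_smul, TensorProduct.tmul_smul, koszulMul_comm h h' c c']
      congr 1
      rw [← TensorProduct.smul_tmul', ← TensorProduct.smul_tmul', smul_comm]

end DeRham

theorem koszulMul_incl {i : ℤ} (h : 0 + i = i) (f : B) (a : KoszulPart B V i) :
    koszulMul h (koszulIncl f) a = f • a := by
  have : koszulIncl (V := V) f = f • koszulIncl (1 : B) := by rw [← map_smul, smul_eq_mul, mul_one]
  rw [this, map_smul, LinearMap.smul_apply, koszulMul_one h _ koszulIncl_one]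

theorem pullSmul_incl_tmul {T : Type w} [AddCommGroup T] [Module B T] {i : ℤ} (h : 0 + i = i) (f : B)
    (a : KoszulPart B V i) (t : T) :
    pullSmul h (koszulIncl f) (a ⊗ₜ[B] t) = a ⊗ₜ[B] (f • t) := by
  rw [pullSmul_tmul, koszulMul_incl, TensorProduct.smul_tmul]

theorem koszulDeRham_incl {T : Type w} [AddCommGroup T] [Module B T] [Module ℝ T]
    [IsScalarTower ℝ B T] (D : B →ₗ[ℝ] T) (f : B) :
    koszulDeRham D 0 (koszulIncl (V := V) f).1 = koszulIncl (1 : B) ⊗ₜ[B] D f := by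
  rw [show koszulIncl (V := V) f = f • koszulIncl (1 : B) by rw [← map_smul, smul_eq_mul, mul_one],
    koszulDeRham_smul_const D f ⟨1, rfl⟩]

variable [FiniteDimensional ℝ V]

variable (B) in
/-- The constant map `α ↦ α(ξ)` from `V*` to `B`. -/
noncomputable def constDual (ξ : V) : Module.Dual ℝ V →ₗ[ℝ] B :=
  Algebra.linearMap ℝ B ∘ₗ Module.Dual.eval ℝ V ξ

/-- The contraction with the `l`-th basis vector of `V`. -/
noncomputable def basisDiff (l : Fin (Module.finrank ℝ V)) {i j : ℤ} (h : i + 1 = j) :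
    KoszulPart B V i →ₗ[B] KoszulPart B V j :=
  koszulDiff (constDual B (Module.finBasis ℝ V l)) h

theorem koszulD_constDual (l : Fin (Module.finrank ℝ V)) (f : B)
    (x : ExteriorAlgebra ℝ (Module.Dual ℝ V)) :
    koszulD (constDual B (Module.finBasis ℝ V l)) (f ⊗ₜ x) = f ⊗ₜ contr (Module.finBasis ℝ V l) x := by
  rw [koszulD_tmul, Finset.sum_eq_single l]
  · simp [constDual]
  · intro j _ hj
    simp [constDual, Finsupp.single_eq_of_ne hj]
  · simp

theorem IsConst.basisDiff (l : Fin (Module.finrank ℝ V)) {i j : ℤ} (h : i + 1 = j)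
    {c : KoszulPart B V i} (hc : IsConst c) : IsConst (basisDiff l h c) := by
  obtain ⟨x, hx⟩ := hc
  refine ⟨contr (Module.finBasis ℝ V l) x, ?_⟩
  show koszulD _ c.1 = _
  rw [hx, koszulD_constDual]

theorem koszulD_eq_sum (s : Module.Dual ℝ V →ₗ[ℝ] B) (x : KoszulTotal B V) : koszulD s x =
    ∑ l, s ((Module.finBasis ℝ V).coord l) • koszulD (constDual B (Module.finBasis ℝ V l)) x := by
  induction x using TensorProduct.induction_on with
  | zero => simp
  | add x y hx hy => simp only [map_add, hx, hy, smul_add, Finset.sum_add_distrib]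
  | tmul f x =>
    rw [koszulD_tmul]
    refine Finset.sum_congr rfl fun l _ => ?_
    rw [koszulD_constDual, TensorProduct.smul_tmul', smul_eq_mul]

theorem koszulDiff_eq_sum (s : Module.Dual ℝ V →ₗ[ℝ] B) {i j : ℤ} (h : i + 1 = j)
    (a : KoszulPart B V i) : koszulDiff s h a =
      ∑ l, s ((Module.finBasis ℝ V).coord l) • basisDiff l h a := by
  refine Subtype.ext ?_
  refine (koszulD_eq_sum s a.1).trans ?_
  exact (map_sum (koszulPiece B V j).subtype
    (fun l => s ((Module.finBasis ℝ V).coord l) • basisDiff l h a) Finset.univ).symm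

/-- Contraction is additive in the contracted element and squares to zero, so this is the
polarization of `ι_{s+t}² = 0`. -/
theorem koszulDiff_anticomm (s t : Module.Dual ℝ V →ₗ[ℝ] B) {i j k : ℤ} (h : i + 1 = j)
    (h' : j + 1 = k) (a : KoszulPart B V i) :
    koszulDiff s h' (koszulDiff t h a) = -koszulDiff t h' (koszulDiff s h a) := by
  refine Subtype.ext ?_
  show koszulD s (koszulD t a.1) = -koszulD t (koszulD s a.1)
  have hadd : ∀ x : KoszulTotal B V, koszulD (s + t) x = koszulD s x + koszulD t x := fun x => by
    rw [koszulD_eq_sum (s + t), koszulD_eq_sum s, koszulD_eq_sum t, ← Finset.sum_add_distrib]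
    exact Finset.sum_congr rfl fun l _ => by rw [LinearMap.add_apply, add_smul]
  have := koszulD_koszulD (s + t) a.1
  simp only [hadd, map_add, koszulD_koszulD, zero_add, add_zero] at this
  exact eq_neg_of_add_eq_zero_left this

/-- In `ι_s = ∑ s(eˡ) ι_{eₗ}` the constant contractions commute with the extension of `D`. The only
defect comes from `D` acting on the coefficients `s(eˡ)`, and this becomes the off-diagonal term of
the differential of the cone. -/
theorem koszulDeRham_diff {T : Type w} [AddCommGroup T] [Module B T] [Module ℝ T]
    [IsScalarTower ℝ B T] (D : B →ₗ[ℝ] T) (hD : ∀ f g, D (f * g) = f • D g + g • D f)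
    (s : Module.Dual ℝ V →ₗ[ℝ] B) {i j : ℤ} (h : i + 1 = j) (a : KoszulPart B V i) :
    koszulDeRham D j (koszulDiff s h a).1 =
      ∑ l, basisDiff l h a ⊗ₜ[B] D (s ((Module.finBasis ℝ V).coord l)) +
        pullDiff s h (koszulDeRham D i a.1) := by
  have hzero : ∀ i : ℤ, (0 : KoszulPart B V i).1 = 0 := fun _ => rfl
  have hadd : ∀ (i : ℤ) (x y : KoszulPart B V i), (x + y).1 = x.1 + y.1 := fun _ _ _ => rfl
  induction a using koszulPart_induction with
  | h0 => simp [hzero]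
  | hadd x y hx hy =>
    simp only [map_add, hadd, hx, hy, TensorProduct.add_tmul, Finset.sum_add_distrib]
    abel
  | ht f c hc =>
    have hsum : ∀ F : Fin (Module.finrank ℝ V) → KoszulPart B V j, (∑ l, F l).1 = ∑ l, (F l).1 :=
      fun F => map_sum (koszulPiece B V j).subtype _ _
    rw [map_smul, koszulDiff_eq_sum, Finset.smul_sum, hsum, map_sum, koszulDeRham_smul_const D f hc,
      pullDiff_tmul, koszulDiff_eq_sum, TensorProduct.sum_tmul, ← Finset.sum_add_distrib]
    refine Finset.sum_congr rfl fun l _ => ?_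
    rw [smul_smul, koszulDeRham_smul_const D _ (hc.basisDiff l h), hD, TensorProduct.tmul_add, map_smul,
      TensorProduct.smul_tmul, TensorProduct.smul_tmul]

end KoszulCalculus

/-! ### The universal derivation with values in the cone. -/

section ConeDerivation

variable {E : Type u} [NormedAddCommGroup E] [NormedSpace ℝ E]
  {M : Type v} [TopologicalSpace M] [ChartedSpace E M]
  {V : Type w} [NormedAddCommGroup V] [NormedSpace ℝ V] [FiniteDimensional ℝ V]
  (σ : C^∞⟮𝓘(ℝ, E), M; 𝓘(ℝ, V), V⟯)

/-- The component `a ↦ ∑ₗ ι_{eₗ} a ⊗ eˡ` of the universal derivation. -/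
noncomputable def verticalDerivation {i j : ℤ} (h : i + 1 = j) :
    KoszulPart (SmoothFun E M) V i →ₗ[ℝ] KoszulPart (SmoothFun E M) V j ⊗[ℝ] Module.Dual ℝ V where
  toFun a := ∑ l, basisDiff l h a ⊗ₜ[ℝ] (Module.finBasis ℝ V).coord l
  map_add' a b := by simp only [map_add, TensorProduct.add_tmul, Finset.sum_add_distrib]
  map_smul' c a := by
    simp only [LinearMap.map_smul_of_tower, RingHom.id_apply, Finset.smul_sum, TensorProduct.smul_tmul']

theorem verticalDerivation_apply {i j : ℤ} (h : i + 1 = j) (a : KoszulPart (SmoothFun E M) V i) :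
    verticalDerivation h a = ∑ l, basisDiff l h a ⊗ₜ[ℝ] (Module.finBasis ℝ V).coord l := rfl

theorem eq_of_pos_degree {B : Type*} [CommRing B] [Algebra ℝ B] {V : Type*} [AddCommGroup V]
    [Module ℝ V] {U : Type*} [AddCommGroup U] [Module ℝ U] {i : ℤ} (h : 0 < i)
    (x y : KoszulPart B V i ⊗[ℝ] U) : x = y := by
  have : ∀ x : KoszulPart B V i ⊗[ℝ] U, x = 0 := fun x => by
    induction x using TensorProduct.induction_on with
    | zero => rfl
    | add x y hx hy => rw [hx, hy, add_zero]
    | tmul a u => rw [koszulPart_eq_zero h a, TensorProduct.zero_tmul]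
  rw [this x, this y]

/-- Each `ι_{eₗ}` is an odd derivation. The extra factors `koszulSign j` and `koszulSign i` are
those of the actions of `b` and `a` on the shift `V*_X[1]`, so in the cone this becomes the Leibniz
rule in degree `0`. -/
theorem verticalDerivation_mul {i j k i' j' k' : ℤ} (h : i + j = k) (hi : i + 1 = i')
    (hj : j + 1 = j') (hk : k + 1 = k') (h₁ : j + i' = k') (h₂ : i + j' = k')
    (a : KoszulPart (SmoothFun E M) V i) (b : KoszulPart (SmoothFun E M) V j) :
    verticalDerivation hk (koszulMul h a b) =
      koszulSign (i * j) • koszulSign j • (koszulMulReal h₁ b).rTensor _ (verticalDerivation hi a) +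
        koszulSign i • (koszulMulReal h₂ a).rTensor _ (verticalDerivation hj b) := by
  simp only [verticalDerivation_apply, map_sum, LinearMap.rTensor_tmul, Finset.smul_sum,
    ← Finset.sum_add_distrib]
  refine Finset.sum_congr rfl fun l _ => ?_
  have e : basisDiff l hk (koszulMul h a b) = _ :=
    koszulDiff_mul (constDual _ (Module.finBasis ℝ V l)) h hi hj hk (by omega : i' + j = k') h₂ a b
  rw [e, TensorProduct.add_tmul, koszulMul_comm (by omega : i' + j = k') h₁, TensorProduct.smul_tmul',
    TensorProduct.smul_tmul', TensorProduct.smul_tmul', smul_smul, ← koszulSign_add]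
  have e2 : koszulSign (i * j + j) = koszulSign (i' * j) := by rw [← hi]; ring_nf
  rw [e2]
  rfl

variable [IsManifold 𝓘(ℝ, E) ∞ M]

theorem exteriorD_mul (f g : SmoothFun E M) : exteriorD (f * g) = f • exteriorD g + g • exteriorD f :=
  isCInfDer_exteriorD.mul f g

/-- The universal derivation `a ↦ (∑ₗ ι_{eₗ} a ⊗ eˡ, d_M a)`, with values in the cone of `(dσ)^*`. -/
noncomputable def coneDerivation : CInfDerivation 0 (cone (dSigmaDual σ)).toGrModule where
  toFun {i j} h := (verticalDerivation (by omega)).prod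
    ((koszulDeRham exteriorD j).comp ((koszulPiece (SmoothFun E M) V i).subtype.restrictScalars ℝ))
  leibniz {i j k i' j' k'} h hi hj hk h₁ h₂ a b := by
    obtain rfl : i = i' := by omega
    obtain rfl : j = j' := by omega
    obtain rfl : k = k' := by omega
    refine Prod.ext ?_ ?_
    · refine (verticalDerivation_mul h rfl rfl rfl (by omega) (by omega) a b).trans ?_
      simp only [zero_mul, koszulSign_zero, one_smul]
      rfl
    · refine (koszulDeRham_mul exteriorD exteriorD_mul h (by omega) a b).trans ?_
      simp only [zero_mul, koszulSign_zero, one_smul]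
      rfl
  chain_rule {k} f a := by
    -- The vertical component of the differential of a degree-zero element lies in `A₁ ⊗ V*`, which
    -- is zero, so only the chain rule of the exterior derivative remains.
    refine Prod.ext (eq_of_pos_degree (by norm_num) _ _) ?_
    refine Eq.trans ?_ (Prod.snd_sum ..).symm
    let b : Fin k → SmoothFun E M := fun i => koszulBody (a i).1
    have hb : ∀ i, a i = koszulIncl (b i) := fun i => (koszulIncl_body (a i)).symm
    refine (koszulDeRham_incl exteriorD (cinfApply f b)).trans ?_
    rw [isCInfDer_exteriorD f b, TensorProduct.tmul_sum]
    refine Finset.sum_congr rfl fun i _ => ?_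
    show _ = pullSmul (zero_add 0) (koszulIncl (cinfApply (f.partialDeriv i) b))
      (koszulDeRham exteriorD 0 (a i).1)
    rw [hb i, koszulDeRham_incl, pullSmul_incl_tmul]

/-- In the first component `ι_{eₗ}` and `ι_σ` anticommute, which accounts for the sign in the
differential of `M[1]`. In the second, the defect of `koszulDeRham_diff` is `(dσ)^*` of the vertical
component. -/
theorem coneDerivation_comm {i j i' j' : ℤ} (hi : i + 1 = i') (hj : j + 1 = j') (h : i + 0 = j)
    (h' : i' + 0 = j') (a : KoszulPart (SmoothFun E M) V i) :
    (coneDerivation σ).toFun h' ((quasiSmooth σ).d hi a) =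
      (cone (dSigmaDual σ)).d hj ((coneDerivation σ).toFun h a) := by
  obtain rfl : i = j := by omega
  obtain rfl : i' = j' := by omega
  subst hi
  refine Prod.ext ?_ ?_
  · show verticalDerivation rfl (koszulDiff (sigmaPairing σ) rfl a) =
      -((koszulDiff (sigmaPairing σ) rfl).restrictScalars ℝ).rTensor _ (verticalDerivation rfl a)
    rw [verticalDerivation_apply, verticalDerivation_apply, map_sum, ← Finset.sum_neg_distrib]
    refine Finset.sum_congr rfl fun l _ => ?_
    rw [LinearMap.rTensor_tmul, ← TensorProduct.neg_tmul]
    exact congrArg (· ⊗ₜ[ℝ] _) (koszulDiff_anticomm _ _ rfl rfl a)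
  · refine (koszulDeRham_diff exteriorD exteriorD_mul (sigmaPairing σ) rfl a).trans ?_
    show _ = extendLinear (exteriorD ∘ₗ sigmaPairing σ) (i + 1) (verticalDerivation rfl a) + _
    rw [verticalDerivation_apply, map_sum]
    rfl

end ConeDerivation

/-- The composition of a derivation of degree `0` with a map of degree `n`. -/
noncomputable def CInfDerivation.postcomp {A : CInfDGAlgebra.{u}} {M : GrModule.{u, v} A}
    {N : GrModule.{u, w} A} {n : ℤ} (d : CInfDerivation 0 M) (φ : GradedHom n M N) :
    CInfDerivation n N where
  toFun {i j} h := (φ.app h).comp (d.toFun (add_zero i))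
  leibniz {i j k i' j' k'} h hi hj hk h₁ h₂ a b := by
    have e : koszulSign (i' * j) = koszulSign (i * j) * koszulSign (n * j) := by
      rw [← koszulSign_add, ← hi]; ring_nf
    simp only [LinearMap.comp_apply]
    rw [d.leibniz h (add_zero i) (add_zero j) (add_zero k) h h, map_add, GrModule.rsmul, map_smul,
      map_smul, φ.app_smul (by omega : j + i = k) hi hk (by omega), φ.app_smul h hj hk h₂, zero_mul,
      koszulSign_zero, one_smul, smul_smul, GrModule.rsmul, e]
  chain_rule {k} f a := by
    simp only [LinearMap.comp_apply]
    rw [d.chain_rule, map_sum]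
    refine Finset.sum_congr rfl fun i _ => ?_
    rw [φ.app_smul (zero_add 0) (zero_add n) (zero_add n) (zero_add n), mul_zero, koszulSign_zero,
      one_smul]

/-! ### Determination of derivations and of maps from the cone by functions and covectors. -/

section Generators

variable {E : Type u} [NormedAddCommGroup E] [NormedSpace ℝ E]
  {M : Type v} [TopologicalSpace M] [ChartedSpace E M]
  {V : Type w} [NormedAddCommGroup V] [NormedSpace ℝ V] [FiniteDimensional ℝ V]
  {σ : C^∞⟮𝓘(ℝ, E), M; 𝓘(ℝ, V), V⟯}

/-- The inclusion of the covectors as elements of degree `-1` of `B ⊗ ⋀V*`. -/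
noncomputable def koszulCovector {B : Type*} [CommRing B] [Algebra ℝ B] {V : Type*} [AddCommGroup V]
    [Module ℝ V] : Module.Dual ℝ V →ₗ[ℝ] KoszulPart B V (-1) where
  toFun α := ⟨1 ⊗ₜ ExteriorAlgebra.ι ℝ α, by
    have := tmul_mem_koszulPiece 1 (1 : B) (x := ExteriorAlgebra.ι ℝ α)
      (by rw [ExteriorAlgebra.exteriorPower, pow_one]; exact ⟨α, rfl⟩)
    simpa using this⟩
  map_add' α β := Subtype.ext (by
    refine Eq.trans ?_ (TensorProduct.tmul_add _ _ _)
    exact congrArg (TensorProduct.tmul ℝ (1 : B)) (map_add _ _ _))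
  map_smul' c α := Subtype.ext (by
    refine Eq.trans ?_ (TensorProduct.tmul_smul _ _ _)
    exact congrArg (TensorProduct.tmul ℝ (1 : B)) (map_smul _ _ _))

/-- Derivations are determined by their values on functions and covectors. -/
theorem CInfDerivation.eq_of_eq_on_generators {N : GrModule.{max v w, u₁} (quasiSmooth σ)} {n : ℤ}
    {d₁ d₂ : CInfDerivation n N}
    (h0 : ∀ (b : SmoothFun E M), d₁.toFun (zero_add n) (koszulIncl b) =
      d₂.toFun (zero_add n) (koszulIncl b))
    (h1 : ∀ {k : ℤ} (h : -1 + n = k) (α : Module.Dual ℝ V), d₁.toFun h (koszulCovector α) =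
      d₂.toFun h (koszulCovector α)) {i j : ℤ} (h : i + n = j)
    (a : KoszulPart (SmoothFun E M) V i) : d₁.toFun h a = d₂.toFun h a := by
  -- Induction on the exterior degree: `f ⊗ (α ∧ z)` is the product of the covector `α` and `f ⊗ z`,
  -- and the Leibniz rule expresses the value on it by the values on the factors.
  have key : ∀ (k : ℕ) (x : ExteriorAlgebra ℝ (Module.Dual ℝ V)), x ∈ ⋀[ℝ]^k (Module.Dual ℝ V) →
      ∀ (f : SmoothFun E M) {i j : ℤ} (h : i + n = j), i = -k →
      ∀ a : KoszulPart (SmoothFun E M) V i, a.1 = f ⊗ₜ x → d₁.toFun h a = d₂.toFun h a := by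
    intro k
    induction k with
    | zero =>
      intro x hx f i j h hi a ha
      obtain rfl : i = 0 := by simpa using hi
      obtain rfl : n = j := by omega
      rw [ExteriorAlgebra.exteriorPower, pow_zero, Submodule.mem_one] at hx
      obtain ⟨c, rfl⟩ := hx
      have : a = koszulIncl (c • f) := by
        refine Subtype.ext (ha.trans ?_)
        show _ = (c • f) ⊗ₜ[ℝ] (1 : ExteriorAlgebra ℝ (Module.Dual ℝ V))
        rw [Algebra.algebraMap_eq_smul_one, TensorProduct.smul_tmul]
      rw [this]
      exact h0 _
    | succ k ih =>
      intro x hx f i j h hi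
      have hx' := hx
      rw [ExteriorAlgebra.exteriorPower, pow_succ'] at hx'
      induction hx' using Submodule.mul_induction_on' with
      | mem_mul_mem y hy z hz =>
        obtain ⟨α, rfl⟩ := hy
        intro a ha
        have hmul : (-1 : ℤ) + -(k : ℤ) = i := by push_cast at hi; omega
        let b : (quasiSmooth σ).carrier (-(k : ℤ)) := ⟨f ⊗ₜ z, tmul_mem_koszulPiece k f hz⟩
        let c : (quasiSmooth σ).carrier (-1) := koszulCovector α
        have : a = (quasiSmooth σ).mul hmul c b := by
          refine Subtype.ext (ha.trans ?_)
          show _ = (1 ⊗ₜ[ℝ] ExteriorAlgebra.ι ℝ α) * (f ⊗ₜ[ℝ] z)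
          rw [Algebra.TensorProduct.tmul_mul_tmul, one_mul]
        have e1 : d₁.toFun rfl c = d₂.toFun rfl c := h1 rfl α
        have e2 : d₁.toFun rfl b = d₂.toFun rfl b := ih z hz f rfl rfl b rfl
        have e3 : d₁.toFun h ((quasiSmooth σ).mul hmul c b) =
            d₂.toFun h ((quasiSmooth σ).mul hmul c b) := by
          rw [d₁.leibniz hmul rfl rfl h (by omega) (by omega),
            d₂.leibniz hmul rfl rfl h (by omega) (by omega), e1, e2]
        exact (congrArg (d₁.toFun h) this).trans (e3.trans (congrArg (d₂.toFun h) this).symm)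
      | add y hy z hz ihy ihz =>
        intro a ha
        have hmem : ∀ y ∈ ⋀[ℝ]^(k + 1) (Module.Dual ℝ V), f ⊗ₜ y ∈ koszulPiece (SmoothFun E M) V i :=
          fun y hy => hi ▸ tmul_mem_koszulPiece (k + 1) f hy
        have hy' : y ∈ ⋀[ℝ]^(k + 1) (Module.Dual ℝ V) := by
          rwa [ExteriorAlgebra.exteriorPower, pow_succ']
        have hz' : z ∈ ⋀[ℝ]^(k + 1) (Module.Dual ℝ V) := by
          rwa [ExteriorAlgebra.exteriorPower, pow_succ']
        let b : KoszulPart (SmoothFun E M) V i := ⟨f ⊗ₜ y, hmem y hy'⟩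
        let c : KoszulPart (SmoothFun E M) V i := ⟨f ⊗ₜ z, hmem z hz'⟩
        have : a = b + c := Subtype.ext (ha.trans (TensorProduct.tmul_add _ _ _))
        have e1 := ihy hy' b rfl
        have e2 := ihz hz' c rfl
        rw [this]
        exact (map_add (d₁.toFun h) b c).trans ((congrArg₂ (· + ·) e1 e2).trans
          (map_add (d₂.toFun h) b c).symm)
  have : ∃ hx : a.1 ∈ koszulPiece (SmoothFun E M) V i,
      d₁.toFun h ⟨a.1, hx⟩ = d₂.toFun h ⟨a.1, hx⟩ := by
    refine koszulPiece_induction (p := fun x => ∃ hx : x ∈ koszulPiece (SmoothFun E M) V i,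
      d₁.toFun h ⟨x, hx⟩ = d₂.toFun h ⟨x, hx⟩) ⟨zero_mem _, ?_⟩ ?_ (fun k hk f x hx => ?_) a.2
    · exact (map_zero (d₁.toFun h)).trans (map_zero (d₂.toFun h)).symm
    · rintro x y ⟨hx, hpx⟩ ⟨hy, hpy⟩
      exact ⟨add_mem hx hy, (map_add (d₁.toFun h) ⟨x, hx⟩ ⟨y, hy⟩).trans
        ((congrArg₂ (· + ·) hpx hpy).trans (map_add (d₂.toFun h) ⟨x, hx⟩ ⟨y, hy⟩).symm)⟩
    · exact ⟨hk ▸ tmul_mem_koszulPiece k f hx, key k x hx f h hk _ rfl⟩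
  exact this.2

section PullLift

variable {N : GrModule.{max v w, u₁} (quasiSmooth σ)} {T : Type*} [AddCommGroup T]
  [Module (SmoothFun E M) T]

/-- The map `a ⊗ t ↦ a · F(t)`, for a `C^∞(M)`-linear map `F`. -/
noncomputable def pullLift {l : ℤ} (F : T →+ N.carrier l)
    (hF : ∀ (b : SmoothFun E M) (t : T), F (b • t) = N.smul (zero_add l) (koszulIncl b) (F t))
    {i j : ℤ} (h : i + l = j) :
    KoszulPart (SmoothFun E M) V i ⊗[SmoothFun E M] T →ₗ[ℝ] N.carrier j where
  toFun := TensorProduct.liftAddHom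
    (AddMonoidHom.mk' (fun a : KoszulPart (SmoothFun E M) V i => ((N.smul h a).toAddMonoidHom.comp F))
      fun a b => AddMonoidHom.ext fun t => by
        show N.smul h (a + b) (F t) = N.smul h a (F t) + N.smul h b (F t)
        exact LinearMap.map_add₂ (N.smul h) a b (F t))
    (fun b a t => by
      show N.smul h (b • a) (F t) = N.smul h a (F (b • t))
      refine Eq.trans ?_ ((N.mul_smul (add_zero i) h (zero_add l) h a (koszulIncl b) (F t)).trans
        (congrArg (N.smul h a) (hF b t).symm))
      refine congrArg (fun a => N.smul h a (F t)) ?_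
      show b • a = koszulMul (add_zero i) a (koszulIncl b)
      rw [koszulMul_comm _ (zero_add i), koszulMul_incl, mul_zero, koszulSign_zero, one_smul])
  map_add' := map_add _
  map_smul' c x := by
    induction x using TensorProduct.induction_on with
    | zero => simp
    | add x y hx hy => rw [smul_add, map_add, hx, hy, map_add, smul_add]
    | tmul a t => exact LinearMap.map_smul₂ (N.smul h) c a (F t)

theorem pullLift_tmul {l : ℤ} (F : T →+ N.carrier l)
    (hF : ∀ (b : SmoothFun E M) (t : T), F (b • t) = N.smul (zero_add l) (koszulIncl b) (F t))
    {i j : ℤ} (h : i + l = j) (a : KoszulPart (SmoothFun E M) V i) (t : T) :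
    pullLift F hF h (a ⊗ₜ t) = N.smul h a (F t) := rfl

end PullLift

variable [IsManifold 𝓘(ℝ, E) ∞ M]

/-- The degree `k` is a variable that is only propositionally zero, so the value is compared with a
scalar in the total algebra. -/
theorem basisDiff_covector {B : Type*} [CommRing B] [Algebra ℝ B] {V : Type*}
    [AddCommGroup V] [Module ℝ V] [FiniteDimensional ℝ V] {k : ℤ}
    (h' : -1 + 1 = k) (l : Fin (Module.finrank ℝ V)) (α : Module.Dual ℝ V) :
    (basisDiff l h' (koszulCovector α) : KoszulPart B V k).1 = α (Module.finBasis ℝ V l) • 1 := by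
  show koszulD _ (1 ⊗ₜ ExteriorAlgebra.ι ℝ α) = _
  have : contr (Module.finBasis ℝ V l) (ExteriorAlgebra.ι ℝ α) =
      α (Module.finBasis ℝ V l) • (1 : ExteriorAlgebra ℝ (Module.Dual ℝ V)) := by
    rw [← Algebra.algebraMap_eq_smul_one]
    exact CliffordAlgebra.contractLeft_ι (0 : QuadraticForm ℝ (Module.Dual ℝ V)) _ α
  rw [koszulD_constDual, this, TensorProduct.tmul_smul, ← Algebra.TensorProduct.one_def]

theorem koszulMul_basisDiff_covector {B : Type*} [CommRing B] [Algebra ℝ B] {V : Type*}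
    [AddCommGroup V] [Module ℝ V] [FiniteDimensional ℝ V] {i j k : ℤ} (h : i + k = j)
    (h' : -1 + 1 = k) (l : Fin (Module.finrank ℝ V)) (α : Module.Dual ℝ V) (a : KoszulPart B V i) :
    (koszulMul h a (basisDiff l h' (koszulCovector α))).1 = α (Module.finBasis ℝ V l) • a.1 := by
  show a.1 * (basisDiff l h' (koszulCovector α)).1 = _
  rw [basisDiff_covector, mul_smul_comm, mul_one]

theorem exteriorD_one : exteriorD (1 : SmoothFun E M) = 0 := by
  have := exteriorD_mul (1 : SmoothFun E M) 1
  rwa [mul_one, one_smul, left_eq_add] at this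

/-- The first summand of the cone is generated by the differentials of the covectors. -/
theorem cone_inl_eq {i : ℤ} (c : KoszulPart (SmoothFun E M) V (i + 1)) (α : Module.Dual ℝ V) :
    ((c ⊗ₜ[ℝ] α, 0) : (cone (dSigmaDual σ)).carrier i) = koszulSign (i + 1) •
      (cone (dSigmaDual σ)).smul (by omega : (i + 1) + -1 = i) c
        ((coneDerivation σ).toFun (add_zero (-1)) (koszulCovector α)) := by
  refine Prod.ext ?_ ?_
  · show c ⊗ₜ[ℝ] α = koszulSign (i + 1) • koszulSign (i + 1) •
      (koszulMulReal _ c).rTensor _ (verticalDerivation _ (koszulCovector α))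
    rw [smul_smul, koszulSign_mul_self, one_smul, verticalDerivation_apply, map_sum]
    conv_lhs => rw [← (Module.finBasis ℝ V).sum_dual_apply_smul_coord α, TensorProduct.tmul_sum]
    refine Finset.sum_congr rfl fun l _ => ?_
    rw [LinearMap.rTensor_tmul, TensorProduct.tmul_smul, TensorProduct.smul_tmul']
    refine congrArg (· ⊗ₜ[ℝ] _) (Subtype.ext ?_)
    exact (koszulMul_basisDiff_covector (by omega : i + 1 + (-1 + 1) = i + 1) (by norm_num) l α c).symm
  · show 0 = koszulSign (i + 1) • pullSmul _ c (koszulDeRham exteriorD (-1) (koszulCovector α).1)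
    have : (koszulCovector α : KoszulPart (SmoothFun E M) V (-1)) =
        (1 : SmoothFun E M) • koszulCovector α := (one_smul _ _).symm
    rw [this, koszulDeRham_smul_const _ _ ⟨_, rfl⟩, exteriorD_one, TensorProduct.tmul_zero, map_zero,
      smul_zero]

/-- The second summand of the cone is generated by the differentials of the functions. -/
theorem cone_inr_eq {i : ℤ} (c : KoszulPart (SmoothFun E M) V i) (f : SmoothFun E M) :
    ((0, c ⊗ₜ[SmoothFun E M] exteriorD f) : (cone (dSigmaDual σ)).carrier i) =
      (cone (dSigmaDual σ)).smul (add_zero i) c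
        ((coneDerivation σ).toFun (add_zero 0) (koszulIncl f)) := by
  refine Prod.ext ?_ ?_
  · show 0 = koszulSign i • (koszulMulReal _ c).rTensor _ (verticalDerivation _ (koszulIncl f))
    rw [eq_of_pos_degree (by norm_num) (verticalDerivation _ (koszulIncl f)) 0, map_zero, smul_zero]
  · show _ = pullSmul (add_zero i) c (koszulDeRham exteriorD 0 (koszulIncl f).1)
    rw [koszulDeRham_incl, pullSmul_tmul, koszulMul_comm _ (zero_add i), koszulMul_incl, mul_zero,
      koszulSign_zero, one_smul, one_smul]

theorem tmul_smul_eq {R P Q : Type*} [CommSemiring R] [AddCommMonoid P] [AddCommMonoid Q] [Module R P]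
    [Module R Q] (r : R) (x : P) (y : Q) : x ⊗ₜ[R] (r • y) = (r • x) ⊗ₜ[R] y :=
  (TensorProduct.smul_tmul r x y).symm

section ConeHom

variable {N : GrModule.{max v w, u₁} (quasiSmooth σ)} {n : ℤ}
  (φ ψ : GradedHom n (cone (dSigmaDual σ)).toGrModule N)

theorem GradedHom.app_cone_inl {i j k : ℤ} (hj : i + n = j) (hk : -1 + n = k) (h : i + 1 + k = j)
    (c : KoszulPart (SmoothFun E M) V (i + 1)) (α : Module.Dual ℝ V) :
    φ.app hj (c ⊗ₜ[ℝ] α, 0) = koszulSign (i + 1) • koszulSign (n * (i + 1)) • N.smul h c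
      (φ.app hk ((coneDerivation σ).toFun (add_zero (-1)) (koszulCovector α))) :=
  (congrArg (φ.app hj) (cone_inl_eq c α)).trans ((map_smul (φ.app hj) _ _).trans
    (congrArg _ (φ.app_smul _ hk hj h _ _)))

theorem GradedHom.app_cone_inr {i j : ℤ} (hj : i + n = j)
    (c : KoszulPart (SmoothFun E M) V i) (f : SmoothFun E M) :
    φ.app hj (0, c ⊗ₜ[SmoothFun E M] exteriorD f) = koszulSign (n * i) • N.smul hj c
      (φ.app (zero_add n) ((coneDerivation σ).toFun (add_zero 0) (koszulIncl f))) :=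
  (congrArg (φ.app hj) (cone_inr_eq c f)).trans (φ.app_smul _ (zero_add n) hj hj _ _)

theorem GradedHom.app_cone_inr_add {i j : ℤ} (hj : i + n = j)
    (x y : KoszulPart (SmoothFun E M) V i ⊗[SmoothFun E M] OneForms E M) :
    φ.app hj (0, x + y) = φ.app hj (0, x) + φ.app hj (0, y) :=
  map_add ((φ.app hj).comp (LinearMap.inr ℝ _ _)) x y

variable {φ ψ}

/-- Maps from the cone are determined by their values on differentials. -/
theorem cone_hom_ext [FiniteDimensional ℝ E] (Φ : DifferentialFrame.{u, v, u₁} E M)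
    (h1 : ∀ {k : ℤ} (h : -1 + n = k) (α : Module.Dual ℝ V),
      φ.app h ((coneDerivation σ).toFun (add_zero (-1)) (koszulCovector α)) =
        ψ.app h ((coneDerivation σ).toFun (add_zero (-1)) (koszulCovector α)))
    (h0 : ∀ f : SmoothFun E M,
      φ.app (zero_add n) ((coneDerivation σ).toFun (add_zero 0) (koszulIncl f)) =
        ψ.app (zero_add n) ((coneDerivation σ).toFun (add_zero 0) (koszulIncl f))) : φ = ψ := by
  refine GradedHom.ext_app fun {i j} hj m => ?_
  have e1 : ∀ x : KoszulPart (SmoothFun E M) V (i + 1) ⊗[ℝ] Module.Dual ℝ V,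
      φ.app hj (x, 0) = ψ.app hj (x, 0) := by
    have : (φ.app hj).comp (LinearMap.inl ℝ _ _) = (ψ.app hj).comp (LinearMap.inl ℝ _ _) :=
      TensorProduct.ext' fun c α =>
        (φ.app_cone_inl hj rfl (by omega) c α).trans <|
          (congrArg (fun y => koszulSign (i + 1) • koszulSign (n * (i + 1)) •
            N.smul (by omega) c y) (h1 rfl α)).trans (ψ.app_cone_inl hj rfl (by omega) c α).symm
    exact LinearMap.congr_fun this
  have e2 : ∀ x : KoszulPart (SmoothFun E M) V i ⊗[SmoothFun E M] OneForms E M,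
      φ.app hj (0, x) = ψ.app hj (0, x) := by
    intro x
    induction x using TensorProduct.induction_on with
    | zero => exact (map_zero (φ.app hj)).trans (map_zero (ψ.app hj)).symm
    | add x y hx hy => rw [φ.app_cone_inr_add, ψ.app_cone_inr_add, hx, hy]
    | tmul c θ =>
      -- A one-form need not be exact, but the frame writes `θ = ∑ θ(Xₗ) dxₗ`, and the coefficients
      -- can be moved into the left tensor factor.
      have : ∀ χ : GradedHom n (cone (dSigmaDual σ)).toGrModule N, χ.app hj (0, c ⊗ₜ θ) =
          ∑ l, χ.app hj (0, (pairing θ (Φ.field l) • c) ⊗ₜ exteriorD (Φ.coord l)) := by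
        intro χ
        conv_lhs => rw [← Φ.oneForm_eq_sum θ, TensorProduct.tmul_sum]
        refine (map_sum ((χ.app hj).comp (LinearMap.inr ℝ _ _)) _ _).trans ?_
        refine Finset.sum_congr rfl fun l _ => ?_
        exact congrArg (fun y => χ.app hj (0, y)) (tmul_smul_eq _ _ _)
      rw [this, this]
      refine Finset.sum_congr rfl fun l _ => ?_
      exact (φ.app_cone_inr hj _ _).trans ((congrArg (fun y => koszulSign (n * i) •
        N.smul hj (pairing θ (Φ.field l) • c) y) (h0 _)).trans (ψ.app_cone_inr hj _ _).symm)
  have : m = (m.1, 0) + (0, m.2) := Prod.ext (add_zero _).symm (zero_add _).symm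
  rw [this]
  refine (map_add (φ.app hj) _ _).trans (Eq.trans ?_ (map_add (ψ.app hj) _ _).symm)
  exact congrArg₂ (· + ·) (e1 m.1) (e2 m.2)

end ConeHom

end Generators

/-! ### Universality of the cone. -/

section Universal

variable {E : Type u} [NormedAddCommGroup E] [NormedSpace ℝ E]
  {M : Type v} [TopologicalSpace M] [ChartedSpace E M]
  {V : Type w} [NormedAddCommGroup V] [NormedSpace ℝ V] [FiniteDimensional ℝ V]
  {σ : C^∞⟮𝓘(ℝ, E), M; 𝓘(ℝ, V), V⟯} {N : GrModule.{max v w, u₁} (quasiSmooth σ)}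

theorem smul_of_val_eq_smul_one {i j : ℤ} (hi : i = 0) (h : i + j = j)
    (c : ℝ) (a : KoszulPart (SmoothFun E M) V i) (ha : a.1 = c • 1) (m : N.carrier j) :
    N.smul h a m = c • m := by
  subst hi
  have : a = c • koszulIncl 1 := Subtype.ext ha
  rw [this]
  exact ((LinearMap.map_smul₂ (N.smul h) c (koszulIncl 1) m)).trans (congrArg _ (N.one_smul h m))

theorem pullLift_smul {T : Type*} [AddCommGroup T] [Module (SmoothFun E M) T]
    {l : ℤ} (F : T →+ N.carrier l)
    (hF : ∀ (b : SmoothFun E M) (t : T), F (b • t) = N.smul (zero_add l) (koszulIncl b) (F t))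
    {i j ij k jk : ℤ} (h : i + j = ij) (h₂ : ij + l = k) (h₃ : j + l = jk) (h₄ : i + jk = k)
    (a : KoszulPart (SmoothFun E M) V i) (x : KoszulPart (SmoothFun E M) V j ⊗[SmoothFun E M] T) :
    pullLift F hF h₂ (pullSmul h a x) = N.smul h₄ a (pullLift F hF h₃ x) := by
  induction x using TensorProduct.induction_on with
  | zero => simp only [map_zero]
  | add x y hx hy => simp only [map_add, hx, hy]
  | tmul b t => exact N.mul_smul h h₂ h₃ h₄ a b (F t)

/-- The map `a ⊗ u ↦ a · F(u)`, for a linear map `F`. -/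
noncomputable def constLift {U : Type*} [AddCommGroup U] [Module ℝ U] {l : ℤ} (F : U →ₗ[ℝ] N.carrier l)
    {i j : ℤ} (h : i + l = j) : KoszulPart (SmoothFun E M) V i ⊗[ℝ] U →ₗ[ℝ] N.carrier j :=
  TensorProduct.lift (show KoszulPart (SmoothFun E M) V i →ₗ[ℝ] U →ₗ[ℝ] N.carrier j from
    (N.smul h).compl₂ F)

theorem constLift_tmul {U : Type*} [AddCommGroup U] [Module ℝ U] {l : ℤ} (F : U →ₗ[ℝ] N.carrier l)
    {i j : ℤ} (h : i + l = j) (a : KoszulPart (SmoothFun E M) V i) (t : U) :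
    constLift F h (a ⊗ₜ t) = N.smul h a (F t) := rfl

theorem constLift_smul {U : Type*} [AddCommGroup U] [Module ℝ U] {l : ℤ} (F : U →ₗ[ℝ] N.carrier l)
    {i j ij k jk : ℤ} (h : i + j = ij) (h₂ : ij + l = k) (h₃ : j + l = jk) (h₄ : i + jk = k)
    (a : KoszulPart (SmoothFun E M) V i) (x : KoszulPart (SmoothFun E M) V j ⊗[ℝ] U) :
    constLift F h₂ ((koszulMulReal h a).rTensor U x) = N.smul h₄ a (constLift F h₃ x) := by
  induction x using TensorProduct.induction_on with
  | zero => simp only [map_zero]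
  | add x y hx hy => simp only [map_add, hx, hy]
  | tmul b t => exact N.mul_smul h h₂ h₃ h₄ a b (F t)

variable [IsManifold 𝓘(ℝ, E) ∞ M]

/-- The map from the cone with `1 ⊗ α ↦ F₁(α)` and `1 ⊗ θ ↦ F₂(θ)`. -/
noncomputable def coneHom {n k : ℤ} (hk : -1 + n = k) (F₁ : Module.Dual ℝ V →ₗ[ℝ] N.carrier k)
    (F₂ : OneForms E M →+ N.carrier n)
    (hF₂ : ∀ (b : SmoothFun E M) (t : OneForms E M),
      F₂ (b • t) = N.smul (zero_add n) (koszulIncl b) (F₂ t)) :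
    GradedHom n (cone (dSigmaDual σ)).toGrModule N :=
  -- The signs are forced: `(c ⊗ α, 0)` is `(-1)^{i+1} c · dα` and moving a map of degree `n` past
  -- `c` of degree `i + 1` gives `(-1)^{n(i+1)}`. On the second summand only the latter kind of sign
  -- `(-1)^{ni}` occurs.
  ⟨fun q => koszulSign ((n + 1) * (q.src + 1)) • (constLift F₁ (by have := q.eq; omega)).comp
      (LinearMap.fst ℝ _ _) + koszulSign (n * q.src) • (pullLift F₂ hF₂ q.eq).comp
        (LinearMap.snd ℝ _ _), by
    intro i j l j' l' h hj hl h' a m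
    have e1 : constLift F₁ (by omega : l + 1 + k = l') (koszulSign i •
        (koszulMulReal (by omega : i + (j + 1) = l + 1) a).rTensor _ m.1) =
          koszulSign i • N.smul h' a (constLift F₁ (by omega : j + 1 + k = j') m.1) :=
      (map_smul (constLift F₁ _) _ _).trans
        (congrArg _ (constLift_smul F₁ (by omega) (by omega) (by omega) h' a m.1))
    have e2 := pullLift_smul F₂ hF₂ h hl hj h' a m.2
    have e : koszulSign ((n + 1) * (l + 1)) * koszulSign i =
        koszulSign (n * i) * koszulSign ((n + 1) * (j + 1)) := by
      have := koszulSign_mul_self i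
      have e : (n + 1) * (l + 1) = n * i + (n + 1) * (j + 1) + i := by rw [← h]; ring
      rw [e, koszulSign_add, koszulSign_add]
      linear_combination koszulSign (n * i) * koszulSign ((n + 1) * (j + 1)) * this
    have e' : koszulSign (n * l) = koszulSign (n * i) * koszulSign (n * j) := by
      rw [← koszulSign_add, ← h]; ring_nf
    refine (congrArg₂ (fun x y => koszulSign ((n + 1) * (l + 1)) • x + koszulSign (n * l) • y)
      e1 e2).trans ?_
    show _ = koszulSign (n * i) • N.smul h' a (koszulSign ((n + 1) * (j + 1)) • constLift F₁ _ m.1 +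
      koszulSign (n * j) • pullLift F₂ hF₂ hj m.2)
    rw [map_add, map_smul, map_smul, smul_add, smul_smul, smul_smul, smul_smul, e, e']⟩

section ConeHom

variable {n k : ℤ} (hk : -1 + n = k) (F₁ : Module.Dual ℝ V →ₗ[ℝ] N.carrier k)
    (F₂ : OneForms E M →+ N.carrier n)
    (hF₂ : ∀ (b : SmoothFun E M) (t : OneForms E M),
      F₂ (b • t) = N.smul (zero_add n) (koszulIncl b) (F₂ t))

/-- The horizontal part of `dα` vanishes because `d 1 = 0`, and its vertical part is `∑ α(eₗ) ⊗ eˡ`,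
on which `F₁` gives `F₁ α`. -/
theorem coneHom_covector (α : Module.Dual ℝ V) :
    (coneHom (σ := σ) hk F₁ F₂ hF₂).app hk
      ((coneDerivation σ).toFun (add_zero (-1)) (koszulCovector α)) = F₁ α := by
  show koszulSign ((n + 1) * (-1 + 1)) • constLift F₁ _ (verticalDerivation _ (koszulCovector α)) +
    koszulSign (n * -1) • pullLift F₂ hF₂ _
      (koszulDeRham exteriorD (-1) (koszulCovector α : KoszulPart (SmoothFun E M) V (-1)).1) = _
  have : (koszulCovector α : KoszulPart (SmoothFun E M) V (-1)) =
    (1 : SmoothFun E M) • koszulCovector α := (one_smul _ _).symm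
  rw [this, koszulDeRham_smul_const _ _ ⟨_, rfl⟩, exteriorD_one, TensorProduct.tmul_zero, map_zero,
    smul_zero, add_zero, one_smul, (by ring : (n + 1) * (-1 + 1) = 0), koszulSign_zero, one_smul,
    verticalDerivation_apply, map_sum]
  conv_rhs => rw [← (Module.finBasis ℝ V).sum_dual_apply_smul_coord α, map_sum]
  refine Finset.sum_congr rfl fun l _ => ?_
  rw [map_smul, constLift_tmul]
  exact smul_of_val_eq_smul_one (by norm_num) _ _ _ (basisDiff_covector _ l α) _

theorem coneHom_incl (f : SmoothFun E M) :
    (coneHom (σ := σ) hk F₁ F₂ hF₂).app (zero_add n)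
      ((coneDerivation σ).toFun (add_zero 0) (koszulIncl f)) = F₂ (exteriorD f) := by
  show koszulSign ((n + 1) * (0 + 1)) • constLift F₁ _ (verticalDerivation _ (koszulIncl f)) +
    koszulSign (n * 0) • pullLift F₂ hF₂ _
      (koszulDeRham exteriorD 0 (koszulIncl f : KoszulPart (SmoothFun E M) V 0).1) = _
  rw [eq_of_pos_degree (by norm_num) (verticalDerivation _ (koszulIncl f)) 0, map_zero, smul_zero,
    zero_add, mul_zero, koszulSign_zero, one_smul, koszulDeRham_incl, pullLift_tmul]
  exact N.one_smul _ _

end ConeHom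

/-- The part of degree `n` of a graded module, as a module over the functions on `M`. -/
@[reducible] noncomputable def functionModule (N : GrModule.{max v w, u₁} (quasiSmooth σ)) (n : ℤ) :
    Module (SmoothFun E M) (N.carrier n) where
  smul b m := N.smul (zero_add n) (koszulIncl b) m
  one_smul m := N.one_smul (zero_add n) m
  mul_smul b c m := by
    refine Eq.trans ?_ (N.mul_smul (zero_add 0) (zero_add n) (zero_add n) (zero_add n) (koszulIncl b)
      (koszulIncl c) m)
    refine congrArg (fun a => N.smul (zero_add n) a m) ?_
    show koszulIncl (b • c) = koszulMul (zero_add 0) (koszulIncl b) (koszulIncl c)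
    rw [koszulMul_incl, map_smul]
  smul_zero b := map_zero _
  smul_add b := map_add _
  zero_smul m := by
    refine Eq.trans ?_ (LinearMap.map_zero₂ (N.smul (zero_add n)) m)
    exact congrArg (fun a => N.smul (zero_add n) a m) (map_zero koszulIncl)
  add_smul b c m := by
    refine Eq.trans ?_ (LinearMap.map_add₂ (N.smul (zero_add n)) (koszulIncl b) (koszulIncl c) m)
    exact congrArg (fun a => N.smul (zero_add n) a m) (map_add koszulIncl b c)

/-- Restricted to `C^∞(M)`, the derivation takes values in the single module `N_n` over `C^∞(M)`,
and the degree-zero chain rule makes it a `C^∞`-derivation in the classical sense. The frame formula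
then applies. -/
theorem CInfDerivation.incl_eq_sum (Φ : DifferentialFrame.{u, v, u₁} E M) {n : ℤ}
    (d : CInfDerivation n N) (f : SmoothFun E M) : d.toFun (zero_add n) (koszulIncl f) =
      ∑ l, N.smul (zero_add n) (koszulIncl (pairing (exteriorD f) (Φ.field l)))
        (d.toFun (zero_add n) (koszulIncl (Φ.coord l))) := by
  let := functionModule N n
  refine Φ.derivation_eq_sum (D := fun f => d.toFun (zero_add n) (koszulIncl f)) ?_ f
  intro k f a
  have e : ∀ f : CInfFun k, (quasiSmooth σ).op f (fun i => koszulIncl (a i)) =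
      koszulIncl (cinfApply f a) := fun f => by
    show koszulIncl (cinfApply f fun i => koszulBody (koszulIncl (V := V) (a i)).1) = _
    simp only [koszulBody_incl]
  refine (congrArg (d.toFun (zero_add n)) (e f)).symm.trans ((d.chain_rule f _).trans ?_)
  exact Finset.sum_congr rfl fun i _ =>
    congrArg (fun b => N.smul (zero_add n) b _) (e (f.partialDeriv i))

/-- The map of one-forms induced by a derivation. -/
noncomputable def CInfDerivation.oneFormMap (Φ : DifferentialFrame.{u, v, u₁} E M) {n : ℤ}
    (d : CInfDerivation n N) : OneForms E M →+ N.carrier n :=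
  letI := functionModule N n
  -- The derivation prescribes values on exact forms only. The formula `θ ↦ ∑ θ(Xₗ) d(xₗ)` is
  -- `C^∞(M)`-linear on all one-forms and has the prescribed values on exact ones by
  -- `CInfDerivation.incl_eq_sum`.
  ∑ l, ((LinearMap.toSpanSingleton (SmoothFun E M) (N.carrier n)
    (d.toFun (zero_add n) (koszulIncl (Φ.coord l)))).comp (pairing.flip (Φ.field l))).toAddMonoidHom

theorem CInfDerivation.oneFormMap_apply (Φ : DifferentialFrame.{u, v, u₁} E M) {n : ℤ}
    (d : CInfDerivation n N) (θ : OneForms E M) : d.oneFormMap Φ θ =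
      ∑ l, N.smul (zero_add n) (koszulIncl (pairing θ (Φ.field l)))
        (d.toFun (zero_add n) (koszulIncl (Φ.coord l))) := by
  rw [oneFormMap, AddMonoidHom.finsetSum_apply]
  rfl

theorem CInfDerivation.oneFormMap_smul (Φ : DifferentialFrame.{u, v, u₁} E M) {n : ℤ}
    (d : CInfDerivation n N) (b : SmoothFun E M) (θ : OneForms E M) :
    d.oneFormMap Φ (b • θ) = N.smul (zero_add n) (koszulIncl b) (d.oneFormMap Φ θ) := by
  let := functionModule N n
  rw [oneFormMap_apply, oneFormMap_apply, map_sum]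
  refine Finset.sum_congr rfl fun l _ => ?_
  rw [map_smul]
  exact smul_assoc b (pairing θ (Φ.field l)) (d.toFun (zero_add n) (koszulIncl (Φ.coord l)))

/-- The cone of `(dσ)^*` is a module of Kähler differentials. -/
theorem isKahlerDifferentials_cone [FiniteDimensional ℝ E] (σ : C^∞⟮𝓘(ℝ, E), M; 𝓘(ℝ, V), V⟯)
    (Φ : DifferentialFrame.{u, v, u₁} E M) :
    IsKahlerDifferentials.{max v w, u₁, max u v w} (cone (dSigmaDual σ)) (coneDerivation σ) where
  comm := coneDerivation_comm σ
  universal N n d := by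
    let φ := coneHom (σ := σ) rfl ((d.toFun rfl).comp (koszulCovector (B := SmoothFun E M) (V := V)))
      (d.oneFormMap Φ) (d.oneFormMap_smul Φ)
    have hφ : ∀ {i j : ℤ} (h : i + n = j) (a : KoszulPart (SmoothFun E M) V i),
        φ.app h ((coneDerivation σ).toFun (add_zero i) a) = d.toFun h a := by
      -- The composite of the universal derivation with `φ` is again a derivation, so agreement with
      -- `d` has to be checked only on functions and covectors.
      refine CInfDerivation.eq_of_eq_on_generators (d₁ := (coneDerivation σ).postcomp φ)
        (fun b => ?_) fun {k} h α => ?_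
      · exact (coneHom_incl rfl _ _ _ b).trans
          ((d.oneFormMap_apply Φ _).trans (d.incl_eq_sum Φ b).symm)
      · subst h
        exact coneHom_covector rfl _ _ _ α
    refine ⟨φ, fun {i j k} h h' h'' a => ?_, fun ψ hψ => ?_⟩
    · obtain rfl : i = j := by omega
      exact hφ h'' a
    -- Uniqueness: the cone is generated by the differentials of functions and covectors, where both
    -- maps are prescribed.
    · exact cone_hom_ext Φ
        (fun h α => (hψ (add_zero _) h h (koszulCovector α)).trans (hφ h _).symm)
        fun f => (hψ (add_zero _) (zero_add n) (zero_add n) (koszulIncl f)).trans (hφ _ _).symm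

end Universal

/-- All degrees, including the intermediate ones, are free variables tied by equations, so the
defining formula can be used without transport along equalities of integers. -/
theorem internalHom_d_app {A : CInfDGAlgebra.{u}} {M : DGModule.{u, v} A} {N : DGModule.{u, w} A}
    {n k : ℤ} (h : n + 1 = k) (φ : GradedHom n M.toGrModule N.toGrModule) {i i' j l : ℤ}
    (hi : i + n = j) (hj : j + 1 = l) (hi' : i + 1 = i') (hl : i' + n = l) (hk : i + k = l)
    (m : M.carrier i) :
    GradedHom.app (M := M.toGrModule) (N := N.toGrModule) ((internalHom M N).d h φ) hk m =
      N.d hj (φ.app hi m) - koszulSign n • φ.app hl (M.d hi' m) := by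
  subst hi hi'
  rfl

theorem internalHom_smul_app {A : CInfDGAlgebra.{u}} {M : DGModule.{u, v} A} {N : DGModule.{u, w} A}
    {p n k : ℤ} (h : p + n = k) (a : A.carrier p) (φ : GradedHom n M.toGrModule N.toGrModule)
    {i j l : ℤ} (hi : i + n = j) (hj : p + j = l) (hk : i + k = l) (m : M.carrier i) :
    GradedHom.app (M := M.toGrModule) (N := N.toGrModule) ((internalHom M N).smul h a φ) hk m =
      N.smul hj a (φ.app hi m) := by
  subst hi
  rfl

/-! ### The dual of the cone. -/

section Tangent

variable {E : Type u} [NormedAddCommGroup E] [NormedSpace ℝ E]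
  {M : Type v} [TopologicalSpace M] [ChartedSpace E M]
  {V : Type w} [NormedAddCommGroup V] [NormedSpace ℝ V] [FiniteDimensional ℝ V]

/-- This is the recursion for `ι_σ(α ∧ x)` at `x = 1`, where `ι_σ 1 = 0`. It is how `σ` enters the
differential of `dα`. -/
theorem koszulDiff_covector (σ : C^∞⟮𝓘(ℝ, E), M; 𝓘(ℝ, V), V⟯) (α : Module.Dual ℝ V) (h : (-1 : ℤ) + 1 = 0) :
    koszulDiff (sigmaPairing σ) h (koszulCovector α) = koszulIncl (sigmaPairing σ α) := by
  refine Subtype.ext ?_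
  show koszulD (sigmaPairing σ) (1 ⊗ₜ ExteriorAlgebra.ι ℝ α) = sigmaPairing σ α ⊗ₜ 1
  have := koszulD_tmul_ι_mul (sigmaPairing σ) 1 α 1
  have h0 : koszulD (sigmaPairing σ) (1 ⊗ₜ[ℝ] (1 : ExteriorAlgebra ℝ (Module.Dual ℝ V))) = 0 := by
    rw [koszulD_tmul]
    refine Finset.sum_eq_zero fun j _ => ?_
    rw [contr_zero _ (by rw [ExteriorAlgebra.exteriorPower, pow_zero]; exact Submodule.one_le.1 le_rfl),
      TensorProduct.tmul_zero]
  rwa [mul_one, mul_one, h0, mul_zero, sub_zero] at this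

variable [IsManifold 𝓘(ℝ, E) ∞ M]

/-- The contraction of `A_i ⊗ T_M` with a one-form. -/
noncomputable def contractOneForm {i : ℤ} : OneForms E M →ₗ[SmoothFun E M]
    (KoszulPart (SmoothFun E M) V i ⊗[SmoothFun E M] VectorFields E M) →ₗ[SmoothFun E M]
      KoszulPart (SmoothFun E M) V i where
  toFun θ := (TensorProduct.rid _ _).toLinearMap.comp ((pairing θ).lTensor _)
  map_add' θ η := by rw [map_add, LinearMap.lTensor_add, LinearMap.comp_add]
  map_smul' b θ := by rw [map_smul, LinearMap.lTensor_smul, LinearMap.comp_smul]; rfl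

theorem contractOneForm_tmul {i : ℤ} (θ : OneForms E M) (a : KoszulPart (SmoothFun E M) V i)
    (W : VectorFields E M) : contractOneForm θ (a ⊗ₜ W) = pairing θ W • a := by
  show TensorProduct.rid (SmoothFun E M) _ (a ⊗ₜ pairing θ W) = _
  exact TensorProduct.rid_tmul _ _

/-- The contraction of `A_i ⊗ V` with a covector. -/
noncomputable def contractCovector {i : ℤ} : Module.Dual ℝ V →ₗ[ℝ]
    (KoszulPart (SmoothFun E M) V i ⊗[ℝ] V) →ₗ[ℝ] KoszulPart (SmoothFun E M) V i where
  toFun α := (TensorProduct.rid _ _).toLinearMap.comp (α.lTensor _)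
  map_add' α β := by rw [LinearMap.lTensor_add, LinearMap.comp_add]
  map_smul' c α := by rw [LinearMap.lTensor_smul, LinearMap.comp_smul]; rfl

theorem contractCovector_tmul {i : ℤ} (α : Module.Dual ℝ V) (a : KoszulPart (SmoothFun E M) V i)
    (x : V) : contractCovector α (a ⊗ₜ x) = α x • a := by
  show TensorProduct.rid ℝ _ (a ⊗ₜ α x) = _
  exact TensorProduct.rid_tmul _ _

variable (σ : C^∞⟮𝓘(ℝ, E), M; 𝓘(ℝ, V), V⟯)

section Components

variable {σ} {n : ℤ}
  (φ : GradedHom n (cone (dSigmaDual σ)).toGrModule (DGModule.self (quasiSmooth σ)).toGrModule)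

/-- The value of a map from the cone on the differential of a function. -/
noncomputable def evalFun (f : SmoothFun E M) : KoszulPart (SmoothFun E M) V n :=
  φ.app (zero_add n) ((coneDerivation σ).toFun (add_zero 0) (koszulIncl f))

/-- The value of a map from the cone on the differential of a covector. -/
noncomputable def evalCovector {k : ℤ} (h : -1 + n = k) :
    Module.Dual ℝ V →ₗ[ℝ] KoszulPart (SmoothFun E M) V k :=
  (φ.app h).comp (((coneDerivation σ).toFun (add_zero (-1))).comp
    (koszulCovector (B := SmoothFun E M) (V := V)))

/-- The composite of `φ` with the universal derivation is a derivation, so the frame expands it. -/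
theorem evalFun_eq_sum (Φ : DifferentialFrame.{u, v, max v w} E M) (f : SmoothFun E M) :
    evalFun φ f = ∑ l, pairing (exteriorD f) (Φ.field l) • evalFun φ (Φ.coord l) := by
  refine (((coneDerivation σ).postcomp φ).incl_eq_sum Φ f).trans ?_
  exact Finset.sum_congr rfl fun l _ => koszulMul_incl (zero_add n) _ _

/-- The term `φ ∘ δ` drops out, because `δ` vanishes on functions for degree reasons and hence on
their differentials. -/
theorem evalFun_d {k : ℤ} (h : n + 1 = k) (f : SmoothFun E M) :
    evalFun (σ := σ) (((internalHom (cone (dSigmaDual σ)) (DGModule.self (quasiSmooth σ))).d h φ :)) f =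
      koszulDiff (sigmaPairing σ) h (evalFun φ f) := by
  refine (internalHom_d_app h φ (zero_add n) h (zero_add 1) (by omega) (zero_add k) _).trans ?_
  rw [← coneDerivation_comm σ (zero_add 1) (zero_add 1) (add_zero 0) (add_zero 1)]
  have : (quasiSmooth σ).d (zero_add 1) (koszulIncl f) = 0 := koszulPart_eq_zero one_pos _
  rw [this, map_zero, map_zero, smul_zero, sub_zero]
  rfl

/-- Here `φ ∘ δ` survives: `δ(dα) = d⟨σ, α⟩` in the cone, and this produces the `dσ` term of the
cocone. -/
theorem evalCovector_d {k l : ℤ} (h : n + 1 = k) (hl : -1 + n = l) (hk : -1 + k = n) (hn : l + 1 = n)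
    (α : Module.Dual ℝ V) :
    evalCovector (σ := σ)
      (((internalHom (cone (dSigmaDual σ)) (DGModule.self (quasiSmooth σ))).d h φ :)) hk α =
        koszulDiff (sigmaPairing σ) hn (evalCovector φ hl α) -
          koszulSign n • evalFun φ (sigmaPairing σ α) := by
  let c : (quasiSmooth σ).carrier (-1) := koszulCovector α
  have e : (quasiSmooth σ).d (neg_add_cancel 1) c = koszulIncl (sigmaPairing σ α) :=
    koszulDiff_covector σ α (neg_add_cancel 1)
  have e1 : (cone (dSigmaDual σ)).d (neg_add_cancel 1) ((coneDerivation σ).toFun (add_zero (-1)) c) =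
      (coneDerivation σ).toFun (add_zero 0) (koszulIncl (sigmaPairing σ α)) :=
    (coneDerivation_comm σ (neg_add_cancel 1) (neg_add_cancel 1) (add_zero _) (add_zero 0) c).symm.trans
      (congrArg _ e)
  refine (internalHom_d_app h φ hl hn (neg_add_cancel 1) (zero_add n) hk _).trans ?_
  exact congrArg (fun y => (DGModule.self (quasiSmooth σ)).d hn (evalCovector φ hl α) -
    koszulSign n • φ.app (zero_add n) y) e1

/-- The element of `A_• ⊗ T_M` corresponding to a map from the cone. -/
noncomputable def horizontalPart (Φ : DifferentialFrame.{u, v, max v w} E M) :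
    KoszulPart (SmoothFun E M) V n ⊗[SmoothFun E M] VectorFields E M :=
  ∑ l, evalFun φ (Φ.coord l) ⊗ₜ Φ.field l

/-- The element of `A_• ⊗ V` corresponding to a map from the cone. -/
noncomputable def verticalPart {k : ℤ} (h : -1 + n = k) : KoszulPart (SmoothFun E M) V k ⊗[ℝ] V :=
  -- The sign accounts for the shift `V_X[-1]`: it turns the plain action on maps into the signed
  -- action on the shift, and the differential `δ ∘ φ - (-1)ⁿ φ ∘ δ` into `dσ - δ`.
  koszulSign n • ∑ l, evalCovector φ h ((Module.finBasis ℝ V).coord l) ⊗ₜ Module.finBasis ℝ V l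

/-- Applying `dσ` to `∑ φ(dxₗ) ⊗ Xₗ` gives coefficients `∑ Xₗ⟨σ, eʲ⟩ φ(dxₗ)`, which the frame
collects into `φ(d⟨σ, eʲ⟩)`. -/
theorem contractLinear_horizontalPart (Φ : DifferentialFrame.{u, v, max v w} E M) :
    contractLinear (derivSigma σ) n (horizontalPart φ Φ) =
      ∑ l, evalFun φ (sigmaPairing σ ((Module.finBasis ℝ V).coord l)) ⊗ₜ[ℝ] Module.finBasis ℝ V l := by
  refine (map_sum (contractLinear (derivSigma σ) n) _ _).trans ?_
  simp only [contractLinear_tmul]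
  rw [Finset.sum_comm]
  refine Finset.sum_congr rfl fun l _ => ?_
  rw [evalFun_eq_sum φ Φ (sigmaPairing σ _), TensorProduct.sum_tmul]
  rfl

/-- With the sign `(-1)^{n+1}` of the new degree, the two terms of `evalCovector_d` become `dσ` of
the horizontal part and minus the differential of the vertical part. -/
theorem verticalPart_d (Φ : DifferentialFrame.{u, v, max v w} E M) {k l : ℤ} (h : n + 1 = k)
    (hl : -1 + n = l) (hk : -1 + k = n) (hn : l + 1 = n) :
    verticalPart (σ := σ)
      (((internalHom (cone (dSigmaDual σ)) (DGModule.self (quasiSmooth σ))).d h φ :)) hk =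
        contractLinear (derivSigma σ) n (horizontalPart φ Φ) -
          ((koszulDiff (sigmaPairing σ) hn).restrictScalars ℝ).rTensor V (verticalPart φ hl) := by
  have e : koszulSign k = -koszulSign n := by rw [← h, koszulSign_add, koszulSign_one, mul_neg_one]
  rw [contractLinear_horizontalPart]
  show koszulSign k • ∑ j, evalCovector (σ := σ)
    (((internalHom (cone (dSigmaDual σ)) (DGModule.self (quasiSmooth σ))).d h φ :)) hk
      ((Module.finBasis ℝ V).coord j) ⊗ₜ Module.finBasis ℝ V j = _ - LinearMap.rTensor V _
        (koszulSign n • ∑ j, evalCovector φ hl ((Module.finBasis ℝ V).coord j) ⊗ₜ Module.finBasis ℝ V j)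
  simp only [evalCovector_d φ h hl hk hn, e, map_smul, map_sum, LinearMap.rTensor_tmul,
    TensorProduct.sub_tmul, Finset.sum_sub_distrib, ← TensorProduct.smul_tmul', ← Finset.smul_sum,
    smul_sub, neg_smul, smul_smul, neg_mul, koszulSign_mul_self, one_smul, sub_neg_eq_add,
    LinearMap.coe_restrictScalars]
  abel

end Components

/-- The map from the cone to the functions that corresponds to an element of the cocone. -/
noncomputable def homOfCocone {n : ℤ}
    (x : (KoszulPart (SmoothFun E M) V n ⊗[SmoothFun E M] VectorFields E M) ×
      (KoszulPart (SmoothFun E M) V (n - 1) ⊗[ℝ] V)) :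
    GradedHom n (cone (dSigmaDual σ)).toGrModule (DGModule.self (quasiSmooth σ)).toGrModule :=
  coneHom (by omega : -1 + n = n - 1)
    (show Module.Dual ℝ V →ₗ[ℝ] KoszulPart (SmoothFun E M) V (n - 1) from
      -- The same sign as in `verticalPart`, which is its own inverse.
      koszulSign n • contractCovector.flip x.2)
    (show OneForms E M →+ KoszulPart (SmoothFun E M) V n from
      (contractOneForm.flip x.1).toAddMonoidHom)
    (fun b θ => ((contractOneForm.flip x.1).map_smul b θ).trans (koszulMul_incl (zero_add n) _ _).symm)

theorem evalFun_homOfCocone {n : ℤ} (x : (KoszulPart (SmoothFun E M) V n ⊗[SmoothFun E M]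
    VectorFields E M) × (KoszulPart (SmoothFun E M) V (n - 1) ⊗[ℝ] V)) (f : SmoothFun E M) :
    evalFun (homOfCocone σ x) f = contractOneForm (exteriorD f) x.1 :=
  coneHom_incl _ _ _ _ f

theorem evalCovector_homOfCocone {n : ℤ} (x : (KoszulPart (SmoothFun E M) V n ⊗[SmoothFun E M]
    VectorFields E M) × (KoszulPart (SmoothFun E M) V (n - 1) ⊗[ℝ] V)) (h : -1 + n = n - 1)
    (α : Module.Dual ℝ V) :
    evalCovector (homOfCocone σ x) h α = koszulSign n • contractCovector α x.2 :=
  coneHom_covector _ _ _ _ α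

/-- This is the expansion `W = ∑ dxₗ(W) Xₗ` of vector fields, tensored with `A_i`. It makes an
element recoverable from its contractions with the `dxₗ`. -/
theorem sum_contractOneForm_tmul [FiniteDimensional ℝ E] (Φ : DifferentialFrame.{u, v, max v w} E M)
    {i : ℤ} (m : KoszulPart (SmoothFun E M) V i ⊗[SmoothFun E M] VectorFields E M) :
    ∑ l, contractOneForm (exteriorD (Φ.coord l)) m ⊗ₜ[SmoothFun E M] Φ.field l = m := by
  induction m using TensorProduct.induction_on with
  | zero => simp only [map_zero, TensorProduct.zero_tmul, Finset.sum_const_zero]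
  | add x y hx hy =>
    simp only [map_add, TensorProduct.add_tmul, Finset.sum_add_distrib]
    rw [hx, hy]
  | tmul a W =>
    conv_rhs => rw [← Φ.vectorField_eq_sum W, TensorProduct.tmul_sum]
    refine Finset.sum_congr rfl fun l _ => ?_
    rw [contractOneForm_tmul, tmul_smul_eq]

theorem sum_contractCovector_tmul {i : ℤ} (y : KoszulPart (SmoothFun E M) V i ⊗[ℝ] V) :
    ∑ l, contractCovector ((Module.finBasis ℝ V).coord l) y ⊗ₜ[ℝ] Module.finBasis ℝ V l = y := by
  induction y using TensorProduct.induction_on with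
  | zero => simp only [map_zero, TensorProduct.zero_tmul, Finset.sum_const_zero]
  | add x y hx hy =>
    simp only [map_add, TensorProduct.add_tmul, Finset.sum_add_distrib]
    rw [hx, hy]
  | tmul a x =>
    conv_rhs => rw [← (Module.finBasis ℝ V).sum_repr x, TensorProduct.tmul_sum]
    refine Finset.sum_congr rfl fun l _ => ?_
    rw [contractCovector_tmul, tmul_smul_eq]
    rfl

theorem contractCovector_sum {i : ℤ} (F : Module.Dual ℝ V →ₗ[ℝ] KoszulPart (SmoothFun E M) V i)
    (α : Module.Dual ℝ V) : contractCovector α (∑ l, F ((Module.finBasis ℝ V).coord l) ⊗ₜ[ℝ]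
      Module.finBasis ℝ V l) = F α := by
  rw [map_sum]
  simp only [contractCovector_tmul]
  exact sum_coord F α

/-- The isomorphism of the dual of the cone of `(dσ)^*` with the cocone of `dσ`, in degree `n`. -/
noncomputable def dualConeEquiv [FiniteDimensional ℝ E] (Φ : DifferentialFrame.{u, v, max v w} E M)
    (n : ℤ) : GradedHom n (cone (dSigmaDual σ)).toGrModule (DGModule.self (quasiSmooth σ)).toGrModule
      ≃ₗ[ℝ] (KoszulPart (SmoothFun E M) V n ⊗[SmoothFun E M] VectorFields E M) ×
        (KoszulPart (SmoothFun E M) V (n - 1) ⊗[ℝ] V) where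
  toFun φ := (horizontalPart φ Φ, verticalPart φ (by omega))
  map_add' φ ψ := by
    refine Prod.ext ?_ ?_
    · show ∑ l, (evalFun φ (Φ.coord l) + evalFun ψ (Φ.coord l)) ⊗ₜ Φ.field l = _ + _
      simp only [TensorProduct.add_tmul, Finset.sum_add_distrib]
      rfl
    · show koszulSign n • ∑ l, (evalCovector φ _ ((Module.finBasis ℝ V).coord l) +
        evalCovector ψ _ ((Module.finBasis ℝ V).coord l)) ⊗ₜ Module.finBasis ℝ V l = _ + _
      simp only [TensorProduct.add_tmul, Finset.sum_add_distrib, smul_add]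
      rfl
  map_smul' c φ := by
    refine Prod.ext ?_ ?_
    · show ∑ l, (c • evalFun φ (Φ.coord l)) ⊗ₜ Φ.field l = c • horizontalPart φ Φ
      simp only [← TensorProduct.smul_tmul', ← Finset.smul_sum]
      rfl
    · show koszulSign n • ∑ l, (c • evalCovector φ _ ((Module.finBasis ℝ V).coord l)) ⊗ₜ
        Module.finBasis ℝ V l = c • verticalPart φ _
      simp only [← TensorProduct.smul_tmul', ← Finset.smul_sum, smul_comm _ c]
      rfl
  invFun := homOfCocone σ
  left_inv φ := by
    -- Two maps from the cone are compared on the differentials of covectors and functions, where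
    -- the dual bases of `V` and the frame recover the value of `φ`.
    refine cone_hom_ext Φ (fun {k} h α => ?_) fun f => ?_
    · obtain rfl : k = n - 1 := by omega
      refine (evalCovector_homOfCocone σ _ h α).trans ?_
      show koszulSign n • contractCovector α (koszulSign n • _) = evalCovector φ h α
      rw [map_smul, smul_smul, koszulSign_mul_self, one_smul, contractCovector_sum]
    · refine (evalFun_homOfCocone σ _ f).trans (Eq.trans ?_ (evalFun_eq_sum φ Φ f).symm)
      show contractOneForm (exteriorD f) (∑ l, _) = _
      rw [map_sum]
      exact Finset.sum_congr rfl fun l _ => contractOneForm_tmul _ _ _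
  right_inv x := by
    refine Prod.ext ?_ ?_
    · show ∑ l, evalFun (homOfCocone σ x) (Φ.coord l) ⊗ₜ Φ.field l = x.1
      simp only [evalFun_homOfCocone]
      exact sum_contractOneForm_tmul Φ x.1
    · show koszulSign n • ∑ l, evalCovector (homOfCocone σ x) _ ((Module.finBasis ℝ V).coord l) ⊗ₜ
        Module.finBasis ℝ V l = x.2
      simp only [evalCovector_homOfCocone, ← TensorProduct.smul_tmul', ← Finset.smul_sum]
      rw [smul_smul, koszulSign_mul_self, one_smul, sum_contractCovector_tmul]

/-- The dual of the cone of `(dσ)^*` is the cocone of `dσ`. -/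
noncomputable def dualConeIso [FiniteDimensional ℝ E] (Φ : DifferentialFrame.{u, v, max v w} E M) :
    DGIso (tangentModule (cone (dSigmaDual σ))) (cocone (dSigma σ)) where
  equiv n := dualConeEquiv σ Φ n
  map_smul {i j k} h a φ := by
    refine Prod.ext ?_ ?_
    · have e : ∀ f, evalFun (σ := σ) (((tangentModule (cone (dSigmaDual σ))).smul h a φ :)) f =
          koszulMul h a (evalFun φ f) := fun f =>
        internalHom_smul_app h a φ (zero_add j) h (zero_add k) _
      show ∑ l, evalFun (σ := σ) (((tangentModule (cone (dSigmaDual σ))).smul h a φ :)) (Φ.coord l) ⊗ₜ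
        Φ.field l = pullSmul h a (∑ l, evalFun φ (Φ.coord l) ⊗ₜ Φ.field l)
      rw [map_sum]
      exact Finset.sum_congr rfl fun l _ => congrArg (· ⊗ₜ[SmoothFun E M] _) (e _)
    · have e : ∀ α, evalCovector (σ := σ) (((tangentModule (cone (dSigmaDual σ))).smul h a φ :))
          (by omega : -1 + k = k - 1) α = koszulMul (by omega : i + (j - 1) = k - 1) a
            (evalCovector φ (by omega : -1 + j = j - 1) α) := fun α =>
        internalHom_smul_app h a φ (by omega) (by omega) (by omega) _
      show koszulSign k • ∑ l, evalCovector (σ := σ)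
        (((tangentModule (cone (dSigmaDual σ))).smul h a φ :)) _ ((Module.finBasis ℝ V).coord l) ⊗ₜ
          Module.finBasis ℝ V l = koszulSign i • (koszulMulReal (by omega : i + (j - 1) = k - 1) a).rTensor V
            (koszulSign j • ∑ l, evalCovector φ (by omega : -1 + j = j - 1)
              ((Module.finBasis ℝ V).coord l) ⊗ₜ Module.finBasis ℝ V l)
      rw [map_smul, smul_smul, ← koszulSign_add, h, map_sum]
      exact congrArg _ (Finset.sum_congr rfl fun l _ => congrArg (· ⊗ₜ[ℝ] _) (e _))
  map_d {n k} h φ := by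
    -- The second component of the cocone in degree `k` lies in degree `k - 1`. Writing `n` in this
    -- form makes the degrees of the two sides coincide literally.
    obtain rfl : n = k - 1 := by omega
    refine Prod.ext ?_ ?_
    · show ∑ l, evalFun (σ := σ) (((tangentModule (cone (dSigmaDual σ))).d h φ :)) (Φ.coord l) ⊗ₜ
        Φ.field l = pullDiff (sigmaPairing σ) h (∑ l, evalFun φ (Φ.coord l) ⊗ₜ Φ.field l)
      rw [map_sum]
      exact Finset.sum_congr rfl fun l _ => congrArg (· ⊗ₜ[SmoothFun E M] _) (evalFun_d φ h _)
    · exact verticalPart_d φ Φ h (by omega) (by omega) (by omega)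

end Tangent

end DGManifold

theorem proposition4
    {E : Type u} [NormedAddCommGroup E] [NormedSpace ℝ E] [FiniteDimensional ℝ E]
    {M : Type v} [TopologicalSpace M] [T2Space M] [SecondCountableTopology M]
    [ChartedSpace E M] [IsManifold 𝓘(ℝ, E) ∞ M]
    {V : Type w} [NormedAddCommGroup V] [NormedSpace ℝ V] [FiniteDimensional ℝ V]
    (σ : C^∞⟮𝓘(ℝ, E), M; 𝓘(ℝ, V), V⟯) :
    (∃ d : CInfDerivation 0 (cone (dSigmaDual σ)).toGrModule,
      IsKahlerDifferentials.{max v w, max u v w, max u v w} (cone (dSigmaDual σ)) d) ∧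
    ∀ (Ω : DGModule.{max v w, max u v w} (quasiSmooth σ)) (d : CInfDerivation 0 Ω.toGrModule),
      IsKahlerDifferentials.{max v w, max u v w, max u v w} Ω d →
        Nonempty (DGIso Ω (cone (dSigmaDual σ))) ∧
        Nonempty (DGIso (tangentModule Ω) (cocone (dSigma σ))) := by
  -- Together with second countability this makes `M` σ-compact, as the frame requires.
  have : LocallyCompactSpace M := ChartedSpace.locallyCompactSpace E M
  obtain ⟨Φ⟩ := nonempty_differentialFrame.{u, v, max u v w} E M
  -- A frame computes derivations into modules of one fixed universe. `Φ` serves the test modules of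
  -- the universal property and `Ψ` the values in `C^∞(X)` itself.
  obtain ⟨Ψ⟩ := nonempty_differentialFrame.{u, v, max v w} E M
  have hcone := isKahlerDifferentials_cone σ Φ
  refine ⟨⟨coneDerivation σ, hcone⟩, fun Ω d hd => ?_⟩
  have hiso := hd.nonempty_iso hcone
  exact ⟨hiso, hiso.map fun e => (e.internalHom _).trans (dualConeIso σ Ψ)⟩
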